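/- **Koch chain.** Let $T$ be the triangle with vertices $(-1,0),(0,-1),(1,0)$. The Koch chain $K_1$ consists of these three points. For $s>1$, a Koch chain $K_s$ consists of two copies of $K_{s-1}$, each flattened along the vertical direction and then moved by an orientation-preserving similarity (translation, rotation, scaling) so that its endpoints $(\pm1,0)$ become the endpoints of the edge from $(-1,0)$ to $(0,-1)$, respectively of the edge from $(0,-1)$ to $(1,0)$, and its other points lie on the inner side of that edge. The copies have to be sufficiently flat: in each copy the order of the points along the edge is their order along the $x$-axis, all points except the three vertices lie in the interior of $T$, and no segment joining a point of the left copy with a point of the right copy, both different from $(0,-1)$, has a third point of $K_s$ on it or vertically above it. (Such $K_s$ exist for every $s\ge1$; any sufficiently small flattening factors may be used in each step, and the two copies may come from different realizations of $K_{s-1}$.) **Dual Koch arrangement.** $K^*_s$ is the arrangement of the $2^s+1$ lines $y=ax-b$ with $(a,b)\in K_s$. Its faces are the connected components of the complement of the union of the lines. The edges of a face are the segments and rays that bound it. **Lemma.** For every $s\ge 1$ a Koch chain $K_s$ exists, and for every Koch chain $K_s$ the faces of $K^*_s$ are as follows. - There is a unique infinite face without upper boundary, and it has $3$ edges. - There is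 a unique infinite face without lower boundary, and it has $2$ edges. - Each of the remaining infinite faces is unbounded towards exactly one of the two sides, left and right. Among those unbounded towards the left, exactly $s-1$ have $4$ edges, and all others have $2$ or $3$ edges. - Among those unbounded towards the right, exactly $s-1$ have $4$ edges, and all others have $2$ or $3$ edges. - Among the finite faces, exactly $3\cdot 2^{s-1}-2s-1$ have $5$ edges, and all others have $3$ or $4$ edges. -/

import Mathlib

noncomputable section

namespace Koch

/-- The left vertex of the initial triangle. -/
def leftVertex : ℝ × ℝ := (-1, 0)

/-- The bottom vertex of the initial triangle. -/
def bottomVertex : ℝ × ℝ := (0, -1)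

/-- The right vertex of the initial triangle. -/
def rightVertex : ℝ × ℝ := (1, 0)

/-- The three vertices of the initial triangle. -/
def triangle : Set (ℝ × ℝ) := {leftVertex, bottomVertex, rightVertex}

/-- Flatten by the factor `ε` along the vertical direction, `(x, y) ↦ (x, ε y)`, and then apply
the orientation-preserving similarity of the plane (translation, rotation and scaling) that sends
`(-1, 0)` to `u` and `(1, 0)` to `v`. With `d = (v - u) / 2` and `d'` the vector `d` turned
counterclockwise by a right angle, this is `(x, y) ↦ (u + v) / 2 + x d + ε y d'`. -/
def flatCopy (u v : ℝ × ℝ) (ε : ℝ) (p : ℝ × ℝ) : ℝ × ℝ :=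
  ((u.1 + v.1) / 2 + p.1 * ((v.1 - u.1) / 2) - ε * p.2 * ((v.2 - u.2) / 2),
   (u.2 + v.2) / 2 + p.1 * ((v.2 - u.2) / 2) + ε * p.2 * ((v.1 - u.1) / 2))

/-- The flattened copy on the edge from the left to the bottom vertex. The endpoints `(-1, 0)` and
`(1, 0)` go to the bottom and to the left vertex: this is the rotation which puts the points of a
chain, which lie below the axis, on the inner side of that edge. -/
def leftCopy (ε : ℝ) : ℝ × ℝ → ℝ × ℝ := flatCopy bottomVertex leftVertex ε

/-- The flattened copy on the edge from the bottom to the right vertex, on its inner side. -/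
def rightCopy (ε : ℝ) : ℝ × ℝ → ℝ × ℝ := flatCopy rightVertex bottomVertex ε

/-- The upper shadow of the segment `ab`: the points on the segment or vertically above it. -/
def upperShadow (a b : ℝ × ℝ) : Set (ℝ × ℝ) :=
  {z | ∃ w ∈ segment ℝ a b, w.1 = z.1 ∧ w.2 ≤ z.2}

/-- The copies of `P` and `Q`, flattened by `ε` and `δ` and placed on the two lower edges of the
triangle, are sufficiently flat. -/
structure SufficientlyFlat (P Q : Set (ℝ × ℝ)) (ε δ : ℝ) : Prop where
  /-- The order of the points of the left copy along its edge is their order along the x-axis. -/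
  left_order : ∀ p ∈ P, ∀ q ∈ P, p.1 < q.1 → (leftCopy ε q).1 < (leftCopy ε p).1
  /-- The order of the points of the right copy along its edge is their order along the x-axis. -/
  right_order : ∀ p ∈ Q, ∀ q ∈ Q, p.1 < q.1 → (rightCopy δ q).1 < (rightCopy δ p).1
  /-- All points but the three vertices are in the interior of the triangle. -/
  inside : ∀ z ∈ leftCopy ε '' P ∪ rightCopy δ '' Q, z ∉ triangle →
    z ∈ interior (convexHull ℝ triangle)
  /-- No segment between a point of the left copy and a point of the right copy, other than the
  common bottom vertex, has a third point in its upper shadow. -/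
  shadow : ∀ a ∈ leftCopy ε '' P, ∀ c ∈ rightCopy δ '' Q, a ≠ bottomVertex → c ≠ bottomVertex →
    ∀ b ∈ leftCopy ε '' P ∪ rightCopy δ '' Q, b ≠ a → b ≠ c → b ∉ upperShadow a c

/-- `IsKochChain s K`: the point set `K` is a Koch chain `K_s` (with `s ≥ 1`). The flattening of
the two copies of `K_{s-1}` in each step is arbitrary, as long as it is sufficient, and the two
copies may stem from different realizations of `K_{s-1}`. -/
inductive IsKochChain : ℕ → Set (ℝ × ℝ) → Prop
  | base : IsKochChain 1 triangle
  | step (s : ℕ) (P Q : Set (ℝ × ℝ)) (ε δ : ℝ) (hP : IsKochChain s P) (hQ : IsKochChain s Q)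
      (hε : 0 < ε) (hδ : 0 < δ) (hflat : SufficientlyFlat P Q ε δ) :
      IsKochChain (s + 1) (leftCopy ε '' P ∪ rightCopy δ '' Q)

/-- The line `y = a x - b` dual to the point `(a, b)`. -/
def dualLine (p : ℝ × ℝ) : Set (ℝ × ℝ) := {z | z.2 = p.1 * z.1 - p.2}

/-- The faces of the arrangement of the lines dual to the points of `K`: the connected components
of the complement of the union of the lines. -/
def faces (K : Set (ℝ × ℝ)) : Set (Set (ℝ × ℝ)) :=
  {F | ∃ z ∈ (⋃ p ∈ K, dualLine p)ᶜ, F = connectedComponentIn (⋃ p ∈ K, dualLine p)ᶜ z}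

/-- The edges (segments, rays or lines) of a face `F`, which is a convex region: the intersections
with more than one point of its closure with a line of the arrangement. -/
def edges (K F : Set (ℝ × ℝ)) : Set (Set (ℝ × ℝ)) :=
  {e | ∃ p ∈ K, e = closure F ∩ dualLine p ∧ e.Nontrivial}

/-- The number of edges of a face. -/
def numEdges (K F : Set (ℝ × ℝ)) : ℕ∞ := (edges K F).encard

/-- The face has no upper boundary: no vertical ray going up from a point of `F` leaves `F`. -/
def NoUpperBoundary (F : Set (ℝ × ℝ)) : Prop :=
  ∀ z ∈ F, ∀ t : ℝ, 0 ≤ t → (z.1, z.2 + t) ∈ F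

/-- The face has no lower boundary: no vertical ray going down from a point of `F` leaves `F`. -/
def NoLowerBoundary (F : Set (ℝ × ℝ)) : Prop :=
  ∀ z ∈ F, ∀ t : ℝ, 0 ≤ t → (z.1, z.2 - t) ∈ F

/-- The finite faces. -/
def finiteFaces (K : Set (ℝ × ℝ)) : Set (Set (ℝ × ℝ)) :=
  {F ∈ faces K | Bornology.IsBounded F}

/-- The infinite faces that have both an upper and a lower boundary. -/
def sideFaces (K : Set (ℝ × ℝ)) : Set (Set (ℝ × ℝ)) :=
  {F ∈ faces K | ¬ Bornology.IsBounded F ∧ ¬ NoUpperBoundary F ∧ ¬ NoLowerBoundary F}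

/-- Those of them that are unbounded towards the left. -/
def leftFaces (K : Set (ℝ × ℝ)) : Set (Set (ℝ × ℝ)) :=
  {F ∈ sideFaces K | ¬ BddBelow (Prod.fst '' F)}

/-- Those of them that are unbounded towards the right. -/
def rightFaces (K : Set (ℝ × ℝ)) : Set (Set (ℝ × ℝ)) :=
  {F ∈ sideFaces K | ¬ BddAbove (Prod.fst '' F)}

end Koch

end

/-! A point `z` is above the line dual to `p` exactly when `p` is above the line dual to `z`. Hence
a face is determined by the set `A` of points of `K` whose dual lines are below it, and the sets
that occur are those cut off from above by a line. In general position such a line can be moved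
until it is close to a line through two points of `K`; this is the definition of `separable`. Two
faces share an edge on the line dual to `p` when their sets differ in `p` only, so the number of
edges of a face is the degree of `A` in the graph on the separable sets whose steps toggle one point
(`GeneralPosition.faces_eq`, `GeneralPosition.numEdges_cell`). The faces unbounded to the right and
to the left come from the initial and the final parts of `K` in the order of abscissas; `∅` and `K`
give the faces without lower and without upper boundary.

The rest is a recursion for this graph. A flattened copy preserves orientation but reverses the
order of abscissas, so it exchanges above and below. Complementation followed by the copy is
therefore an isomorphism of the graphs, and it keeps initial parts initial (`IsFlip.flippedCounts`).
Let `K` be the union of two copies `L` and `R` that share the point `m`. By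
`Halves.mem_separable_iff` a separable set contains `R \ {m}` and is separable within `L`, or
symmetrically, or it is crossing: an initial part of `L` and a final part of `R`, each half missing
a point other than `m`. The degrees follow. A crossing set has at most two neighbours from each
half. A set that contains `R \ {m}` but misses a point of `L` other than `m` keeps its degree in
`L`, plus one if it meets `L` in an initial part. For `K` and `K \ {m}` the two degrees add up,
minus one for the shared `m`.

In a copy, `∅` has degree 3 and the full set has degree 2. So `K` gets 2 + 2 - 1 = 3 and `K \ {m}`
gets 3 + 3 - 1 = 5, while `L \ {m}` gets 3 + 1 = 4 and is the only new initial part of degree 4. The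
finite pentagons are `K \ {m}`, those inherited from the halves, and the sets whose trace on one
half is an initial (for `L`) or final (for `R`) part of degree 4, raised by one. With r = s - 1 this
gives N(r+1) = 2 N(r) + 2r + 1 and N(0) = 0, thus N(r) = 3·2^r - 2r - 3. -/

noncomputable section
namespace Koch
open scoped symmDiff

/-! ### Separable sets of a chain composed of two halves -/

variable {α : Type*}

/-- `A` is an initial part of `K` in the order given by `key`. -/
def Lower (key : α → ℝ) (K A : Set α) : Prop :=
  A ⊆ K ∧ ∀ p ∈ A, ∀ q ∈ K, key q < key p → q ∈ A

/-- `A` is a final part of `K` in the order given by `key`. -/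
def Upper (key : α → ℝ) (K A : Set α) : Prop :=
  A ⊆ K ∧ ∀ p ∈ A, ∀ q ∈ K, key p < key q → q ∈ A

lemma lower_neg (key : α → ℝ) (K A : Set α) :
    Lower (fun p => -key p) K A ↔ Upper key K A := by
  simp [Lower, Upper]

lemma upper_neg (key : α → ℝ) (K A : Set α) :
    Upper (fun p => -key p) K A ↔ Lower key K A := by
  simp [Lower, Upper]

lemma mem_toggle (A : Set α) (p q : α) : q ∈ A ∆ {p} ↔ (q ∈ A ↔ q ≠ p) := by
  rw [Set.mem_symmDiff, Set.mem_singleton_iff]; tauto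

/-- The subsets of `K` cut out from above by a line close to a line `ij` through two points of
`K`, where `above i j k` means that `k` is above the line `ij`. -/
def separable (above : α → α → α → Prop) (K : Set α) : Set (Set α) :=
  {A | A ⊆ K ∧ ∃ i ∈ K, ∃ j ∈ K, i ≠ j ∧
    ∀ k ∈ K, k ≠ i → k ≠ j → (k ∈ A ↔ above i j k)}

/-- The number of separable sets that differ from `A` in a single element. -/
def degree (above : α → α → α → Prop) (K A : Set α) : ℕ∞ :=
  {p ∈ K | A ∆ {p} ∈ separable above K}.encard

section Neighbours

variable {key : α → ℝ} {L B : Set α}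

/-- Only the least element can be added to the empty initial part. -/
lemma encard_lower_toggle_empty (hfin : L.Finite) (inj : Set.InjOn key L) (hL : L.Nonempty) :
    {p ∈ L | Lower key L ((∅ : Set α) ∆ {p})}.encard = 1 := by
  obtain ⟨a, ha, hmin⟩ := Set.exists_min_image L key hfin hL
  rw [Set.encard_eq_one]
  refine ⟨a, ?_⟩
  ext p
  simp only [Set.mem_ofPred_eq, Set.mem_singleton_iff, Lower, Set.subset_def, mem_toggle]
  constructor
  · rintro ⟨hp, h1, h2⟩
    by_contra hne
    have hlt : key a < key p := lt_of_le_of_ne (hmin p hp) fun h => hne (inj ha hp h).symm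
    have := h2 p (by simp) a ha hlt
    simp at this; exact hne this.symm
  · rintro rfl
    refine ⟨ha, by simp [ha], ?_⟩
    intro q hq r hr hlt
    simp at hq; subst hq
    exact absurd hlt (not_lt.2 (hmin r hr))

/-- Initial parts are linearly ordered by inclusion: the neighbours of a proper nonempty one arise
by dropping its greatest element or adding the least missing one. -/
lemma encard_lower_toggle (hfin : L.Finite) (inj : Set.InjOn key L) (hB : Lower key L B)
    (hne : B ≠ L) (h0 : B.Nonempty) : {p ∈ L | Lower key L (B ∆ {p})}.encard = 2 := by
  have hss : (L \ B).Nonempty := by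
    by_contra h
    rw [Set.not_nonempty_iff_eq_empty, Set.sdiff_eq_empty] at h
    exact hne (hB.1.antisymm h)
  obtain ⟨a, ha, hmin⟩ := Set.exists_min_image (L \ B) key (hfin.subset Set.sdiff_subset) hss
  obtain ⟨b, hb, hmax⟩ := Set.exists_max_image B key (hfin.subset hB.1) h0
  rw [Set.encard_eq_two]
  have hbL := hB.1 hb
  have hab : b ≠ a := fun h => ha.2 (h ▸ hb)
  refine ⟨b, a, hab, ?_⟩
  have hkey : ∀ x ∈ B, ∀ y ∈ L, y ∉ B → key x < key y := by
    intro x hx y hy hyB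
    rcases lt_trichotomy (key x) (key y) with h | h | h
    · exact h
    · exact absurd (inj (hB.1 hx) hy h ▸ hx) hyB
    · exact absurd (hB.2 x hx y hy h) hyB
  ext p
  simp only [Set.mem_ofPred_eq, Set.mem_singleton_iff, Set.mem_insert_iff, Lower, Set.subset_def,
    mem_toggle]
  constructor
  · rintro ⟨hp, -, h2⟩
    by_contra! hne
    by_cases hpB : p ∈ B
    · have hlt : key p < key b := lt_of_le_of_ne (hmax p hpB) fun h => hne.1 (inj hp hbL h)
      have := h2 b (by simp [hb, hne.1.symm]) p hp hlt
      simp [hpB] at this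
    · have hlt : key a < key p := lt_of_le_of_ne (hmin p ⟨hp, hpB⟩)
        fun h => hne.2 (inj ha.1 hp h).symm
      have := h2 p (by simp [hpB]) a ha.1 hlt
      simp [ha.2] at this; exact hne.2 this.symm
  · rintro (rfl | rfl)
    · refine ⟨hbL, fun x hx => ?_, fun x hx y hy hxy => ?_⟩
      · by_cases h : x = p
        · exact h ▸ hbL
        · exact hB.1 (hx.2 h)
      · by_cases h : x = p
        · subst h; simp [hb] at hx
        · have hxB := hx.2 h
          have hyB := hB.2 x hxB y hy hxy
          simp only [hyB, true_iff]
          rintro rfl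
          exact absurd hxy (not_lt.2 (hmax x hxB))
    · refine ⟨ha.1, fun x hx => ?_, fun x hx y hy hxy => ?_⟩
      · by_cases h : x = p
        · exact h ▸ ha.1
        · exact hB.1 (hx.2 h)
      · have hyp : ∀ y ∈ L, y ≠ p → key y < key p → y ∈ B := by
          intro y hy hyp h
          by_contra hyB
          exact absurd h (not_lt.2 (hmin y ⟨hy, hyB⟩))
        by_cases h : x = p
        · subst h
          have h1 : y ≠ x := by rintro rfl; exact lt_irrefl _ hxy
          simp [h1, hyp y hy h1 hxy]
        · have hxB := hx.2 h
          have hyB := hB.2 x hxB y hy hxy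
          simp only [hyB, true_iff]
          rintro rfl
          exact ha.2 hyB

end Neighbours

/-- The combinatorics of two chains `L` and `R` which share the point `m` and are placed such that
every point strictly between a point of `L` and a point of `R` is below their segment. -/
structure Halves (key : α → ℝ) (above : α → α → α → Prop) (L R : Set α) (m : α) : Prop where
  finL : L.Finite
  finR : R.Finite
  mL : m ∈ L
  mR : m ∈ R
  ltL : ∀ l ∈ L, l ≠ m → key l < key m
  gtR : ∀ r ∈ R, r ≠ m → key m < key r
  injL : Set.InjOn key L
  injR : Set.InjOn key R
  exL : ∀ p, ∃ l ∈ L, l ≠ m ∧ l ≠ p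
  exR : ∀ p, ∃ r ∈ R, r ≠ m ∧ r ≠ p
  comm : ∀ i j k, above i j k ↔ above j i k
  mixed : ∀ a ∈ L, ∀ c ∈ R, a ≠ m → c ≠ m → ∀ b ∈ L ∪ R, key a < key b → key b < key c →
    ¬ above a c b ∧ above a b c ∧ above b c a
  lowerL : ∀ A, Lower key L A → A ∈ separable above L
  upperL : ∀ A, Upper key L A → A ∈ separable above L
  lowerR : ∀ A, Lower key R A → A ∈ separable above R
  upperR : ∀ A, Upper key R A → A ∈ separable above R

namespace Halves

variable {key : α → ℝ} {above : α → α → α → Prop} {L R A B : Set α} {m p : α}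

/-- The mirror image. Negating `key` exchanges initial and final parts, so every statement about the
left half also serves for the right half. -/
lemma symm (h : Halves key above L R m) : Halves (fun p => -key p) above R L m where
  finL := h.finR
  finR := h.finL
  mL := h.mR
  mR := h.mL
  ltL r hr hne := neg_lt_neg (h.gtR r hr hne)
  gtR l hl hne := neg_lt_neg (h.ltL l hl hne)
  injL a ha b hb hab := h.injR ha hb (neg_injective hab)
  injR a ha b hb hab := h.injL ha hb (neg_injective hab)
  exL := h.exR
  exR := h.exL
  comm := h.comm
  mixed a ha c hc ham hcm b hb hab hbc := by
    obtain ⟨h1, h2, h3⟩ := h.mixed c hc a ha hcm ham b (Set.union_comm R L ▸ hb)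
      (neg_lt_neg_iff.1 hbc) (neg_lt_neg_iff.1 hab)
    rw [h.comm a c b, h.comm a b c, h.comm b c a]
    exact ⟨h1, h3, h2⟩
  lowerL A hA := h.upperR A ((lower_neg _ _ _).1 hA)
  upperL A hA := h.lowerR A ((upper_neg _ _ _).1 hA)
  lowerR A hA := h.upperL A ((lower_neg _ _ _).1 hA)
  upperR A hA := h.lowerL A ((upper_neg _ _ _).1 hA)

lemma not_mem_right (h : Halves key above L R m) {l : α} (hl : l ∈ L) (hne : l ≠ m) : l ∉ R :=
  fun hr => lt_asymm (h.ltL l hl hne) (h.gtR l hr hne)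

lemma not_mem_left (h : Halves key above L R m) {r : α} (hr : r ∈ R) (hne : r ≠ m) : r ∉ L :=
  fun hl => lt_asymm (h.ltL r hl hne) (h.gtR r hr hne)

lemma le_of_left (h : Halves key above L R m) {l : α} (hl : l ∈ L) : key l ≤ key m := by
  by_cases hne : l = m
  · rw [hne]
  · exact (h.ltL l hl hne).le

lemma le_of_right (h : Halves key above L R m) {r : α} (hr : r ∈ R) : key m ≤ key r := by
  by_cases hne : r = m
  · rw [hne]
  · exact (h.gtR r hr hne).le

/-- `A` is cut out by a line that has points of both halves other than `m` above itself. -/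
def Crossing (key : α → ℝ) (L R : Set α) (m : α) (A : Set α) : Prop :=
  Lower key L (A ∩ L) ∧ Upper key R (A ∩ R) ∧ (∃ i ∈ L, i ≠ m ∧ i ∉ A) ∧ ∃ k ∈ R, k ≠ m ∧ k ∉ A

lemma crossing_neg : Crossing (fun p => -key p) R L m A ↔ Crossing key L R m A := by
  simp only [Crossing, lower_neg, upper_neg]; tauto

/-- `m` is the last point of `L`, so an initial part of `L` containing it would miss nothing. -/
lemma Crossing.not_mem (h : Halves key above L R m) (hA : Crossing key L R m A) : m ∉ A := by
  obtain ⟨h1, -, ⟨i, hi, him, hiA⟩, -⟩ := hA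
  exact fun hm => hiA (h1.2 m ⟨hm, h.mL⟩ i hi (h.ltL i hi him)).1

/-- Subsets that are cut out by a line through two points of the left half. -/
lemma separable_of_left (h : Halves key above L R m) (hA : A ⊆ L ∪ R) (hR : R \ {m} ⊆ A)
    (hL : A ∩ L ∈ separable above L) : A ∈ separable above (L ∪ R) := by
  obtain ⟨-, i, hi, j, hj, hij, hk⟩ := hL
  refine ⟨hA, i, Or.inl hi, j, Or.inl hj, hij, fun k hkK hki hkj => ?_⟩
  by_cases hkL : k ∈ L
  · rw [← hk k hkL hki hkj]; exact ⟨fun h => ⟨h, hkL⟩, fun h => h.1⟩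
  · have hkR : k ∈ R := hkK.resolve_left hkL
    have hkm : k ≠ m := fun h' => hkL (h' ▸ h.mL)
    refine iff_of_true (hR ⟨hkR, hkm⟩) ?_
    rcases lt_or_gt_of_ne (fun h' => hij (h.injL hi hj h') : key i ≠ key j) with hlt | hlt
    · have him : i ≠ m := by
        rintro rfl; exact absurd hlt (not_lt.2 (h.le_of_left hj))
      exact (h.mixed i hi k hkR him hkm j (Or.inl hj) hlt
        ((h.le_of_left hj).trans_lt (h.gtR k hkR hkm))).2.1
    · have hjm : j ≠ m := by
        rintro rfl; exact absurd hlt (not_lt.2 (h.le_of_left hi))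
      rw [h.comm]
      exact (h.mixed j hj k hkR hjm hkm i (Or.inl hi) hlt
        ((h.le_of_left hi).trans_lt (h.gtR k hkR hkm))).2.1

/-- The line joins the first missing point of `L` to the last missing point of `R`. The points
between them are below it and not in `A`; those outside are above it and in `A`. -/
lemma separable_of_crossing (h : Halves key above L R m) (hA : A ⊆ L ∪ R)
    (hc : Crossing key L R m A) : A ∈ separable above (L ∪ R) := by
  obtain ⟨h1, h2, ⟨i, hi, him, hiA⟩, k, hk, hkm, hkA⟩ := hc
  obtain ⟨a, ⟨haL, haA⟩, hmin⟩ := Set.exists_min_image (L \ A) key (h.finL.subset Set.sdiff_subset)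
    ⟨i, hi, hiA⟩
  obtain ⟨c, ⟨hcR, hcA⟩, hmax⟩ := Set.exists_max_image (R \ A) key (h.finR.subset Set.sdiff_subset)
    ⟨k, hk, hkA⟩
  have ham : key a < key m := (hmin i ⟨hi, hiA⟩).trans_lt (h.ltL i hi him)
  have hcm : key m < key c := (h.gtR k hk hkm).trans_le (hmax k ⟨hk, hkA⟩)
  have ham' : a ≠ m := by rintro rfl; exact lt_irrefl _ ham
  have hcm' : c ≠ m := by rintro rfl; exact lt_irrefl _ hcm
  refine ⟨hA, a, Or.inl haL, c, Or.inr hcR, ?_, fun b hb hba hbc => ?_⟩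
  · rintro rfl; exact lt_asymm ham hcm
  have hbA : (key a < key b → key b < key c → b ∉ A) := by
    intro hab hbc hbA
    rcases hb with hb | hb
    · exact haA (h1.2 b ⟨hbA, hb⟩ a haL hab).1
    · exact hcA (h2.2 b ⟨hbA, hb⟩ c hcR hbc).1
  rcases lt_or_ge (key b) (key a) with hlt | hge
  · have hbL : b ∈ L := by
      by_contra hbL
      exact lt_asymm ((h.le_of_right (hb.resolve_left hbL)).trans_lt hlt) ham
    have hbm : b ≠ m := by rintro rfl; exact lt_asymm ham hlt
    refine iff_of_true ?_ ?_
    · by_contra hbA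
      exact absurd hlt (not_lt.2 (hmin b ⟨hbL, hbA⟩))
    · exact (h.mixed b hbL c hcR hbm hcm' a (Or.inl haL) hlt (ham.trans hcm)).2.2
  rcases lt_or_ge (key c) (key b) with hlt | hge'
  · have hbR : b ∈ R := by
      by_contra hbR
      exact lt_asymm (hlt.trans_le (h.le_of_left (hb.resolve_right hbR))) hcm
    have hbm : b ≠ m := by rintro rfl; exact lt_asymm hcm hlt
    refine iff_of_true ?_ ?_
    · by_contra hbA
      exact absurd hlt (not_lt.2 (hmax b ⟨hbR, hbA⟩))
    · exact (h.mixed a haL b hbR ham' hbm c (Or.inr hcR) (ham.trans hcm) hlt).2.1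
  have hab : key a < key b := by
    refine lt_of_le_of_ne hge fun he => ?_
    rcases hb with hb | hb
    · exact hba (h.injL hb haL he.symm)
    · exact absurd ((h.le_of_right hb).trans_eq he.symm) (not_le.2 ham)
  have hbc' : key b < key c := by
    refine lt_of_le_of_ne hge' fun he => ?_
    rcases hb with hb | hb
    · exact absurd (he.symm.trans_le (h.le_of_left hb)) (not_le.2 hcm)
    · exact hbc (h.injR hb hcR he)
  exact iff_of_false (hbA hab hbc') (h.mixed a haL c hcR ham' hcm' b hb hab hbc').1

/-- By `mixed`, every point of `R` except `m` is above a line through two points of `L`. -/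
lemma left_of_separable (h : Halves key above L R m) {i j : α}
    (hi : i ∈ L) (hj : j ∈ L) (hij : i ≠ j)
    (hk : ∀ k ∈ L ∪ R, k ≠ i → k ≠ j → (k ∈ A ↔ above i j k)) :
    R \ {m} ⊆ A ∧ A ∩ L ∈ separable above L := by
  refine ⟨?_, Set.inter_subset_right, i, hi, j, hj, hij, fun k hkL hki hkj => ?_⟩
  · rintro k ⟨hkR, hkm⟩
    have hkL := h.not_mem_left hkR hkm
    rw [hk k (Or.inr hkR) (fun h' => hkL (h' ▸ hi)) (fun h' => hkL (h' ▸ hj))]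
    rcases lt_or_gt_of_ne (fun h' => hij (h.injL hi hj h') : key i ≠ key j) with hlt | hlt
    · have him : i ≠ m := by
        rintro rfl; exact absurd hlt (not_lt.2 (h.le_of_left hj))
      exact (h.mixed i hi k hkR him hkm j (Or.inl hj) hlt
        ((h.le_of_left hj).trans_lt (h.gtR k hkR hkm))).2.1
    · have hjm : j ≠ m := by
        rintro rfl; exact absurd hlt (not_lt.2 (h.le_of_left hi))
      rw [h.comm]
      exact (h.mixed j hj k hkR hjm hkm i (Or.inl hi) hlt
        ((h.le_of_left hi).trans_lt (h.gtR k hkR hkm))).2.1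
  · rw [← hk k (Or.inl hkL) hki hkj]; exact ⟨fun h => h.1, fun h => ⟨h, hkL⟩⟩

/-- On the left half, the points before `i` are above the line `ij` and those after `i` are below
it; only the membership of `i` itself is free, and either choice leaves an initial part. -/
lemma cross_of_separable (h : Halves key above L R m) {i j : α}
    (hi : i ∈ L) (hj : j ∈ R) (him : i ≠ m) (hjm : j ≠ m)
    (hk : ∀ k ∈ L ∪ R, k ≠ i → k ≠ j → (k ∈ A ↔ above i j k)) :
    Lower key L (A ∩ L) := by
  refine ⟨Set.inter_subset_right, ?_⟩
  rintro p ⟨hpA, hpL⟩ q hqL hqp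
  refine ⟨?_, hqL⟩
  have hjL := h.not_mem_left hj hjm
  have hpi : key p ≤ key i := by
    by_contra! hlt
    have hpj : key p < key j := (h.le_of_left hpL).trans_lt (h.gtR j hj hjm)
    refine (h.mixed i hi j hj him hjm p (Or.inl hpL) hlt hpj).1 ?_
    rwa [← hk p (Or.inl hpL) (by rintro rfl; exact lt_irrefl _ hlt)
      (by rintro rfl; exact lt_irrefl _ hpj)]
  have hqi := hqp.trans_le hpi
  have hij : key i < key j := (h.ltL i hi him).trans (h.gtR j hj hjm)
  have hqm : q ≠ m := by
    rintro rfl; exact absurd hqp (not_lt.2 (h.le_of_left hpL))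
  rw [hk q (Or.inl hqL) (by rintro rfl; exact lt_irrefl _ hqi) (by rintro rfl; exact hjL hqL)]
  exact (h.mixed q hqL j hj hqm hjm i (Or.inl hi) hqi hij).2.2

/-- The classification behind all degree computations; the three alternatives correspond to the two
defining points lying both in `L`, both in `R`, or in different halves, up to overlaps. -/
lemma mem_separable_iff (h : Halves key above L R m) :
    A ∈ separable above (L ∪ R) ↔ A ⊆ L ∪ R ∧
      ((R \ {m} ⊆ A ∧ A ∩ L ∈ separable above L) ∨ (L \ {m} ⊆ A ∧ A ∩ R ∈ separable above R) ∨
        Crossing key L R m A) := by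
  constructor
  · rintro ⟨hA, i, hi, j, hj, hij, hk⟩
    refine ⟨hA, ?_⟩
    have key' : ∀ i ∈ L, ∀ j ∈ R, i ≠ m → j ≠ m →
        (∀ k ∈ L ∪ R, k ≠ i → k ≠ j → (k ∈ A ↔ above i j k)) →
        ((R \ {m} ⊆ A ∧ A ∩ L ∈ separable above L) ∨ (L \ {m} ⊆ A ∧ A ∩ R ∈ separable above R) ∨
          Crossing key L R m A) := by
      intro i hi j hj him hjm hk
      have hl := h.cross_of_separable hi hj him hjm hk
      have hr := h.symm.cross_of_separable (A := A) hj hi hjm him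
        (fun k hkK h1 h2 => by rw [hk k (Set.union_comm R L ▸ hkK) h2 h1, h.comm])
      rw [lower_neg] at hr
      -- A line through both halves need not give a crossing set, since the free end points may
      -- complete a half. The set then belongs to one of the first two types, because initial and
      -- final parts of a half are separable in it.
      by_cases h1 : R \ {m} ⊆ A
      · exact Or.inl ⟨h1, h.lowerL _ hl⟩
      by_cases h2 : L \ {m} ⊆ A
      · exact Or.inr (Or.inl ⟨h2, h.upperR _ hr⟩)
      simp only [Set.not_subset] at h1 h2
      obtain ⟨k, hk, hkA⟩ := h1
      obtain ⟨l, hl', hlA⟩ := h2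
      exact Or.inr (Or.inr ⟨hl, hr, ⟨l, hl'.1, hl'.2, hlA⟩, k, hk.1, hk.2, hkA⟩)
    have hk' : ∀ k ∈ L ∪ R, k ≠ j → k ≠ i → (k ∈ A ↔ above j i k) :=
      fun k hkK h1 h2 => by rw [hk k hkK h2 h1, h.comm]
    have hRR : i ∈ R → j ∈ R → (L \ {m} ⊆ A ∧ A ∩ R ∈ separable above R) := fun h1 h2 =>
      h.symm.left_of_separable h1 h2 hij
        (fun k hkK => hk k (Set.union_comm R L ▸ hkK))
    by_cases hiL : i ∈ L <;> by_cases hjL : j ∈ L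
    · exact Or.inl (h.left_of_separable hiL hjL hij hk)
    · have hjR := hj.resolve_left hjL
      by_cases him : i = m
      · exact Or.inr (Or.inl (hRR (him ▸ h.mR) hjR))
      · exact key' i hiL j hjR him (fun h' => hjL (h' ▸ h.mL)) hk
    · have hiR := hi.resolve_left hiL
      by_cases hjm : j = m
      · exact Or.inr (Or.inl (hRR hiR (hjm ▸ h.mR)))
      · exact key' j hjL i hiR hjm (fun h' => hiL (h' ▸ h.mL)) hk'
    · exact Or.inr (Or.inl (hRR (hi.resolve_left hiL) (hj.resolve_left hjL)))
  · rintro ⟨hA, ⟨h1, h2⟩ | ⟨h1, h2⟩ | hc⟩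
    · exact h.separable_of_left hA h1 h2
    · rw [Set.union_comm]
      exact h.symm.separable_of_left (by rwa [Set.union_comm]) h1 h2
    · exact h.separable_of_crossing hA hc

end Halves
end Koch
end

/-! ### Degrees in a union of two halves -/

noncomputable section
namespace Koch
open scoped symmDiff
namespace Halves

variable {α : Type*}
variable {key : α → ℝ} {above : α → α → α → Prop} {L R A B : Set α} {m p : α}

lemma toggle_inter_of_mem (hp : p ∈ L) : (A ∆ {p}) ∩ L = (A ∩ L) ∆ {p} := by
  ext q
  simp only [Set.mem_inter_iff, mem_toggle]
  by_cases hq : q = p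
  · subst hq; simp [hp]
  · simp [hq]

lemma toggle_inter_of_notMem (hp : p ∉ L) : (A ∆ {p}) ∩ L = A ∩ L := by
  ext q
  simp only [Set.mem_inter_iff, mem_toggle]
  by_cases hq : q = p
  · subst hq; simp [hp]
  · simp [hq]

lemma toggle_subset (hA : A ⊆ L) (hp : p ∈ L) : A ∆ {p} ⊆ L := by
  intro q hq
  by_cases h : q = p
  · exact h ▸ hp
  · exact hA (((mem_toggle _ _ _).1 hq).2 h)

lemma lower_of_sdiff_subset (h : Halves key above L R m) (hB : B ⊆ L) (hm : L \ {m} ⊆ B) :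
    Lower key L B := by
  refine ⟨hB, fun p hp q hq hqp => hm ⟨hq, ?_⟩⟩
  rintro rfl
  exact absurd hqp (not_lt.2 (h.le_of_left (hB hp)))

/-- The sets that contain the right half are governed by the left half. -/
lemma separable_iff_left (h : Halves key above L R m) (hA : A ⊆ L ∪ R) (hR : R \ {m} ⊆ A) :
    A ∈ separable above (L ∪ R) ↔ A ∩ L ∈ separable above L := by
  rw [h.mem_separable_iff]
  constructor
  · rintro ⟨-, h1 | ⟨h1, -⟩ | hc⟩
    · exact h1.2
    · exact h.lowerL _ (h.lower_of_sdiff_subset Set.inter_subset_right fun q hq => ⟨h1 hq, hq.1⟩)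
    · obtain ⟨-, -, -, k, hk, hkm, hkA⟩ := hc
      exact absurd (hR ⟨hk, hkm⟩) hkA
  · exact fun h1 => ⟨hA, Or.inl ⟨hR, h1⟩⟩

lemma toggle_separable_iff_left (h : Halves key above L R m) (hA : A ⊆ L ∪ R) (hR : R \ {m} ⊆ A)
    (hp : p ∈ L) : A ∆ {p} ∈ separable above (L ∪ R) ↔ (A ∩ L) ∆ {p} ∈ separable above L := by
  rw [h.separable_iff_left (toggle_subset hA (Or.inl hp)), toggle_inter_of_mem hp]
  intro q hq
  rw [mem_toggle]
  refine iff_of_true (hR hq) ?_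
  rintro rfl
  exact h.not_mem_left hq.1 hq.2 hp

/-- Removing a point of `R` other than `m` while the left half still misses `i` rules out the first
two types, so the new set has to be crossing. -/
lemma toggle_separable_iff_right (h : Halves key above L R m) (hA : A ⊆ L ∪ R)
    (hR : R \ {m} ⊆ A) (hi : ∃ i ∈ L, i ≠ m ∧ i ∉ A) (hp : p ∈ R) (hpm : p ≠ m) :
    A ∆ {p} ∈ separable above (L ∪ R) ↔
      Lower key L (A ∩ L) ∧ Upper key R ((A ∩ R) ∆ {p}) := by
  have hpL := h.not_mem_left hp hpm
  have hpA : p ∉ A ∆ {p} := by simp [mem_toggle, hR ⟨hp, hpm⟩]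
  obtain ⟨i, hi, him, hiA⟩ := hi
  have hiA' : i ∉ A ∆ {p} := by
    rw [mem_toggle]
    have : i ≠ p := by rintro rfl; exact hpL hi
    simp [hiA, this]
  rw [h.mem_separable_iff]
  constructor
  · rintro ⟨-, ⟨h1, -⟩ | ⟨h1, -⟩ | ⟨h1, h2, -⟩⟩
    · exact absurd (h1 ⟨hp, hpm⟩) hpA
    · exact absurd (h1 ⟨hi, him⟩) hiA'
    · rw [toggle_inter_of_notMem hpL] at h1
      rw [toggle_inter_of_mem hp] at h2
      exact ⟨h1, h2⟩
  · rintro ⟨h1, h2⟩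
    refine ⟨toggle_subset hA (Or.inr hp), Or.inr (Or.inr ⟨?_, ?_, ⟨i, hi, him, hiA'⟩,
      p, hp, hpm, hpA⟩)⟩
    · rwa [toggle_inter_of_notMem hpL]
    · rwa [toggle_inter_of_mem hp]

lemma degree_union (h : Halves key above L R m) : degree above (L ∪ R) A =
    {p ∈ L | A ∆ {p} ∈ separable above (L ∪ R)}.encard +
      {p ∈ R | p ≠ m ∧ A ∆ {p} ∈ separable above (L ∪ R)}.encard := by
  rw [degree, ← Set.encard_union_eq]
  · congr 1
    ext p
    simp only [Set.mem_ofPred_eq, Set.mem_union]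
    constructor
    · rintro ⟨hp, h1⟩
      by_cases hpL : p ∈ L
      · exact Or.inl ⟨hpL, h1⟩
      · exact Or.inr ⟨hp.resolve_left hpL, fun h' => hpL (h' ▸ h.mL), h1⟩
    · tauto
  · rw [Set.disjoint_left]
    rintro p ⟨h1, -⟩ ⟨h2, h3, -⟩
    exact h.not_mem_left h2 h3 h1

lemma encard_upper_toggle_empty (h : Halves key above L R m) :
    {p ∈ R | Upper key R ((∅ : Set α) ∆ {p})}.encard = 1 := by
  have := encard_lower_toggle_empty h.symm.finL h.symm.injL ⟨m, h.mR⟩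
  simpa only [lower_neg] using this

lemma encard_upper_toggle (h : Halves key above L R m) (hB : Upper key R B) (hne : B ≠ R)
    (h0 : B.Nonempty) : {p ∈ R | Upper key R (B ∆ {p})}.encard = 2 := by
  have := encard_lower_toggle h.symm.finL h.symm.injL ((lower_neg _ _ _).2 hB) hne h0
  simpa only [lower_neg] using this

/-- A neighbour obtained by removing a point of `R` would be crossing, which needs an initial part
on the left; so all neighbours come from `L`. -/
lemma degree_of_not_lower (h : Halves key above L R m) (hA : A ⊆ L ∪ R) (hR : R \ {m} ⊆ A)
    (hi : ∃ i ∈ L, i ≠ m ∧ i ∉ A) (hl : ¬ Lower key L (A ∩ L)) :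
    degree above (L ∪ R) A = degree above L (A ∩ L) := by
  have h1 : {p ∈ R | p ≠ m ∧ A ∆ {p} ∈ separable above (L ∪ R)} = ∅ := by
    rw [Set.eq_empty_iff_forall_notMem]
    rintro p ⟨hp, hpm, hs⟩
    exact hl ((h.toggle_separable_iff_right hA hR hi hp hpm).1 hs).1
  rw [h.degree_union, h1, Set.encard_empty, add_zero, degree]
  congr 1
  ext p
  exact and_congr_right fun hp => h.toggle_separable_iff_left hA hR hp

/-- Besides the neighbours within `L`, exactly one crossing set is adjacent. -/
lemma degree_of_lower (h : Halves key above L R m) (hA : A ⊆ L ∪ R) (hR : R \ {m} ⊆ A)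
    (hi : ∃ i ∈ L, i ≠ m ∧ i ∉ A) (hl : Lower key L (A ∩ L)) :
    degree above (L ∪ R) A = degree above L (A ∩ L) + 1 := by
  have hmA : m ∉ A := by
    obtain ⟨i, hi, him, hiA⟩ := hi
    exact fun hm => hiA (hl.2 m ⟨hm, h.mL⟩ i hi (h.ltL i hi him)).1
  have hAR : A ∩ R = R \ {m} := by
    ext q
    constructor
    · rintro ⟨h1, h2⟩
      exact ⟨h2, by rintro rfl; exact hmA h1⟩
    · exact fun h1 => ⟨hR h1, h1.1⟩
  have hup : Upper key R (R \ {m}) :=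
    (lower_neg _ _ _).1 (h.symm.lower_of_sdiff_subset Set.sdiff_subset le_rfl)
  obtain ⟨r, hr, hrm, -⟩ := h.exR m
  -- The final part `R \ {m}` of `R` has two neighbours. The one that adds `m` is already counted
  -- among the toggles in `L`; the other is the additional neighbour.
  have h2 := h.encard_upper_toggle hup (fun h' => (h'.symm ▸ h.mR : m ∈ R \ {m}).2 rfl) ⟨r, hr, hrm⟩
  have hmem : m ∈ {p ∈ R | Upper key R ((R \ {m}) ∆ {p})} := by
    refine ⟨h.mR, ?_⟩
    have : (R \ {m}) ∆ {m} = R := by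
      ext q
      rw [mem_toggle]
      by_cases hq : q = m
      · subst hq; simp [h.mR]
      · simp [hq]
    rw [this]
    exact ⟨le_rfl, fun p _ q hq _ => hq⟩
  have h1 : {p ∈ R | p ≠ m ∧ A ∆ {p} ∈ separable above (L ∪ R)} =
      {p ∈ R | Upper key R ((R \ {m}) ∆ {p})} \ {m} := by
    ext p
    simp only [Set.mem_ofPred_eq, Set.mem_sdiff, Set.mem_singleton_iff]
    constructor
    · rintro ⟨hp, hpm, hs⟩
      have := ((h.toggle_separable_iff_right hA hR hi hp hpm).1 hs).2
      rw [hAR] at this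
      exact ⟨⟨hp, this⟩, hpm⟩
    · rintro ⟨⟨hp, hs⟩, hpm⟩
      refine ⟨hp, hpm, (h.toggle_separable_iff_right hA hR hi hp hpm).2 ⟨hl, ?_⟩⟩
      rwa [hAR]
  have h3 : ({p ∈ R | Upper key R ((R \ {m}) ∆ {p})} \ {m}).encard = 1 := by
    have h4 := Set.encard_sdiff_singleton_add_one hmem
    rw [h2, ← one_add_one_eq_two] at h4
    exact (ENat.add_left_injective_of_ne_top ENat.one_ne_top) h4
  rw [h.degree_union, h1, h3, degree]
  congr 2
  ext p
  exact and_congr_right fun hp => h.toggle_separable_iff_left hA hR hp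

/-- Inclusion-exclusion: toggles in `L` and in `R` are independent, and `m` is the one toggle
counted on both sides. -/
lemma degree_of_subset (h : Halves key above L R m) (hA : A ⊆ L ∪ R) (hL : L \ {m} ⊆ A)
    (hR : R \ {m} ⊆ A) :
    degree above (L ∪ R) A + 1 = degree above L (A ∩ L) + degree above R (A ∩ R) := by
  have hinter : {p ∈ L | (A ∩ L) ∆ {p} ∈ separable above L} ∩
      {p ∈ R | (A ∩ R) ∆ {p} ∈ separable above R} = {m} := by
    ext p
    simp only [Set.mem_inter_iff, Set.mem_ofPred_eq, Set.mem_singleton_iff]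
    constructor
    · rintro ⟨⟨h1, -⟩, h2, -⟩
      by_contra hpm
      exact h.not_mem_left h2 hpm h1
    · rintro rfl
      refine ⟨⟨h.mL, h.lowerL _ (h.lower_of_sdiff_subset
        (toggle_subset Set.inter_subset_right h.mL) ?_)⟩, h.mR, h.symm.lowerL _
        (h.symm.lower_of_sdiff_subset (toggle_subset Set.inter_subset_right h.mR) ?_)⟩
      · rintro q ⟨hq, hqm⟩
        rw [mem_toggle]
        exact iff_of_true ⟨hL ⟨hq, hqm⟩, hq⟩ hqm
      · rintro q ⟨hq, hqm⟩
        rw [mem_toggle]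
        exact iff_of_true ⟨hR ⟨hq, hqm⟩, hq⟩ hqm
  rw [degree, degree, degree, ← Set.encard_union_add_encard_inter, hinter, Set.encard_singleton]
  congr 2
  ext p
  have h1 := fun hp : p ∈ L => h.toggle_separable_iff_left hA hR hp
  have h2 := fun hp : p ∈ R => h.symm.toggle_separable_iff_left (by rwa [Set.union_comm]) hL hp
  rw [Set.union_comm R L] at h2
  simp only [Set.mem_ofPred_eq, Set.mem_union]
  tauto

lemma toggle_separable_of_crossing (h : Halves key above L R m) (hA : A ⊆ L ∪ R)
    (hc : Crossing key L R m A) (hp : p ∈ L) :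
    A ∆ {p} ∈ separable above (L ∪ R) ↔ Lower key L ((A ∩ L) ∆ {p}) := by
  have hmA := hc.not_mem h
  obtain ⟨h1, h2, ⟨i, hi, him, hiA⟩, k, hk, hkm, hkA⟩ := hc
  have hkL := h.not_mem_left hk hkm
  have hkA' : k ∉ A ∆ {p} := by
    rw [mem_toggle]
    have : k ≠ p := by rintro rfl; exact hkL hp
    simp [hkA, this]
  rw [h.mem_separable_iff, toggle_inter_of_mem hp]
  -- Toggling `m` is never possible here: both halves still miss a point, so the result would be
  -- crossing although it contains `m`. Any other point of `L` leaves the trace on `R` unchanged.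
  by_cases hpm : p = m
  · subst hpm
    have hip : i ∉ A ∆ {p} := by simp [mem_toggle, him, hiA]
    refine iff_of_false ?_ ?_
    · rintro ⟨-, ⟨h1, -⟩ | ⟨h1, -⟩ | hc⟩
      · exact hkA' (h1 ⟨hk, hkm⟩)
      · exact hip (h1 ⟨hi, him⟩)
      · exact hc.not_mem h (by simp [mem_toggle, hmA])
    · intro h3
      have := h3.2 p (by simp [mem_toggle, hmA]) i hi (h.ltL i hi him)
      simp [mem_toggle, him, hiA] at this
  · have hpR := h.not_mem_right hp hpm
    rw [toggle_inter_of_notMem hpR, ← toggle_inter_of_mem hp]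
    constructor
    · rintro ⟨-, ⟨h1, -⟩ | ⟨h1, -⟩ | hc⟩
      · exact absurd (h1 ⟨hk, hkm⟩) hkA'
      · exact h.lower_of_sdiff_subset Set.inter_subset_right fun q hq => ⟨h1 hq, hq.1⟩
      · exact hc.1
    · intro h3
      refine ⟨toggle_subset hA (Or.inl hp), Or.inr ?_⟩
      by_cases h4 : L \ {m} ⊆ A ∆ {p}
      · exact Or.inl ⟨h4, h.upperR _ h2⟩
      · obtain ⟨l, hl, hlA⟩ := Set.not_subset.1 h4
        refine Or.inr ⟨h3, ?_, ⟨l, hl.1, hl.2, hlA⟩, k, hk, hkm, hkA'⟩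
        rwa [toggle_inter_of_notMem hpR]

/-- The two halves vary independently, and no toggle is counted twice because the common point `m`
is never an admissible one. -/
lemma degree_of_crossing (h : Halves key above L R m) (hA : A ⊆ L ∪ R)
    (hc : Crossing key L R m A) : degree above (L ∪ R) A =
      {p ∈ L | Lower key L ((A ∩ L) ∆ {p})}.encard +
        {p ∈ R | Upper key R ((A ∩ R) ∆ {p})}.encard := by
  have hmA := hc.not_mem h
  rw [degree, ← Set.encard_union_eq]
  · congr 1
    ext p
    have h1 := fun hp : p ∈ L => h.toggle_separable_of_crossing hA hc hp
    have h2 := fun hp : p ∈ R => h.symm.toggle_separable_of_crossing (by rwa [Set.union_comm])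
      (crossing_neg.2 hc) hp
    rw [Set.union_comm R L] at h2
    simp only [lower_neg] at h2
    simp only [Set.mem_ofPred_eq, Set.mem_union]
    tauto
  · rw [Set.disjoint_left]
    rintro p ⟨h1, h2⟩ ⟨h3, -⟩
    have hpm : p = m := by
      by_contra hpm
      exact h.not_mem_left h3 hpm h1
    subst hpm
    obtain ⟨-, -, ⟨i, hi, him, hiA⟩, -⟩ := hc
    have := h2.2 p (by simp [mem_toggle, hmA]) i hi (h.ltL i hi him)
    simp [mem_toggle, him, hiA] at this

lemma Crossing.inter_ne (hc : Crossing key L R m A) : A ∩ L ≠ L ∧ A ∩ R ≠ R := by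
  obtain ⟨-, -, ⟨i, hi, -, hiA⟩, k, hk, -, hkA⟩ := hc
  exact ⟨fun h' => hiA (Set.inter_eq_right.1 h' hi), fun h' => hkA (Set.inter_eq_right.1 h' hk)⟩

lemma degree_of_crossing_left (h : Halves key above L R m) (hA : A ⊆ L ∪ R)
    (hc : Crossing key L R m A) (hL : (A ∩ L).Nonempty) (hR : A ∩ R = ∅) :
    degree above (L ∪ R) A = 3 := by
  rw [h.degree_of_crossing hA hc, hR, h.encard_upper_toggle_empty,
    encard_lower_toggle h.finL h.injL hc.1 hc.inter_ne.1 hL]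
  norm_num

lemma degree_of_crossing_both (h : Halves key above L R m) (hA : A ⊆ L ∪ R)
    (hc : Crossing key L R m A) (hL : (A ∩ L).Nonempty) (hR : (A ∩ R).Nonempty) :
    degree above (L ∪ R) A = 4 := by
  rw [h.degree_of_crossing hA hc, h.encard_upper_toggle hc.2.1 hc.inter_ne.2 hR,
    encard_lower_toggle h.finL h.injL hc.1 hc.inter_ne.1 hL]
  norm_num

lemma crossing_empty (h : Halves key above L R m) : Crossing key L R m ∅ := by
  obtain ⟨l, hl, hlm, -⟩ := h.exL m
  obtain ⟨r, hr, hrm, -⟩ := h.exR m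
  exact ⟨by simp [Lower], by simp [Upper], ⟨l, hl, hlm, by simp⟩, r, hr, hrm, by simp⟩

lemma degree_empty (h : Halves key above L R m) : degree above (L ∪ R) ∅ = 2 := by
  rw [h.degree_of_crossing (Set.empty_subset _) h.crossing_empty, Set.empty_inter,
    Set.empty_inter, h.encard_upper_toggle_empty,
    encard_lower_toggle_empty h.finL h.injL ⟨m, h.mL⟩]
  norm_num

end Halves
end Koch
end

/-! ### The recursion for the degree counts -/

noncomputable section
namespace Koch
open scoped symmDiff

variable {α : Type*}

/-- The degrees of the separable sets, apart from the empty and the full set, in a chain with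
`2 ^ (r + 1) + 1` points: initial and final parts, and the remaining sets. -/
structure DegreeCounts (r : ℕ) (key : α → ℝ) (above : α → α → α → Prop) (K : Set α) : Prop where
  lower_degree : ∀ A, Lower key K A → A.Nonempty → A ≠ K →
    degree above K A = 2 ∨ degree above K A = 3 ∨ degree above K A = 4
  lower_count : {A | Lower key K A ∧ A.Nonempty ∧ A ≠ K ∧ degree above K A = 4}.encard = r
  upper_degree : ∀ A, Upper key K A → A.Nonempty → A ≠ K →
    degree above K A = 2 ∨ degree above K A = 3 ∨ degree above K A = 4
  upper_count : {A | Upper key K A ∧ A.Nonempty ∧ A ≠ K ∧ degree above K A = 4}.encard = r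
  inner_degree : ∀ A ∈ separable above K, ¬ Lower key K A → ¬ Upper key K A →
    degree above K A = 3 ∨ degree above K A = 4 ∨ degree above K A = 5
  inner_count : {A ∈ separable above K | ¬ Lower key K A ∧ ¬ Upper key K A ∧
    degree above K A = 5}.encard + ((2 * r + 3 : ℕ) : ℕ∞) = ((3 * 2 ^ r : ℕ) : ℕ∞)

/-- The degrees of the separable sets of a chain. -/
structure ChainCounts (r : ℕ) (key : α → ℝ) (above : α → α → α → Prop) (K : Set α) : Prop
    extends DegreeCounts r key above K where
  degree_self : degree above K K = 3
  degree_empty : degree above K ∅ = 2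
  degree_lower_singleton : ∀ p ∈ K, Lower key K {p} → degree above K {p} = 3
  degree_upper_singleton : ∀ p ∈ K, Upper key K {p} → degree above K {p} = 3

/-- The degrees of the separable sets of a chain that is turned upside down. -/
structure FlippedCounts (r : ℕ) (key : α → ℝ) (above : α → α → α → Prop) (K : Set α) : Prop
    extends DegreeCounts r key above K where
  degree_self : degree above K K = 2
  degree_empty : degree above K ∅ = 3
  degree_lower_cosingleton : ∀ p ∈ K, Lower key K (K \ {p}) → degree above K (K \ {p}) = 3
  degree_upper_cosingleton : ∀ p ∈ K, Upper key K (K \ {p}) → degree above K (K \ {p}) = 3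

lemma DegreeCounts.neg {r : ℕ} {key : α → ℝ} {above : α → α → α → Prop} {K : Set α}
    (h : DegreeCounts r key above K) : DegreeCounts r (fun p => -key p) above K where
  lower_degree A hA := h.upper_degree A ((lower_neg _ _ _).1 hA)
  lower_count := by simpa only [lower_neg] using h.upper_count
  upper_degree A hA := h.lower_degree A ((upper_neg _ _ _).1 hA)
  upper_count := by simpa only [upper_neg] using h.lower_count
  inner_degree A hA hl hu := h.inner_degree A hA (by rwa [upper_neg] at hu)
    (by rwa [lower_neg] at hl)
  inner_count := by
    simp only [lower_neg, upper_neg]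
    rw [← h.inner_count]
    congr 2
    ext A
    simp only [Set.mem_ofPred_eq]
    tauto

lemma FlippedCounts.neg {r : ℕ} {key : α → ℝ} {above : α → α → α → Prop} {K : Set α}
    (h : FlippedCounts r key above K) : FlippedCounts r (fun p => -key p) above K where
  toDegreeCounts := h.toDegreeCounts.neg
  degree_self := h.degree_self
  degree_empty := h.degree_empty
  degree_lower_cosingleton p hp hl := h.degree_upper_cosingleton p hp ((lower_neg _ _ _).1 hl)
  degree_upper_cosingleton p hp hl := h.degree_lower_cosingleton p hp ((upper_neg _ _ _).1 hl)

lemma Lower.inter {key : α → ℝ} {K L A : Set α} (h : Lower key K A) (hL : L ⊆ K) :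
    Lower key L (A ∩ L) :=
  ⟨Set.inter_subset_right, fun p hp q hq hqp => ⟨h.2 p hp.1 q (hL hq) hqp, hq⟩⟩

lemma Upper.inter {key : α → ℝ} {K L A : Set α} (h : Upper key K A) (hL : L ⊆ K) :
    Upper key L (A ∩ L) :=
  ⟨Set.inter_subset_right, fun p hp q hq hqp => ⟨h.2 p hp.1 q (hL hq) hqp, hq⟩⟩

namespace Halves

variable {key : α → ℝ} {above : α → α → α → Prop} {L R A B : Set α} {m p : α} {r : ℕ}

lemma degree_self (h : Halves key above L R m) (hL : FlippedCounts r key above L)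
    (hR : FlippedCounts r key above R) : degree above (L ∪ R) (L ∪ R) = 3 := by
  have h1 := h.degree_of_subset le_rfl (Set.sdiff_subset.trans Set.subset_union_left)
    (Set.sdiff_subset.trans Set.subset_union_right)
  rw [Set.union_inter_cancel_left, Set.union_inter_cancel_right, hL.degree_self,
    hR.degree_self] at h1
  exact ENat.add_left_injective_of_ne_top ENat.one_ne_top
    (show degree above (L ∪ R) (L ∪ R) + 1 = 3 + 1 by rw [h1]; norm_num)

/-- The new pentagon of each step: 3 + 3 - 1, the summands being the degrees of `L \ {m}` and `R \
{m}` in the flipped halves. -/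
lemma degree_compl_middle (h : Halves key above L R m) (hL : FlippedCounts r key above L)
    (hR : FlippedCounts r key above R) : degree above (L ∪ R) ((L ∪ R) \ {m}) = 5 := by
  have h1 := h.degree_of_subset (A := (L ∪ R) \ {m}) Set.sdiff_subset
    (Set.sdiff_subset_sdiff_left Set.subset_union_left)
    (Set.sdiff_subset_sdiff_left Set.subset_union_right)
  have h2 : (L ∪ R) \ {m} ∩ L = L \ {m} := by ext q; simp; tauto
  have h3 : (L ∪ R) \ {m} ∩ R = R \ {m} := by ext q; simp; tauto
  rw [h2, h3, hL.degree_lower_cosingleton m h.mL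
    (h.lower_of_sdiff_subset Set.sdiff_subset le_rfl),
    hR.degree_upper_cosingleton m h.mR ((lower_neg _ _ _).1
    (h.symm.lower_of_sdiff_subset Set.sdiff_subset le_rfl))] at h1
  exact ENat.add_left_injective_of_ne_top ENat.one_ne_top
    (show degree above (L ∪ R) ((L ∪ R) \ {m}) + 1 = 5 + 1 by rw [h1]; norm_num)

/-- A crossing set with empty right part. That `L` has a point other than `m` and `p` is what makes
the left part miss a point. -/
lemma degree_lower_singleton (h : Halves key above L R m) (hp : p ∈ L ∪ R)
    (hl : Lower key (L ∪ R) {p}) : degree above (L ∪ R) {p} = 3 := by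
  obtain ⟨l, hl', hlm, hlp⟩ := h.exL p
  obtain ⟨k, hk, hkm, -⟩ := h.exR m
  have hpR : p ∉ R := fun hpR => hlp (hl.2 p rfl l (Or.inl hl')
    ((h.ltL l hl' hlm).trans_le (h.le_of_right hpR)))
  have hpL := hp.resolve_right hpR
  have hR : ({p} : Set α) ∩ R = ∅ := by simpa using hpR
  refine h.degree_of_crossing_left (Set.singleton_subset_iff.2 hp)
    ⟨hl.inter Set.subset_union_left, ?_, ⟨l, hl', hlm, hlp⟩, k, hk, hkm, ?_⟩
    ⟨p, rfl, hpL⟩ hR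
  · rw [hR]; simp [Upper]
  · rintro rfl; exact hpR hk

/-- A growing initial part first exhausts `L \ {m}`, then takes `m`, and from then on contains `L`
and grows inside `R`. -/
lemma lower_cases (h : Halves key above L R m) (hA : Lower key (L ∪ R) A) (h0 : A.Nonempty)
    (hK : A ≠ L ∪ R) : (Crossing key L R m A ∧ (A ∩ L).Nonempty ∧ A ∩ R = ∅) ∨ A = L \ {m} ∨
      (L ⊆ A ∧ Lower key R (A ∩ R) ∧ (A ∩ R).Nonempty ∧ A ∩ R ≠ R) := by
  by_cases hL : L \ {m} ⊆ A
  · by_cases hm : m ∈ A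
    · have hLA : L ⊆ A := fun q hq => by
        by_cases hqm : q = m
        · exact hqm ▸ hm
        · exact hL ⟨hq, hqm⟩
      refine Or.inr (Or.inr ⟨hLA, hA.inter Set.subset_union_right, ⟨m, hm, h.mR⟩, fun he => ?_⟩)
      exact hK (hA.1.antisymm (Set.union_subset hLA (Set.inter_eq_right.1 he)))
    · refine Or.inr (Or.inl (Set.Subset.antisymm (fun q hq => ?_) hL))
      have hqm : q ≠ m := by rintro rfl; exact hm hq
      refine ⟨(hA.1 hq).resolve_right fun hqR => hm ?_, hqm⟩
      exact hA.2 q hq m (Or.inl h.mL) (h.gtR q hqR hqm)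
  · obtain ⟨i, ⟨hi, him⟩, hiA⟩ := Set.not_subset.1 hL
    have hR : A ∩ R = ∅ := by
      rw [Set.eq_empty_iff_forall_notMem]
      rintro q ⟨hqA, hqR⟩
      exact hiA (hA.2 q hqA i (Or.inl hi) ((h.ltL i hi him).trans_le (h.le_of_right hqR)))
    obtain ⟨k, hk, hkm, -⟩ := h.exR m
    refine Or.inl ⟨⟨hA.inter Set.subset_union_left, ?_, ⟨i, hi, him, hiA⟩, k, hk, hkm,
      fun hkA => Set.notMem_empty k (hR ▸ ⟨hkA, hk⟩)⟩, ?_, hR⟩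
    · rw [hR]; simp [Upper]
    · obtain ⟨q, hq⟩ := h0
      exact ⟨q, hq, (hA.1 hq).resolve_right fun hqR => Set.notMem_empty q (hR ▸ ⟨hq, hqR⟩)⟩

/-- Seen from `R`, this set contains all of `L` but `m` and has empty trace: the degree 3 of `∅` in
a flipped chain, plus the crossing neighbour. -/
lemma degree_left_cosingleton (h : Halves key above L R m) (hR : FlippedCounts r key above R) :
    degree above (L ∪ R) (L \ {m}) = 4 := by
  have h1 : (L \ {m}) ∩ R = ∅ := by
    rw [Set.eq_empty_iff_forall_notMem]
    rintro q ⟨hq, hqR⟩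
    exact h.not_mem_left hqR hq.2 hq.1
  obtain ⟨k, hk, hkm, -⟩ := h.exR m
  rw [Set.union_comm, h.symm.degree_of_lower (Set.sdiff_subset.trans Set.subset_union_right) le_rfl
    ⟨k, hk, hkm, fun hkL => h.not_mem_left hk hkm hkL.1⟩, h1, hR.degree_empty]
  · norm_num
  · rw [h1]; simp [Lower]

/-- The trace on `R` contains its first point `m` but not all of `R`, so it is not a final part and
there is no additional crossing neighbour. -/
lemma degree_of_left_subset (h : Halves key above L R m) (hA : A ⊆ L ∪ R) (hLA : L ⊆ A)
    (hne : A ∩ R ≠ R) : degree above (L ∪ R) A = degree above R (A ∩ R) := by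
  have hex : ∃ k ∈ R, k ∉ A := by
    by_contra! hcon
    exact hne (Set.inter_eq_right.2 hcon)
  obtain ⟨k, hk, hkA⟩ := hex
  have hkm : k ≠ m := by rintro rfl; exact hkA (hLA h.mL)
  rw [Set.union_comm, h.symm.degree_of_not_lower (by rwa [Set.union_comm])
    (Set.sdiff_subset.trans hLA) ⟨k, hk, hkm, hkA⟩]
  rw [lower_neg]
  exact fun hu => hkA (hu.2 m ⟨hLA h.mL, h.mR⟩ k hk (h.gtR k hk hkm)).1

lemma lower_degree (h : Halves key above L R m) (hR : FlippedCounts r key above R)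
    (hA : Lower key (L ∪ R) A) (h0 : A.Nonempty) (hK : A ≠ L ∪ R) :
    degree above (L ∪ R) A = 2 ∨ degree above (L ∪ R) A = 3 ∨ degree above (L ∪ R) A = 4 := by
  rcases h.lower_cases hA h0 hK with ⟨hc, h1, h2⟩ | rfl | ⟨h1, h2, h3, h4⟩
  · exact Or.inr (Or.inl (h.degree_of_crossing_left hA.1 hc h1 h2))
  · exact Or.inr (Or.inr (h.degree_left_cosingleton hR))
  · rw [h.degree_of_left_subset hA.1 h1 h4]
    exact hR.lower_degree _ h2 h3 h4

lemma union_inter_right (h : Halves key above L R m) (hB : B ⊆ R) (hm : m ∈ B) :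
    (L ∪ B) ∩ R = B := by
  ext q
  constructor
  · rintro ⟨hq | hq, hqR⟩
    · by_cases hqm : q = m
      · exact hqm ▸ hm
      · exact absurd hq (h.not_mem_left hqR hqm)
    · exact hq
  · exact fun hq => ⟨Or.inr hq, hB hq⟩

lemma middle_mem_of_lower (h : Halves key above L R m) (hB : Lower key R B) (h0 : B.Nonempty) :
    m ∈ B := by
  obtain ⟨q, hq⟩ := h0
  by_cases hqm : q = m
  · exact hqm ▸ hq
  · exact hB.2 q hq m h.mR (h.gtR q (hB.1 hq) hqm)

/-- The initial parts of degree 4 are `L ∪ B` with `B` such a part of `R`, and the new one `L \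
{m}`. -/
lemma lower_count (h : Halves key above L R m) (hR : FlippedCounts r key above R) :
    {A | Lower key (L ∪ R) A ∧ A.Nonempty ∧ A ≠ L ∪ R ∧ degree above (L ∪ R) A = 4}.encard =
      ((r + 1 : ℕ) : ℕ∞) := by
  set S := {A | Lower key R A ∧ A.Nonempty ∧ A ≠ R ∧ degree above R A = 4}
  have hS : ∀ B ∈ S, B ⊆ R ∧ m ∈ B := fun B hB => ⟨hB.1.1, h.middle_mem_of_lower hB.1 hB.2.1⟩
  have heq : {A | Lower key (L ∪ R) A ∧ A.Nonempty ∧ A ≠ L ∪ R ∧ degree above (L ∪ R) A = 4} =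
      insert (L \ {m}) ((fun B => L ∪ B) '' S) := by
    ext A
    constructor
    · rintro ⟨hA, h0, hK, h4⟩
      rcases h.lower_cases hA h0 hK with ⟨hc, h1, h2⟩ | rfl | ⟨h1, h2, h3, h5⟩
      · rw [h.degree_of_crossing_left hA.1 hc h1 h2] at h4
        norm_num at h4
      · exact Or.inl rfl
      · refine Or.inr ⟨A ∩ R, ⟨h2, h3, h5, ?_⟩, ?_⟩
        · rwa [← h.degree_of_left_subset hA.1 h1 h5]
        · ext q
          have := @h1 q
          have := @hA.1 q
          simp only [Set.mem_union, Set.mem_inter_iff] at *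
          tauto
    · rintro (rfl | ⟨B, hB, rfl⟩)
      · refine ⟨⟨Set.sdiff_subset.trans Set.subset_union_left, fun q hq x hx hxq => ?_⟩, ?_, ?_,
          h.degree_left_cosingleton hR⟩
        · have h1 := hxq.trans (h.ltL q hq.1 hq.2)
          refine ⟨hx.resolve_right fun hxR => absurd (h.le_of_right hxR) (not_le.2 h1), ?_⟩
          rintro rfl; exact lt_irrefl _ h1
        · obtain ⟨l, hl, hlm, -⟩ := h.exL m
          exact ⟨l, hl, hlm⟩
        · intro he
          have : m ∈ L \ {m} := he ▸ Or.inl h.mL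
          exact this.2 rfl
      · obtain ⟨hBR, hm⟩ := hS B hB
        have h1 := h.union_inter_right hBR hm
        have hK : L ∪ B ⊆ L ∪ R := Set.union_subset_union_right L hBR
        refine ⟨⟨hK, fun q hq x hx hxq => ?_⟩, ⟨m, Or.inl h.mL⟩, fun he => hB.2.2.1 ?_, ?_⟩
        · rcases hx with hx | hx
          · exact Or.inl hx
          · refine Or.inr (hB.1.2 q ?_ x hx hxq)
            rcases hq with hq | hq
            · exact absurd hxq (not_lt.2 ((h.le_of_left hq).trans (h.le_of_right hx)))
            · exact hq
        · rw [← h1, show L ∪ B = L ∪ R from he, Set.union_inter_cancel_right]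
        · rw [h.degree_of_left_subset hK Set.subset_union_left (by rw [h1]; exact hB.2.2.1), h1]
          exact hB.2.2.2
  have hinj : Set.InjOn (fun B => L ∪ B) S := by
    intro B hB C hC he
    rw [← h.union_inter_right (hS B hB).1 (hS B hB).2, ← h.union_inter_right (hS C hC).1 (hS C hC).2]
    exact congrArg (· ∩ R) he
  rw [heq, Set.encard_insert_of_notMem, hinj.encard_image, hR.lower_count]
  · rfl
  · rintro ⟨B, -, he⟩
    have : m ∈ L \ {m} := he ▸ Or.inl h.mL
    exact this.2 rfl

lemma union_sdiff_inter_left (h : Halves key above L R m) (hB : B ⊆ L) :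
    (B ∪ R \ {m}) ∩ L = B := by
  ext q
  constructor
  · rintro ⟨hq | hq, hqL⟩
    · exact hq
    · exact absurd hqL (h.not_mem_left hq.1 hq.2)
  · exact fun hq => ⟨Or.inl hq, hB hq⟩

/-- A set containing the right half, but not the left half, which is neither an initial nor a
final part, meets the left half in a nonempty initial part or is inner there. -/
lemma inner_cases (h : Halves key above L R m) (hA : A ⊆ L ∪ R) (hR : R \ {m} ⊆ A)
    (hi : ∃ i ∈ L, i ≠ m ∧ i ∉ A) (hu : ¬ Upper key (L ∪ R) A) :
    (Lower key L (A ∩ L) ∧ (A ∩ L).Nonempty ∧ A ∩ L ≠ L ∧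
      degree above (L ∪ R) A = degree above L (A ∩ L) + 1) ∨
    (¬ Lower key L (A ∩ L) ∧ ¬ Upper key L (A ∩ L) ∧
      degree above (L ∪ R) A = degree above L (A ∩ L)) := by
  by_cases hl : Lower key L (A ∩ L)
  · refine Or.inl ⟨hl, ?_, ?_, h.degree_of_lower hA hR hi hl⟩
    · by_contra h0
      rw [Set.not_nonempty_iff_eq_empty, Set.eq_empty_iff_forall_notMem] at h0
      refine hu ⟨hA, fun q hq x hx hqx => hR ?_⟩
      have hqL : q ∉ L := fun hqL => h0 q ⟨hq, hqL⟩
      have h1 := (h.le_of_right ((hA hq).resolve_left hqL)).trans_lt hqx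
      exact ⟨hx.resolve_left fun hxL => absurd (h.le_of_left hxL) (not_le.2 h1),
        by rintro rfl; exact lt_irrefl _ h1⟩
    · obtain ⟨i, hi, -, hiA⟩ := hi
      exact fun he => hiA (Set.inter_eq_right.1 he hi)
  · refine Or.inr ⟨hl, fun hu' => hu ⟨hA, fun q hq x hx hqx => ?_⟩,
      h.degree_of_not_lower hA hR hi hl⟩
    have hm : m ∈ A := by
      have h0 : (A ∩ L).Nonempty := by
        rw [Set.nonempty_iff_ne_empty]
        intro he
        exact hl (by rw [he]; simp [Lower])
      obtain ⟨y, hy⟩ := h0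
      by_cases hym : y = m
      · exact hym ▸ hy.1
      · exact (hu'.2 y hy m h.mL (h.ltL y hy.2 hym)).1
    rcases hx with hx | hx
    · by_cases hqL : q ∈ L
      · exact (hu'.2 q ⟨hq, hqL⟩ x hx hqx).1
      · exact absurd ((h.le_of_left hx).trans (h.le_of_right ((hA hq).resolve_left hqL)))
          (not_le.2 hqx)
    · by_cases hxm : x = m
      · exact hxm ▸ hm
      · exact hR ⟨hx, hxm⟩

/-- Such a pentagon is `B ∪ R \ {m}`, where `B` is either an initial part of `L` of degree 4, raised
by one, or an inner set of `L` that has degree 5 already. -/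
lemma inner_count_left (h : Halves key above L R m) (hL : FlippedCounts r key above L) :
    {A ∈ separable above (L ∪ R) | (¬ Lower key (L ∪ R) A ∧ ¬ Upper key (L ∪ R) A ∧
        degree above (L ∪ R) A = 5) ∧ R \ {m} ⊆ A ∧ ∃ i ∈ L, i ≠ m ∧ i ∉ A}.encard =
      r + {B ∈ separable above L | ¬ Lower key L B ∧ ¬ Upper key L B ∧
        degree above L B = 5}.encard := by
  set S := {A | Lower key L A ∧ A.Nonempty ∧ A ≠ L ∧ degree above L A = 4} with hSdef
  set T := {B ∈ separable above L | ¬ Lower key L B ∧ ¬ Upper key L B ∧ degree above L B = 5}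
  have hdisj : Disjoint S T := by
    rw [Set.disjoint_left]
    intro B hB hB'
    exact hB'.2.1 hB.1
  have hsub : ∀ B ∈ S ∪ T, B ⊆ L := by
    rintro B (hB | hB)
    · exact hB.1.1
    · exact hB.1.1
  have hinj : Set.InjOn (fun B => B ∪ R \ {m}) (S ∪ T) := by
    intro B hB C hC he
    rw [← h.union_sdiff_inter_left (hsub B hB), ← h.union_sdiff_inter_left (hsub C hC)]
    exact congrArg (· ∩ L) he
  rw [← hL.lower_count, ← hSdef, ← Set.encard_union_eq hdisj, ← hinj.encard_image]
  congr 1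
  ext A
  constructor
  · rintro ⟨hs, ⟨-, hu, h5⟩, hR, hi⟩
    have hA := hs.1
    have hsL := (h.separable_iff_left hA hR).1 hs
    refine ⟨A ∩ L, ?_, ?_⟩
    · rcases h.inner_cases hA hR hi hu with ⟨h1, h2, h3, h4⟩ | ⟨h1, h2, h4⟩
      · refine Or.inl ⟨h1, h2, h3, ENat.add_left_injective_of_ne_top ENat.one_ne_top
          (show degree above L (A ∩ L) + 1 = 4 + 1 by rw [← h4, h5]; norm_num)⟩
      · exact Or.inr ⟨hsL, h1, h2, h4 ▸ h5⟩
    · have hm := h.mL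
      ext q
      have h1 := @hR q
      have h2 := @hA q
      simp only [Set.mem_union, Set.mem_inter_iff, Set.mem_sdiff, Set.mem_singleton_iff] at *
      by_cases hq : q = m
      · subst hq; tauto
      · tauto
  · rintro ⟨B, hB, rfl⟩
    have hBL := hsub B hB
    have hBi := h.union_sdiff_inter_left hBL
    have hA : B ∪ R \ {m} ⊆ L ∪ R := Set.union_subset_union hBL Set.sdiff_subset
    have hR : R \ {m} ⊆ B ∪ R \ {m} := Set.subset_union_right
    have hi : ∃ i ∈ L, i ≠ m ∧ i ∉ B ∪ R \ {m} := by
      have : ∃ i ∈ L, i ≠ m ∧ i ∉ B := by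
        by_contra! hcon
        have hsd : L \ {m} ⊆ B := fun q hq => hcon q hq.1 hq.2
        have hlow := h.lower_of_sdiff_subset hBL hsd
        rcases hB with hB | hB
        · by_cases hm : m ∈ B
          · refine hB.2.2.1 (hBL.antisymm fun q hq => ?_)
            by_cases hqm : q = m
            · exact hqm ▸ hm
            · exact hcon q hq hqm
          -- The exceptional trace: `L \ {m}` would give the complement of `m`, which misses no
          -- other point of `L`. It has degree 3 in the flipped half and so is not among the parts
          -- of degree 4.
          · have he : B = L \ {m} := (Set.subset_sdiff_singleton hBL hm).antisymm hsd
            have h3 := hL.degree_lower_cosingleton m h.mL (he ▸ hlow)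
            rw [← he, hB.2.2.2] at h3
            norm_num at h3
        · exact hB.2.1 hlow
      obtain ⟨i, hi, him, hiB⟩ := this
      exact ⟨i, hi, him, fun h' => h'.elim hiB fun h'' => h.not_mem_left h''.1 him hi⟩
    have hs : B ∪ R \ {m} ∈ separable above (L ∪ R) := by
      rw [h.separable_iff_left hA hR, hBi]
      rcases hB with hB | hB
      · exact h.lowerL _ hB.1
      · exact hB.1
    have hlu : ¬ Lower key (L ∪ R) (B ∪ R \ {m}) ∧ ¬ Upper key (L ∪ R) (B ∪ R \ {m}) := by
      rcases hB with hB | hB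
      · have hmB : m ∉ B := by
          intro hm
          obtain ⟨i, hi, him, hiB⟩ := hi
          exact hiB (Or.inl (hB.1.2 m hm i hi (h.ltL i hi him)))
        have hmA : m ∉ B ∪ R \ {m} := by simp [hmB]
        obtain ⟨k, hk, hkm, -⟩ := h.exR m
        obtain ⟨b, hb⟩ := hB.2.1
        refine ⟨fun hl => hmA (hl.2 k (hR ⟨hk, hkm⟩) m (Or.inl h.mL) (h.gtR k hk hkm)),
          fun hu => hmA (hu.2 b (Or.inl hb) m (Or.inl h.mL) (h.ltL b (hBL hb) ?_))⟩
        rintro rfl; exact hmB hb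
      · refine ⟨fun hl => hB.2.1 ?_, fun hu => hB.2.2.1 ?_⟩
        · rw [← hBi]; exact hl.inter Set.subset_union_left
        · rw [← hBi]; exact hu.inter Set.subset_union_left
    refine ⟨hs, ⟨hlu.1, hlu.2, ?_⟩, hR, hi⟩
    rcases hB with hB | hB
    · rw [h.degree_of_lower hA hR hi (by rw [hBi]; exact hB.1), hBi, hB.2.2.2]; norm_num
    · rw [h.degree_of_not_lower hA hR hi (by rw [hBi]; exact hB.2.1), hBi, hB.2.2.2]

lemma inner_degree_left (h : Halves key above L R m) (hL : FlippedCounts r key above L)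
    (hs : A ∈ separable above (L ∪ R)) (hR : R \ {m} ⊆ A)
    (hi : ∃ i ∈ L, i ≠ m ∧ i ∉ A) (hu : ¬ Upper key (L ∪ R) A) :
    degree above (L ∪ R) A = 3 ∨ degree above (L ∪ R) A = 4 ∨ degree above (L ∪ R) A = 5 := by
  rcases h.inner_cases hs.1 hR hi hu with ⟨h1, h2, h3, h4⟩ | ⟨h1, h2, h4⟩
  · rw [h4]
    rcases hL.lower_degree _ h1 h2 h3 with h5 | h5 | h5 <;> rw [h5] <;> norm_num
  · rw [h4]
    exact hL.inner_degree _ ((h.separable_iff_left hs.1 hR).1 hs) h1 h2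

lemma eq_of_sdiff_subset (hA : A ⊆ L ∪ R) (hL : L \ {m} ⊆ A) (hR : R \ {m} ⊆ A) :
    A = L ∪ R ∨ A = (L ∪ R) \ {m} := by
  by_cases hmA : m ∈ A
  · refine Or.inl (hA.antisymm fun q hq => ?_)
    by_cases hqm : q = m
    · exact hqm ▸ hmA
    · exact hq.elim (fun h' => hL ⟨h', hqm⟩) fun h' => hR ⟨h', hqm⟩
  · refine Or.inr ((Set.subset_sdiff_singleton hA hmA).antisymm ?_)
    rintro q ⟨hq, hqm⟩
    exact hq.elim (fun h' => hL ⟨h', hqm⟩) fun h' => hR ⟨h', hqm⟩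

/-- With empty right trace, a crossing set would be an initial part of the whole chain. -/
lemma crossing_nonempty (h : Halves key above L R m) (hA : A ⊆ L ∪ R)
    (hc : Crossing key L R m A) (hl : ¬ Lower key (L ∪ R) A) : (A ∩ R).Nonempty := by
  rw [Set.nonempty_iff_ne_empty]
  intro he
  refine hl ⟨hA, fun q hq x hx hxq => ?_⟩
  have hqR : q ∉ R := fun hqR => Set.notMem_empty q (he ▸ ⟨hq, hqR⟩)
  have hqL := (hA hq).resolve_right hqR
  have hxR : x ∈ L := by
    by_contra hxL
    exact absurd ((h.le_of_left hqL).trans (h.le_of_right (hx.resolve_left hxL))) (not_le.2 hxq)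
  exact (hc.1.2 q ⟨hq, hqL⟩ x hxR hxq).1

lemma degree_of_inner_crossing (h : Halves key above L R m) (hA : A ⊆ L ∪ R)
    (hc : Crossing key L R m A) (hl : ¬ Lower key (L ∪ R) A) (hu : ¬ Upper key (L ∪ R) A) :
    degree above (L ∪ R) A = 4 := by
  refine h.degree_of_crossing_both hA hc ?_ (h.crossing_nonempty hA hc hl)
  exact h.symm.crossing_nonempty (by rwa [Set.union_comm]) (crossing_neg.2 hc)
    (by rwa [lower_neg, Set.union_comm])

lemma not_lower_upper_compl_middle (h : Halves key above L R m) :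
    ¬ Lower key (L ∪ R) ((L ∪ R) \ {m}) ∧ ¬ Upper key (L ∪ R) ((L ∪ R) \ {m}) := by
  obtain ⟨k, hk, hkm, -⟩ := h.exR m
  obtain ⟨l, hl, hlm, -⟩ := h.exL m
  exact ⟨fun h' => (h'.2 k ⟨Or.inr hk, hkm⟩ m (Or.inl h.mL) (h.gtR k hk hkm)).2 rfl,
    fun h' => (h'.2 l ⟨Or.inl hl, hlm⟩ m (Or.inl h.mL) (h.ltL l hl hlm)).2 rfl⟩

lemma compl_middle_separable (h : Halves key above L R m) :
    (L ∪ R) \ {m} ∈ separable above (L ∪ R) := by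
  rw [h.separable_iff_left Set.sdiff_subset
    (Set.sdiff_subset_sdiff_left Set.subset_union_right)]
  exact h.lowerL _ (h.lower_of_sdiff_subset Set.inter_subset_right
    fun q hq => ⟨⟨Or.inl hq.1, hq.2⟩, hq.1⟩)

/-- The position of a separable set which is neither an initial nor a final part. -/
lemma inner_trichotomy (h : Halves key above L R m) (hs : A ∈ separable above (L ∪ R))
    (hl : ¬ Lower key (L ∪ R) A) : A = (L ∪ R) \ {m} ∨ Crossing key L R m A ∨
      (R \ {m} ⊆ A ∧ ∃ i ∈ L, i ≠ m ∧ i ∉ A) ∨ (L \ {m} ⊆ A ∧ ∃ k ∈ R, k ≠ m ∧ k ∉ A) := by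
  have hK : L \ {m} ⊆ A → R \ {m} ⊆ A → A = (L ∪ R) \ {m} := fun h1 h2 => by
    refine (eq_of_sdiff_subset hs.1 h1 h2).resolve_left ?_
    rintro rfl
    exact hl ⟨le_rfl, fun p _ q hq _ => hq⟩
  have hex : ∀ {M : Set α}, ¬ M \ {m} ⊆ A → ∃ i ∈ M, i ≠ m ∧ i ∉ A := by
    intro M hM
    obtain ⟨i, hi, hiA⟩ := Set.not_subset.1 hM
    exact ⟨i, hi.1, hi.2, hiA⟩
  rcases (h.mem_separable_iff.1 hs).2 with ⟨h1, -⟩ | ⟨h1, -⟩ | hc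
  · by_cases h2 : L \ {m} ⊆ A
    · exact Or.inl (hK h2 h1)
    · exact Or.inr (Or.inr (Or.inl ⟨h1, hex h2⟩))
  · by_cases h2 : R \ {m} ⊆ A
    · exact Or.inl (hK h1 h2)
    · exact Or.inr (Or.inr (Or.inr ⟨h1, hex h2⟩))
  · exact Or.inr (Or.inl hc)

lemma inner_degree (h : Halves key above L R m) (hL : FlippedCounts r key above L)
    (hR : FlippedCounts r key above R) (hs : A ∈ separable above (L ∪ R))
    (hl : ¬ Lower key (L ∪ R) A) (hu : ¬ Upper key (L ∪ R) A) :
    degree above (L ∪ R) A = 3 ∨ degree above (L ∪ R) A = 4 ∨ degree above (L ∪ R) A = 5 := by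
  rcases h.inner_trichotomy hs hl with rfl | hc | ⟨h1, hi⟩ | ⟨h1, hi⟩
  · exact Or.inr (Or.inr (h.degree_compl_middle hL hR))
  · exact Or.inr (Or.inl (h.degree_of_inner_crossing hs.1 hc hl hu))
  · exact h.inner_degree_left hL hs h1 hi hu
  · rw [Set.union_comm] at hs hl ⊢
    exact h.symm.inner_degree_left hR.neg hs h1 hi (by rwa [upper_neg])

/-- One new pentagon and, from each half, its x inner pentagons and its r initial or final parts of
degree 4: x' = 2x + 2r + 1. Crossing sets contribute only degree 4. The formula is kept as a sum to
avoid truncated subtraction. -/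
lemma inner_count (h : Halves key above L R m) (hL : FlippedCounts r key above L)
    (hR : FlippedCounts r key above R) :
    {A ∈ separable above (L ∪ R) | ¬ Lower key (L ∪ R) A ∧ ¬ Upper key (L ∪ R) A ∧
      degree above (L ∪ R) A = 5}.encard + ((2 * (r + 1) + 3 : ℕ) : ℕ∞) =
      ((3 * 2 ^ (r + 1) : ℕ) : ℕ∞) := by
  have h1 := h.inner_count_left hL
  have h2 := h.symm.inner_count_left hR.neg
  simp only [lower_neg, upper_neg, Set.union_comm R L] at h2
  have heq : {A ∈ separable above (L ∪ R) | ¬ Lower key (L ∪ R) A ∧ ¬ Upper key (L ∪ R) A ∧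
      degree above (L ∪ R) A = 5} = insert ((L ∪ R) \ {m})
      ({A ∈ separable above (L ∪ R) | (¬ Lower key (L ∪ R) A ∧ ¬ Upper key (L ∪ R) A ∧
        degree above (L ∪ R) A = 5) ∧ R \ {m} ⊆ A ∧ ∃ i ∈ L, i ≠ m ∧ i ∉ A} ∪
      {A ∈ separable above (L ∪ R) | (¬ Upper key (L ∪ R) A ∧ ¬ Lower key (L ∪ R) A ∧
        degree above (L ∪ R) A = 5) ∧ L \ {m} ⊆ A ∧ ∃ i ∈ R, i ≠ m ∧ i ∉ A}) := by
    ext A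
    constructor
    · rintro ⟨hs, hl, hu, h5⟩
      rcases h.inner_trichotomy hs hl with rfl | hc | hi | hi
      · exact Or.inl rfl
      · rw [h.degree_of_inner_crossing hs.1 hc hl hu] at h5
        norm_num at h5
      · exact Or.inr (Or.inl ⟨hs, ⟨hl, hu, h5⟩, hi⟩)
      · exact Or.inr (Or.inr ⟨hs, ⟨hu, hl, h5⟩, hi⟩)
    · rintro (rfl | ⟨hs, ⟨hl, hu, h5⟩, -⟩ | ⟨hs, ⟨hu, hl, h5⟩, -⟩)
      · exact ⟨h.compl_middle_separable, h.not_lower_upper_compl_middle.1,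
          h.not_lower_upper_compl_middle.2, h.degree_compl_middle hL hR⟩
      · exact ⟨hs, hl, hu, h5⟩
      · exact ⟨hs, hl, hu, h5⟩
  rw [heq, Set.encard_insert_of_notMem, Set.encard_union_eq, h1, h2]
  · have e1 := hL.inner_count
    have e2 := hR.inner_count
    have e3 : {B ∈ separable above R | ¬ Upper key R B ∧ ¬ Lower key R B ∧ degree above R B = 5} =
        {B ∈ separable above R | ¬ Lower key R B ∧ ¬ Upper key R B ∧ degree above R B = 5} := by
      ext B; simp only [Set.mem_ofPred_eq]; tauto
    rw [e3]
    generalize {B ∈ separable above R | ¬ Lower key R B ∧ ¬ Upper key R B ∧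
      degree above R B = 5}.encard = y at *
    generalize {B ∈ separable above L | ¬ Lower key L B ∧ ¬ Upper key L B ∧
      degree above L B = 5}.encard = x at *
    calc (r : ℕ∞) + x + (r + y) + 1 + ((2 * (r + 1) + 3 : ℕ) : ℕ∞)
        = (x + ((2 * r + 3 : ℕ) : ℕ∞)) + (y + ((2 * r + 3 : ℕ) : ℕ∞)) := by push_cast; ring
      _ = ((3 * 2 ^ (r + 1) : ℕ) : ℕ∞) := by rw [e1, e2]; push_cast; ring
  · rw [Set.disjoint_left]
    rintro A ⟨-, -, -, i, hi, him, hiA⟩ ⟨-, -, hL, -⟩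
    exact hiA (hL ⟨hi, him⟩)
  · rintro (⟨-, -, -, i, hi, him, hiA⟩ | ⟨-, -, -, i, hi, him, hiA⟩)
    · exact hiA ⟨Or.inl hi, him⟩
    · exact hiA ⟨Or.inr hi, him⟩

/-- The degrees in a chain that is composed of two flipped chains. -/
theorem chainCounts (h : Halves key above L R m) (hL : FlippedCounts r key above L)
    (hR : FlippedCounts r key above R) : ChainCounts (r + 1) key above (L ∪ R) where
  lower_degree A hA h0 hK := h.lower_degree hR hA h0 hK
  lower_count := h.lower_count hR
  upper_degree A hA h0 hK := by
    rw [Set.union_comm] at hA hK ⊢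
    exact h.symm.lower_degree hL.neg ((lower_neg _ _ _).2 hA) h0 hK
  upper_count := by
    have := h.symm.lower_count hL.neg
    simpa only [lower_neg, Set.union_comm R L] using this
  inner_degree A hs hl hu := h.inner_degree hL hR hs hl hu
  inner_count := h.inner_count hL hR
  degree_self := h.degree_self hL hR
  degree_empty := h.degree_empty
  degree_lower_singleton p hp hl := h.degree_lower_singleton hp hl
  degree_upper_singleton p hp hu := by
    rw [Set.union_comm] at hp hu ⊢
    exact h.symm.degree_lower_singleton hp ((lower_neg _ _ _).2 hu)

end Halves
end Koch
end

/-! ### Copies that exchange above and below, and the three-point chain -/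

noncomputable section
namespace Koch
open scoped symmDiff

section Flip

variable {α : Type*} {key : α → ℝ} {above : α → α → α → Prop} {P A B : Set α} {φ : α → α} {r : ℕ}

/-- The complement of a subset `A` of `P`, transported to `φ '' P`. -/
def flip (φ : α → α) (P A : Set α) : Set α := φ '' (P \ A)

lemma mem_flip (hφ : Function.Injective φ) {p : α} (hp : p ∈ P) : φ p ∈ flip φ P A ↔ p ∉ A := by
  rw [flip, hφ.mem_set_image]
  exact ⟨fun h => h.2, fun h => ⟨hp, h⟩⟩

lemma flip_subset : flip φ P A ⊆ φ '' P := Set.image_mono Set.sdiff_subset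

lemma exists_flip (hB : B ⊆ φ '' P) : ∃ A ⊆ P, flip φ P A = B := by
  refine ⟨P \ φ ⁻¹' B, Set.sdiff_subset, ?_⟩
  rw [flip, Set.sdiff_sdiff_right_self]
  ext x
  constructor
  · rintro ⟨p, hp, rfl⟩; exact hp.2
  · intro hx
    obtain ⟨p, hp, rfl⟩ := hB hx
    exact ⟨p, ⟨hp, hx⟩, rfl⟩

lemma flip_injOn (hφ : Function.Injective φ) : Set.InjOn (flip φ P) {A | A ⊆ P} := by
  intro A hA B hB h
  ext p
  have key : p ∈ P → (p ∈ A ↔ p ∈ B) := fun hp => by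
    have h1 := mem_flip (A := A) hφ hp
    rw [h, mem_flip hφ hp] at h1
    tauto
  exact ⟨fun h' => (key (hA h')).1 h', fun h' => (key (hB h')).2 h'⟩

lemma flip_toggle (hφ : Function.Injective φ) {p : α} (hp : p ∈ P) :
    flip φ P (A ∆ {p}) = flip φ P A ∆ {φ p} := by
  have h1 : flip φ P A ∆ {φ p} ⊆ φ '' P := Halves.toggle_subset flip_subset ⟨p, hp, rfl⟩
  have key : ∀ q ∈ P, (φ q ∈ flip φ P (A ∆ {p}) ↔ φ q ∈ flip φ P A ∆ {φ p}) := by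
    intro q hq
    rw [mem_flip hφ hq, mem_toggle, mem_toggle, mem_flip hφ hq, hφ.ne_iff]
    tauto
  ext x
  constructor
  · intro hx
    obtain ⟨q, hq, rfl⟩ := flip_subset hx
    exact (key q hq).1 hx
  · intro hx
    obtain ⟨q, hq, rfl⟩ := h1 hx
    exact (key q hq).2 hx

variable (key above P φ) in
/-- The map `φ` reverses the order of the points of `P`, and exchanges above and below. -/
structure IsFlip : Prop where
  inj : Function.Injective φ
  key_lt : ∀ p ∈ P, ∀ q ∈ P, (key (φ q) < key (φ p) ↔ key p < key q)
  above_iff : ∀ i ∈ P, ∀ j ∈ P, ∀ k ∈ P, i ≠ j → k ≠ i → k ≠ j →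
    (above (φ i) (φ j) (φ k) ↔ ¬ above i j k)

namespace IsFlip

/-- The images of the same two points serve: a point above their line becomes one below, which
taking the complement compensates. -/
lemma separable_iff (h : IsFlip key above P φ) (hA : A ⊆ P) :
    flip φ P A ∈ separable above (φ '' P) ↔ A ∈ separable above P := by
  constructor
  · rintro ⟨-, _, ⟨i, hi, rfl⟩, _, ⟨j, hj, rfl⟩, hij, hk⟩
    refine ⟨hA, i, hi, j, hj, fun h' => hij (h' ▸ rfl), fun k hkP hki hkj => ?_⟩
    have := hk _ ⟨k, hkP, rfl⟩ (h.inj.ne hki) (h.inj.ne hkj)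
    rw [mem_flip h.inj hkP, h.above_iff i hi j hj k hkP (fun h' => hij (h' ▸ rfl)) hki hkj] at this
    tauto
  · rintro ⟨-, i, hi, j, hj, hij, hk⟩
    refine ⟨flip_subset, _, ⟨i, hi, rfl⟩, _, ⟨j, hj, rfl⟩, h.inj.ne hij, ?_⟩
    rintro _ ⟨k, hkP, rfl⟩ hki hkj
    have hki := h.inj.ne_iff.1 hki
    have hkj := h.inj.ne_iff.1 hkj
    rw [mem_flip h.inj hkP, h.above_iff i hi j hj k hkP hij hki hkj, hk k hkP hki hkj]

lemma degree_eq (h : IsFlip key above P φ) (hA : A ⊆ P) :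
    degree above (φ '' P) (flip φ P A) = degree above P A := by
  rw [degree, degree, ← h.inj.encard_image {p ∈ P | A ∆ {p} ∈ separable above P}]
  congr 1
  have key : ∀ p ∈ P, (flip φ P A ∆ {φ p} ∈ separable above (φ '' P) ↔
      A ∆ {p} ∈ separable above P) := by
    intro p hp
    rw [← flip_toggle h.inj hp, h.separable_iff (Halves.toggle_subset hA hp)]
  ext x
  constructor
  · rintro ⟨⟨p, hp, rfl⟩, hs⟩
    exact ⟨p, ⟨hp, (key p hp).1 hs⟩, rfl⟩
  · rintro ⟨p, ⟨hp, hs⟩, rfl⟩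
    exact ⟨⟨p, hp, rfl⟩, (key p hp).2 hs⟩

/-- The complement of an initial part is final, and reversing the order makes it initial again. -/
lemma lower_iff (h : IsFlip key above P φ) (hA : A ⊆ P) :
    Lower key (φ '' P) (flip φ P A) ↔ Lower key P A := by
  constructor
  · refine fun hl => ⟨hA, fun p hp q hq hqp => ?_⟩
    by_contra hqA
    have := hl.2 (φ q) ((mem_flip h.inj hq).2 hqA) (φ p) ⟨p, hA hp, rfl⟩
      ((h.key_lt q hq p (hA hp)).2 hqp)
    exact (mem_flip h.inj (hA hp)).1 this hp
  · refine fun hl => ⟨flip_subset, ?_⟩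
    rintro _ ⟨p, ⟨hp, hpA⟩, rfl⟩ _ ⟨q, hq, rfl⟩ hqp
    rw [mem_flip h.inj hq]
    exact fun hqA => hpA (hl.2 q hqA p hp ((h.key_lt p hp q hq).1 hqp))

lemma neg (h : IsFlip key above P φ) : IsFlip (fun p => -key p) above P φ where
  inj := h.inj
  key_lt p hp q hq := by
    simp only [neg_lt_neg_iff]; exact h.key_lt q hq p hp
  above_iff := h.above_iff

lemma upper_iff (h : IsFlip key above P φ) (hA : A ⊆ P) :
    Upper key (φ '' P) (flip φ P A) ↔ Upper key P A := by
  simpa only [lower_neg] using h.neg.lower_iff hA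

lemma nonempty_iff (hA : A ⊆ P) :
    (flip φ P A).Nonempty ↔ A ≠ P := by
  rw [flip, Set.image_nonempty, Set.nonempty_iff_ne_empty, Ne, Set.sdiff_eq_empty]
  exact not_congr ⟨fun h' => hA.antisymm h', fun h' => h'.ge⟩

lemma ne_iff (h : IsFlip key above P φ) (hA : A ⊆ P) :
    flip φ P A ≠ φ '' P ↔ A.Nonempty := by
  rw [flip, (Set.image_injective.2 h.inj).ne_iff, Ne, sdiff_eq_left, Set.nonempty_iff_ne_empty]
  refine not_congr ⟨fun h' => ?_, fun h' => by simp [h']⟩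
  rw [Set.eq_empty_iff_forall_notMem]
  exact fun x hx => Set.disjoint_left.1 h' (hA hx) hx

lemma encard_eq (h : IsFlip key above P φ) {S T : Set (Set α)} (hS : ∀ B ∈ S, B ⊆ φ '' P)
    (hT : ∀ A ∈ T, A ⊆ P) (hST : ∀ A ⊆ P, (flip φ P A ∈ S ↔ A ∈ T)) : S.encard = T.encard := by
  rw [← ((flip_injOn h.inj).mono fun A hA => hT A hA).encard_image]
  congr 1
  ext B
  constructor
  · intro hB
    obtain ⟨A, hA, rfl⟩ := exists_flip (hS B hB)
    exact ⟨A, (hST A hA).1 hB, rfl⟩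
  · rintro ⟨A, hA, rfl⟩
    exact (hST A (hT A hA)).2 hA

/-- The graph isomorphism `flip` exchanges the empty and the full set, and singletons with their
complements; all other data are unchanged. -/
theorem flippedCounts (h : IsFlip key above P φ) (hP : ChainCounts r key above P) :
    FlippedCounts r key above (φ '' P) where
  lower_degree B hB h0 hK := by
    obtain ⟨A, hA, rfl⟩ := exists_flip hB.1
    rw [h.degree_eq hA]
    exact hP.lower_degree A ((h.lower_iff hA).1 hB) ((h.ne_iff hA).1 hK) ((nonempty_iff hA).1 h0)
  lower_count := by
    rw [← hP.lower_count]
    refine h.encard_eq (fun B hB => hB.1.1) (fun A hA => hA.1.1) fun A hA => ?_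
    simp only [Set.mem_ofPred_eq]
    rw [h.degree_eq hA, h.lower_iff hA, h.ne_iff hA, nonempty_iff hA]
    tauto
  upper_degree B hB h0 hK := by
    obtain ⟨A, hA, rfl⟩ := exists_flip hB.1
    rw [h.degree_eq hA]
    exact hP.upper_degree A ((h.upper_iff hA).1 hB) ((h.ne_iff hA).1 hK) ((nonempty_iff hA).1 h0)
  upper_count := by
    rw [← hP.upper_count]
    refine h.encard_eq (fun B hB => hB.1.1) (fun A hA => hA.1.1) fun A hA => ?_
    simp only [Set.mem_ofPred_eq]
    rw [h.degree_eq hA, h.upper_iff hA, h.ne_iff hA, nonempty_iff hA]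
    tauto
  inner_degree B hB hl hu := by
    obtain ⟨A, hA, rfl⟩ := exists_flip hB.1
    rw [h.separable_iff hA] at hB
    rw [h.lower_iff hA] at hl
    rw [h.upper_iff hA] at hu
    rw [h.degree_eq hA]
    exact hP.inner_degree A hB hl hu
  inner_count := by
    rw [← hP.inner_count]
    congr 1
    refine h.encard_eq (fun B hB => hB.1.1) (fun A hA => hA.1.1) fun A hA => ?_
    simp only [Set.mem_ofPred_eq]
    rw [h.degree_eq hA, h.upper_iff hA, h.lower_iff hA, h.separable_iff hA]
  degree_self := by
    have := h.degree_eq (Set.empty_subset P)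
    rwa [hP.degree_empty, flip, Set.sdiff_empty] at this
  degree_empty := by
    have := h.degree_eq (le_refl P)
    rwa [hP.degree_self, flip, Set.sdiff_self, Set.image_empty] at this
  degree_lower_cosingleton := by
    rintro _ ⟨p, hp, rfl⟩ hl
    have hps : {p} ⊆ P := Set.singleton_subset_iff.2 hp
    have he : φ '' P \ {φ p} = flip φ P {p} := by
      rw [flip, Set.image_sdiff h.inj, Set.image_singleton]
    rw [he] at hl ⊢
    rw [h.degree_eq hps]
    exact hP.degree_lower_singleton p hp ((h.lower_iff hps).1 hl)
  degree_upper_cosingleton := by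
    rintro _ ⟨p, hp, rfl⟩ hl
    have hps : {p} ⊆ P := Set.singleton_subset_iff.2 hp
    have he : φ '' P \ {φ p} = flip φ P {p} := by
      rw [flip, Set.image_sdiff h.inj, Set.image_singleton]
    rw [he] at hl ⊢
    rw [h.degree_eq hps]
    exact hP.degree_upper_singleton p hp ((h.upper_iff hps).1 hl)

end IsFlip

end Flip

section Base

variable {α : Type*} {key : α → ℝ} {above : α → α → α → Prop} {a b c : α}

/-- The middle point is below the line of the outer ones, so only `{b}` cannot be cut off from
above. The graph is a cube without one vertex: the neighbours `∅`, `{a, b}`, `{b, c}` of `{b}` have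
degree 2, all others degree 3. -/
lemma separable_triple (hab : key a < key b) (hbc : key b < key c)
    (comm : ∀ i j k, above i j k ↔ above j i k) (h1 : ¬ above a c b) (h2 : above a b c)
    (h3 : above b c a) (A : Set α) :
    A ∈ separable above {a, b, c} ↔ A ⊆ {a, b, c} ∧ A ≠ {b} := by
  have hab' : a ≠ b := by rintro rfl; exact lt_irrefl _ hab
  have hbc' : b ≠ c := by rintro rfl; exact lt_irrefl _ hbc
  have hac' : a ≠ c := by rintro rfl; exact lt_asymm hab hbc
  have h4 := comm a c b
  have h5 := comm a b c
  have h6 := comm b c a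
  constructor
  · rintro ⟨hA, i, hi, j, hj, hij, hk⟩
    refine ⟨hA, ?_⟩
    rintro rfl
    simp only [Set.mem_insert_iff, Set.mem_singleton_iff] at hi hj hk
    rcases hi with rfl | rfl | rfl <;> rcases hj with rfl | rfl | rfl <;> grind
  · rintro ⟨hA, hne⟩
    refine ⟨hA, ?_⟩
    by_cases hbA : b ∈ A
    · by_cases haA : a ∈ A
      · refine ⟨b, by simp, c, by simp, hbc', ?_⟩
        simp only [Set.mem_insert_iff, Set.mem_singleton_iff]
        grind
      · have hcA : c ∈ A := by
          by_contra hcA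
          apply hne
          ext x
          have := @hA x
          simp only [Set.mem_insert_iff, Set.mem_singleton_iff] at *
          grind
        refine ⟨a, by simp, b, by simp, hab', ?_⟩
        simp only [Set.mem_insert_iff, Set.mem_singleton_iff]
        grind
    · refine ⟨a, by simp, c, by simp, hac', ?_⟩
      simp only [Set.mem_insert_iff, Set.mem_singleton_iff]
      grind

/-- The degrees in the chain of three points. -/
theorem chainCounts_triple (hab : key a < key b) (hbc : key b < key c)
    (comm : ∀ i j k, above i j k ↔ above j i k) (h1 : ¬ above a c b) (h2 : above a b c)
    (h3 : above b c a) : ChainCounts 0 key above {a, b, c} := by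
  have hab' : a ≠ b := by rintro rfl; exact lt_irrefl _ hab
  have hbc' : b ≠ c := by rintro rfl; exact lt_irrefl _ hbc
  have hac := hab.trans hbc
  have hac' : a ≠ c := by rintro rfl; exact lt_asymm hab hbc
  have hsep := separable_triple hab hbc comm h1 h2 h3
  have hdeg : ∀ A ⊆ {a, b, c}, degree above {a, b, c} A = {p ∈ ({a, b, c} : Set α) |
      A ∆ {p} ≠ {b}}.encard := by
    intro A hA
    rw [degree]
    congr 1
    ext p
    simp only [Set.mem_ofPred_eq, hsep]
    exact and_congr_right fun hp => and_iff_right (Halves.toggle_subset hA hp)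
  have htog : ∀ (A : Set α) p, A ∆ {p} = {b} ↔ A = {b} ∆ {p} := by
    intro A p
    constructor
    · intro h; rw [← h, symmDiff_symmDiff_cancel_right]
    · rintro rfl; rw [symmDiff_symmDiff_cancel_right]
  have hta : ({b} : Set α) ∆ {a} = {a, b} := by
    ext x; rw [mem_toggle]; simp only [Set.mem_singleton_iff, Set.mem_insert_iff]; grind
  have htb : ({b} : Set α) ∆ {b} = ∅ := symmDiff_self _
  have htc : ({b} : Set α) ∆ {c} = {b, c} := by
    ext x; rw [mem_toggle]; simp only [Set.mem_singleton_iff, Set.mem_insert_iff]; grind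
  have hne1 : ({a, b} : Set α) ≠ ∅ := (Set.insert_nonempty _ _).ne_empty
  have hne2 : ({b, c} : Set α) ≠ ∅ := (Set.insert_nonempty _ _).ne_empty
  have hne3 : ({a, b} : Set α) ≠ {b, c} := by
    intro h
    have : a ∈ ({b, c} : Set α) := h ▸ Or.inl rfl
    simp [hab', hac'] at this
  have hset : ∀ A : Set α, {p ∈ ({a, b, c} : Set α) | A ∆ {p} ≠ {b}} =
      {p | (p = a ∧ A ≠ {a, b}) ∨ (p = b ∧ A ≠ ∅) ∨ (p = c ∧ A ≠ {b, c})} := by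
    intro A
    ext p
    simp only [Set.mem_ofPred_eq, Ne, htog, Set.mem_insert_iff, Set.mem_singleton_iff]
    constructor
    · rintro ⟨rfl | rfl | rfl, h⟩
      · rw [hta] at h; exact Or.inl ⟨rfl, h⟩
      · rw [htb] at h; exact Or.inr (Or.inl ⟨rfl, h⟩)
      · rw [htc] at h; exact Or.inr (Or.inr ⟨rfl, h⟩)
    · rintro (⟨rfl, h⟩ | ⟨rfl, h⟩ | ⟨rfl, h⟩)
      · rw [hta]; exact ⟨by simp, h⟩
      · rw [htb]; exact ⟨by simp, h⟩
      · rw [htc]; exact ⟨by simp, h⟩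
  have d0 : degree above {a, b, c} ∅ = 2 := by
    rw [hdeg _ (Set.empty_subset _), hset, Set.encard_eq_two]
    refine ⟨a, c, hac', ?_⟩
    ext p
    simp [hne1.symm, hne2.symm]
  have d1 : degree above {a, b, c} {a, b} = 2 := by
    rw [hdeg _ (by intro x; simp; tauto), hset, Set.encard_eq_two]
    refine ⟨b, c, hbc', ?_⟩
    ext p
    simp [hne1, hne3]
  have d2 : degree above {a, b, c} {b, c} = 2 := by
    rw [hdeg _ (by intro x; simp; tauto), hset, Set.encard_eq_two]
    refine ⟨a, b, hab', ?_⟩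
    ext p
    simp [hne2, hne3.symm]
  have d3 : ∀ A ⊆ {a, b, c}, A ≠ ∅ → A ≠ {a, b} → A ≠ {b, c} → degree above {a, b, c} A = 3 := by
    intro A hA h4 h5 h6
    rw [hdeg _ hA, hset, Set.encard_eq_three]
    refine ⟨a, b, c, hab', hac', hbc', ?_⟩
    ext p
    simp [h4, h5, h6]
  have hall : ∀ A ⊆ {a, b, c}, degree above {a, b, c} A = 2 ∨ degree above {a, b, c} A = 3 := by
    intro A hA
    by_cases h4 : A = ∅
    · exact Or.inl (h4 ▸ d0)
    by_cases h5 : A = {a, b}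
    · exact Or.inl (h5 ▸ d1)
    by_cases h6 : A = {b, c}
    · exact Or.inl (h6 ▸ d2)
    exact Or.inr (d3 A hA h4 h5 h6)
  have hlow : Lower key {a, b, c} {a, b} := by
    refine ⟨by intro x; simp; tauto, ?_⟩
    simp only [Set.mem_insert_iff, Set.mem_singleton_iff]
    rintro p (rfl | rfl) q (rfl | rfl | rfl) <;> grind
  have hupp : Upper key {a, b, c} {b, c} := by
    refine ⟨by intro x; simp; tauto, ?_⟩
    simp only [Set.mem_insert_iff, Set.mem_singleton_iff]
    rintro p (rfl | rfl) q (rfl | rfl | rfl) <;> grind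
  have hin : ∀ A ∈ separable above {a, b, c}, ¬ Lower key {a, b, c} A → ¬ Upper key {a, b, c} A →
      degree above {a, b, c} A = 3 := by
    intro A hA hl hu
    refine d3 A hA.1 ?_ ?_ ?_
    · rintro rfl; exact hl (by simp [Lower])
    · rintro rfl; exact hl hlow
    · rintro rfl; exact hu hupp
  have hsing : ∀ p ∈ ({a, b, c} : Set α), ({p} : Set α) ≠ ∅ ∧ ({p} : Set α) ≠ {a, b} ∧
      ({p} : Set α) ≠ {b, c} := by
    intro p _
    refine ⟨Set.singleton_ne_empty _, fun h => hab' ?_, fun h => hbc' ?_⟩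
    · have h4 : a ∈ ({p} : Set α) := h ▸ (by simp)
      have h5 : b ∈ ({p} : Set α) := h ▸ (by simp)
      exact h4.trans h5.symm
    · have h4 : b ∈ ({p} : Set α) := h ▸ (by simp)
      have h5 : c ∈ ({p} : Set α) := h ▸ (by simp)
      exact h4.trans h5.symm
  have h24 : (2 : ℕ∞) ≠ 4 := by norm_num
  have h34 : (3 : ℕ∞) ≠ 4 := by norm_num
  have h35 : (3 : ℕ∞) ≠ 5 := by norm_num
  refine ⟨⟨fun A hA _ _ => ?_, ?_, fun A hA _ _ => ?_, ?_, fun A hA hl hu => Or.inl (hin A hA hl hu),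
    ?_⟩, ?_, d0, fun p hp _ => ?_, fun p hp _ => ?_⟩
  · rcases hall A hA.1 with h | h <;> simp [h]
  · rw [Nat.cast_zero, Set.encard_eq_zero, Set.eq_empty_iff_forall_notMem]
    rintro A ⟨hA, -, -, h⟩
    rcases hall A hA.1 with h' | h' <;> rw [h'] at h
    · exact h24 h
    · exact h34 h
  · rcases hall A hA.1 with h | h <;> simp [h]
  · rw [Nat.cast_zero, Set.encard_eq_zero, Set.eq_empty_iff_forall_notMem]
    rintro A ⟨hA, -, -, h⟩
    rcases hall A hA.1 with h' | h' <;> rw [h'] at h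
    · exact h24 h
    · exact h34 h
  · have : {A ∈ separable above {a, b, c} | ¬ Lower key {a, b, c} A ∧ ¬ Upper key {a, b, c} A ∧
        degree above {a, b, c} A = 5} = ∅ := by
      rw [Set.eq_empty_iff_forall_notMem]
      rintro A ⟨hA, hl, hu, h⟩
      rw [hin A hA hl hu] at h
      exact h35 h
    rw [this]; simp
  · refine d3 _ le_rfl ((Set.insert_nonempty _ _).ne_empty) (fun h => ?_) (fun h => ?_)
    · have : c ∈ ({a, b} : Set α) := h ▸ (by simp)
      simp [hac'.symm, hbc'.symm] at this
    · have : a ∈ ({b, c} : Set α) := h ▸ (by simp)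
      simp [hac', hab'] at this
  · exact d3 _ (Set.singleton_subset_iff.2 hp) (hsing p hp).1 (hsing p hp).2.1 (hsing p hp).2.2
  · exact d3 _ (Set.singleton_subset_iff.2 hp) (hsing p hp).1 (hsing p hp).2.1 (hsing p hp).2.2

end Base
end Koch
end

/-! ### Duality: cells of the arrangement and separable sets -/

noncomputable section
namespace Koch
open scoped symmDiff
open Filter Topology

/-- Twice the signed area of the triangle `ijk`. -/
def orient (i j k : ℝ × ℝ) : ℝ := (j.1 - i.1) * (k.2 - i.2) - (j.2 - i.2) * (k.1 - i.1)

/-- The point `k` is above the line through `i` and `j`. -/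
def PointAbove (i j k : ℝ × ℝ) : Prop := 0 < orient i j k * (j.1 - i.1)

lemma orient_swap (i j k : ℝ × ℝ) : orient j i k = -orient i j k := by
  simp only [orient]; ring

lemma pointAbove_comm (i j k : ℝ × ℝ) : PointAbove i j k ↔ PointAbove j i k := by
  rw [PointAbove, PointAbove, orient_swap]
  ring_nf

/-- A finite point set with distinct `x`-coordinates and without collinear triples. -/
structure GeneralPosition (K : Set (ℝ × ℝ)) : Prop where
  finite : K.Finite
  nontrivial : K.Nontrivial
  injOn : Set.InjOn Prod.fst K
  orient_ne : ∀ i ∈ K, ∀ j ∈ K, ∀ k ∈ K, i ≠ j → k ≠ i → k ≠ j → orient i j k ≠ 0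

/-- The height of `z` above the line dual to `p`. -/
def excess (p z : ℝ × ℝ) : ℝ := z.2 - (p.1 * z.1 - p.2)

lemma mem_dualLine_iff {p z : ℝ × ℝ} : z ∈ dualLine p ↔ excess p z = 0 := by
  rw [excess, sub_eq_zero]; rfl

lemma continuous_excess (p : ℝ × ℝ) : Continuous (excess p) := by
  unfold excess; fun_prop

lemma excess_add_smul (p z w : ℝ × ℝ) (t : ℝ) :
    excess p (z + t • w) = excess p z + t * (w.2 - p.1 * w.1) := by
  simp only [excess, Prod.fst_add, Prod.snd_add, Prod.smul_fst, Prod.smul_snd, smul_eq_mul]; ring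

lemma excess_sub (p z u : ℝ × ℝ) : excess p u - excess p z = (u - z).2 - p.1 * (u - z).1 := by
  simp only [excess, Prod.fst_sub, Prod.snd_sub]; ring

open Classical in
/-- The side of its dual line on which the points of the cell of `A` are. -/
def side (A : Set (ℝ × ℝ)) (p : ℝ × ℝ) : ℝ := if p ∈ A then 1 else -1

variable {K A B : Set (ℝ × ℝ)} {p q z : ℝ × ℝ}

lemma side_of_mem (h : p ∈ A) : side A p = 1 := if_pos h

lemma side_of_notMem (h : p ∉ A) : side A p = -1 := if_neg h

lemma side_mul_self (A : Set (ℝ × ℝ)) (p : ℝ × ℝ) : side A p * side A p = 1 := by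
  by_cases h : p ∈ A
  · rw [side_of_mem h]; norm_num
  · rw [side_of_notMem h]; norm_num

lemma side_mul_pos_iff {x : ℝ} (hx : x ≠ 0) : 0 < side A p * x ↔ (p ∈ A ↔ 0 < x) := by
  by_cases h : p ∈ A
  · rw [side_of_mem h]; simp [h]
  · rw [side_of_notMem h]
    simp only [neg_mul, one_mul, h, false_iff, not_lt, neg_pos]
    exact ⟨le_of_lt, fun h' => lt_of_le_of_ne h' hx⟩

lemma side_toggle_self (A : Set (ℝ × ℝ)) (p : ℝ × ℝ) : side (A ∆ {p}) p = -side A p := by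
  by_cases h : p ∈ A
  · rw [side_of_mem h, side_of_notMem (by simp [mem_toggle, h])]
  · rw [side_of_notMem h, side_of_mem (by simp [mem_toggle, h])]; norm_num

lemma side_toggle_of_ne (h : q ≠ p) : side (A ∆ {p}) q = side A q := by
  by_cases hq : q ∈ A
  · rw [side_of_mem hq, side_of_mem (by simp [mem_toggle, hq, h])]
  · rw [side_of_notMem hq, side_of_notMem (by simp [mem_toggle, hq, h])]

/-- The cell of the points above the dual lines of `A` and below those of `K \ A`. -/
def cell (K A : Set (ℝ × ℝ)) : Set (ℝ × ℝ) := {z | ∀ p ∈ K, 0 < side A p * excess p z}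

/-- The closed cell. -/
def closedCell (K A : Set (ℝ × ℝ)) : Set (ℝ × ℝ) := {z | ∀ p ∈ K, 0 ≤ side A p * excess p z}

lemma excess_pos_of_mem_cell (hz : z ∈ cell K A) (hp : p ∈ K) (hA : p ∈ A) : 0 < excess p z := by
  have := hz p hp
  rwa [side_of_mem hA, one_mul] at this

lemma excess_neg_of_mem_cell (hz : z ∈ cell K A) (hp : p ∈ K) (hA : p ∉ A) : excess p z < 0 := by
  have := hz p hp
  rw [side_of_notMem hA] at this
  linarith

lemma mem_cell_of (h1 : ∀ p ∈ K, p ∈ A → 0 < excess p z) (h2 : ∀ p ∈ K, p ∉ A → excess p z < 0) :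
    z ∈ cell K A := by
  intro p hp
  by_cases hA : p ∈ A
  · rw [side_of_mem hA, one_mul]; exact h1 p hp hA
  · rw [side_of_notMem hA]; linarith [h2 p hp hA]

lemma cell_inj (hA : A ⊆ K) (hB : B ⊆ K) (hzA : z ∈ cell K A) (hzB : z ∈ cell K B) : A = B := by
  ext p
  constructor
  · intro hp
    by_contra hpB
    exact lt_asymm (excess_pos_of_mem_cell hzA (hA hp) hp) (excess_neg_of_mem_cell hzB (hA hp) hpB)
  · intro hp
    by_contra hpA
    exact lt_asymm (excess_pos_of_mem_cell hzB (hB hp) hp) (excess_neg_of_mem_cell hzA (hB hp) hpA)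

lemma convex_cell : Convex ℝ (cell K A) := by
  intro u hu v hv a b ha hb hab p hp
  have h1 := hu p hp
  have h2 := hv p hp
  have he : side A p * excess p (a • u + b • v) =
      a * (side A p * excess p u) + b * (side A p * excess p v) := by
    have : a = 1 - b := by linarith
    subst this
    simp only [excess, Prod.fst_add, Prod.snd_add, Prod.smul_fst, Prod.smul_snd, smul_eq_mul]; ring
  rw [he]
  rcases ha.eq_or_lt with rfl | ha'
  · have : b = 1 := by linarith
    rw [this]; linarith
  · have := mul_pos ha' h1
    have := mul_nonneg hb h2.le
    linarith

/-- The perturbation argument used below: finitely many affine functions become positive for small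
positive `t` if each is positive at 0, or zero there with positive slope. -/
lemma eventually_forall_pos {ι : Type*} {S : Set ι} (hS : S.Finite) (a b : ι → ℝ)
    (h : ∀ i ∈ S, 0 < a i ∨ (a i = 0 ∧ 0 < b i)) :
    ∀ᶠ t in 𝓝[>] (0 : ℝ), ∀ i ∈ S, 0 < a i + t * b i := by
  rw [eventually_all_finite hS]
  intro i hi
  rcases h i hi with h1 | ⟨h1, h2⟩
  · have hc : Continuous fun t : ℝ => a i + t * b i := by fun_prop
    have ht : Tendsto (fun t : ℝ => a i + t * b i) (𝓝[>] 0) (𝓝 (a i)) := by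
      have := (hc.tendsto 0).mono_left (nhdsWithin_le_nhds (s := Set.Ioi 0))
      simpa using this
    exact ht.eventually (eventually_gt_nhds h1)
  · filter_upwards [self_mem_nhdsWithin] with t ht
    rw [h1, zero_add]
    exact mul_pos ht h2

/-- The intersection point of the lines dual to `i` and `j`. -/
def vertex (i j : ℝ × ℝ) : ℝ × ℝ :=
  ((j.2 - i.2) / (j.1 - i.1), i.1 * ((j.2 - i.2) / (j.1 - i.1)) - i.2)

lemma excess_vertex_left (i j : ℝ × ℝ) : excess i (vertex i j) = 0 := by
  simp [excess, vertex]

lemma excess_vertex_mul {i j : ℝ × ℝ} (h : i.1 ≠ j.1) (k : ℝ × ℝ) :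
    excess k (vertex i j) * (j.1 - i.1) = orient i j k := by
  have : j.1 - i.1 ≠ 0 := sub_ne_zero.2 h.symm
  simp only [excess, vertex, orient]
  field_simp
  ring

lemma excess_vertex_right {i j : ℝ × ℝ} (h : i.1 ≠ j.1) : excess j (vertex i j) = 0 := by
  have h1 := excess_vertex_mul h j
  have h2 : orient i j j = 0 := by simp only [orient]; ring
  rw [h2] at h1
  exact (mul_eq_zero.1 h1).resolve_right (sub_ne_zero.2 h.symm)

/-- Duality in coordinates: the vertex of the arrangement where the lines of `i` and `j` meet is
dual to the line through `i` and `j`. -/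
lemma pointAbove_iff {i j : ℝ × ℝ} (h : i.1 ≠ j.1) (k : ℝ × ℝ) :
    PointAbove i j k ↔ 0 < excess k (vertex i j) := by
  have h1 : j.1 - i.1 ≠ 0 := sub_ne_zero.2 h.symm
  rw [PointAbove, ← excess_vertex_mul h, mul_assoc]
  exact mul_pos_iff_of_pos_right (mul_self_pos.2 h1)

lemma eq_vertex {i j z : ℝ × ℝ} (h : i.1 ≠ j.1) (hi : excess i z = 0) (hj : excess j z = 0) :
    z = vertex i j := by
  have h1 : j.1 - i.1 ≠ 0 := sub_ne_zero.2 h.symm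
  simp only [excess] at hi hj
  have hx : z.1 = (j.2 - i.2) / (j.1 - i.1) := by
    rw [eq_div_iff h1]; linarith
  ext
  · exact hx
  · simp only [vertex]; rw [← hx]; linarith

namespace GeneralPosition

lemma fst_ne (hK : GeneralPosition K) (hp : p ∈ K) (hq : q ∈ K) (h : p ≠ q) : p.1 ≠ q.1 :=
  fun h' => h (hK.injOn hp hq h')

lemma cell_nonempty (hK : GeneralPosition K) (hA : A ∈ separable PointAbove K) :
    (cell K A).Nonempty := by
  obtain ⟨-, i, hi, j, hj, hij, hk⟩ := hA
  have h1 := hK.fst_ne hi hj hij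
  have h2 : i.1 - j.1 ≠ 0 := sub_ne_zero.2 h1
  -- The direction `w` solves `w.2 - i.1 * w.1 = side A i` and `w.2 - j.1 * w.1 = side A j`. A short
  -- move along `w` leaves both lines on the prescribed sides, whereas all other lines stay away
  -- from the vertex.
  set x := (side A j - side A i) / (i.1 - j.1) with hx
  have hx' : x * (i.1 - j.1) = side A j - side A i := div_mul_cancel₀ _ h2
  set w : ℝ × ℝ := (x, side A i + i.1 * x) with hw
  obtain ⟨t, ht⟩ := (eventually_forall_pos hK.finite
    (fun p => side A p * excess p (vertex i j)) (fun p => side A p * (w.2 - p.1 * w.1)) (by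
      intro p hp
      by_cases hpi : p = i
      · subst hpi
        refine Or.inr ⟨by rw [excess_vertex_left, mul_zero], ?_⟩
        have : side A p * (w.2 - p.1 * w.1) = side A p * side A p := by rw [hw]; simp
        rw [this, side_mul_self]; exact one_pos
      by_cases hpj : p = j
      · subst hpj
        refine Or.inr ⟨by rw [excess_vertex_right h1, mul_zero], ?_⟩
        have : side A p * (w.2 - p.1 * w.1) = side A p * side A p := by
          rw [hw]
          simp only
          linear_combination side A p * hx'
        rw [this, side_mul_self]; exact one_pos
      · refine Or.inl ?_
        have hne : excess p (vertex i j) ≠ 0 := by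
          intro h0
          have := excess_vertex_mul h1 p
          rw [h0, zero_mul] at this
          exact hK.orient_ne i hi j hj p hp hij hpi hpj this.symm
        rw [side_mul_pos_iff hne, hk p hp hpi hpj, pointAbove_iff h1])).exists
  refine ⟨vertex i j + t • w, fun p hp => ?_⟩
  have := ht p hp
  rw [excess_add_smul]
  linarith

lemma side_mul_nonneg_of_abs_le {f g t : ℝ} (h : 0 ≤ side A p * f) (hle : |t * g| ≤ |f|) :
    0 ≤ side A p * (f + t * g) := by
  by_cases hA : p ∈ A
  · rw [side_of_mem hA, one_mul] at *
    rw [abs_of_nonneg h] at hle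
    linarith [neg_le_of_abs_le hle]
  · rw [side_of_notMem hA] at *
    rw [abs_of_nonpos (show f ≤ 0 by linarith)] at hle
    linarith [le_of_abs_le hle]

/-- Move from `z` along the direction `w`, forwards or backwards, to the nearest of the lines; no
other line is crossed on the way. -/
lemma exists_step {S : Set (ℝ × ℝ)} (hS : S.Finite) (hne : S.Nonempty) (z w : ℝ × ℝ)
    (hz : ∀ p ∈ S, 0 ≤ side A p * excess p z) (hw : ∀ p ∈ S, w.2 - p.1 * w.1 ≠ 0) :
    ∃ t : ℝ, ∃ i ∈ S, excess i (z + t • w) = 0 ∧ ∀ p ∈ S, 0 ≤ side A p * excess p (z + t • w) := by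
  obtain ⟨i, hi, hmin⟩ := Set.exists_min_image S
    (fun p => |excess p z / (w.2 - p.1 * w.1)|) hS hne
  refine ⟨-(excess i z / (w.2 - i.1 * w.1)), i, hi, ?_, fun p hp => ?_⟩
  · rw [excess_add_smul, neg_mul, div_mul_cancel₀ _ (hw i hi), add_neg_cancel]
  · rw [excess_add_smul]
    refine side_mul_nonneg_of_abs_le (hz p hp) ?_
    rw [abs_mul, abs_neg]
    have := hmin p hp
    rwa [abs_div (excess p z), le_div_iff₀ (abs_pos.2 (hw p hp))] at this

/-- Every cell has a vertex: go vertically to the nearest line, then along it to the nearest other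
line. General position keeps the remaining lines away from this vertex. -/
lemma separable_of_cell (hK : GeneralPosition K) (hA : A ⊆ K) (hne : (cell K A).Nonempty) :
    A ∈ separable PointAbove K := by
  obtain ⟨z, hz⟩ := hne
  obtain ⟨t, i, hi, hi0, ht⟩ := exists_step (A := A) hK.finite hK.nontrivial.nonempty z (0, 1)
    (fun p hp => (hz p hp).le) (fun p _ => by simp)
  set y := z + t • ((0, 1) : ℝ × ℝ)
  obtain ⟨j', hj', hji'⟩ := hK.nontrivial.exists_ne i
  -- The direction `(1, i.1)` is that of the line dual to `i`, so this move stays on it.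
  obtain ⟨s, j, ⟨hj, hji⟩, hj0, hs⟩ := exists_step (A := A) (S := K \ {i})
    (hK.finite.subset Set.sdiff_subset) ⟨j', hj', hji'⟩ y (1, i.1)
    (fun p hp => ht p hp.1) (fun p hp => by
      have := hK.fst_ne hi hp.1 (Ne.symm hp.2)
      simpa [sub_eq_zero] using this)
  have hij : i ≠ j := fun h => hji h.symm
  have h1 := hK.fst_ne hi hj hij
  have hi0' : excess i (y + s • ((1, i.1) : ℝ × ℝ)) = 0 := by
    rw [excess_add_smul, hi0]; simp
  have hv := eq_vertex h1 hi0' hj0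
  rw [hv] at hs
  refine ⟨hA, i, hi, j, hj, hij, fun k hk hki hkj => ?_⟩
  have hne : excess k (vertex i j) ≠ 0 := by
    intro h0
    have := excess_vertex_mul h1 k
    rw [h0, zero_mul] at this
    exact hK.orient_ne i hi j hj k hk hij hki hkj this.symm
  rw [pointAbove_iff h1, ← side_mul_pos_iff hne]
  refine lt_of_le_of_ne (hs k ⟨hk, hki⟩) (Ne.symm (mul_ne_zero ?_ hne))
  intro h0
  have := side_mul_self A k
  rw [h0] at this
  norm_num at this

lemma separable_iff (hK : GeneralPosition K) (hA : A ⊆ K) :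
    A ∈ separable PointAbove K ↔ (cell K A).Nonempty :=
  ⟨hK.cell_nonempty, hK.separable_of_cell hA⟩

lemma cell_injOn (hK : GeneralPosition K) : Set.InjOn (cell K) (separable PointAbove K) := by
  intro A hA B hB h
  obtain ⟨z, hz⟩ := hK.cell_nonempty hA
  exact cell_inj hA.1 hB.1 hz (h ▸ hz)

/-- The cell is convex, hence inside the component. Conversely, a change of side within the
component would produce a point on a line by the intermediate value theorem. -/
lemma connectedComponentIn_eq (hz : z ∈ cell K A) :
    connectedComponentIn (⋃ p ∈ K, dualLine p)ᶜ z = cell K A := by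
  have hsub : cell K A ⊆ (⋃ p ∈ K, dualLine p)ᶜ := by
    intro u hu hu'
    simp only [Set.mem_iUnion, exists_prop, mem_dualLine_iff] at hu'
    obtain ⟨p, hp, h0⟩ := hu'
    have := hu p hp
    rw [h0, mul_zero] at this
    exact lt_irrefl _ this
  refine Set.Subset.antisymm (fun u hu p hp => ?_)
    (convex_cell.isPreconnected.subset_connectedComponentIn hz hsub)
  by_contra! hcon
  have hc : ContinuousOn (fun v => side A p * excess p v)
      (connectedComponentIn (⋃ p ∈ K, dualLine p)ᶜ z) :=
    ((continuous_excess p).const_smul (side A p)).continuousOn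
  obtain ⟨v, hv, hv0⟩ := isPreconnected_connectedComponentIn.intermediate_value hu
    (mem_connectedComponentIn (hsub hz)) hc ⟨hcon, (hz p hp).le⟩
  have hv1 := connectedComponentIn_subset _ _ hv
  refine hv1 ?_
  simp only [Set.mem_iUnion, exists_prop, mem_dualLine_iff]
  refine ⟨p, hp, (mul_eq_zero.1 hv0).resolve_left fun h0 => ?_⟩
  have := side_mul_self A p
  rw [h0] at this
  norm_num at this

/-- The faces are the cells of the separable sets. -/
lemma faces_eq (hK : GeneralPosition K) : faces K = cell K '' separable PointAbove K := by
  ext F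
  constructor
  · rintro ⟨z, hz, rfl⟩
    have hzA : z ∈ cell K {p ∈ K | 0 < excess p z} := by
      refine mem_cell_of (fun p _ h => h.2) fun p hp h => ?_
      refine lt_of_le_of_ne (not_lt.1 fun h' => h ⟨hp, h'⟩) fun h0 => hz ?_
      simp only [Set.mem_iUnion, exists_prop, mem_dualLine_iff]
      exact ⟨p, hp, h0⟩
    exact ⟨_, hK.separable_of_cell (fun p hp => hp.1) ⟨z, hzA⟩, (connectedComponentIn_eq hzA).symm⟩
  · rintro ⟨A, hA, rfl⟩
    obtain ⟨z, hz⟩ := hK.cell_nonempty hA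
    refine ⟨z, ?_, (connectedComponentIn_eq hz).symm⟩
    intro hz'
    simp only [Set.mem_iUnion, exists_prop, mem_dualLine_iff] at hz'
    obtain ⟨p, hp, h0⟩ := hz'
    have := hz p hp
    rw [h0, mul_zero] at this
    exact lt_irrefl _ this

lemma mem_closure_of_eventually {S : Set (ℝ × ℝ)} (z w : ℝ × ℝ)
    (h : ∀ᶠ t in 𝓝[>] (0 : ℝ), z + t • w ∈ S) : z ∈ closure S := by
  have hc : Continuous fun t : ℝ => z + t • w := by fun_prop
  have ht : Tendsto (fun t : ℝ => z + t • w) (𝓝[>] 0) (𝓝 z) := by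
    have := (hc.tendsto 0).mono_left (nhdsWithin_le_nhds (s := Set.Ioi 0))
    simpa using this
  exact mem_closure_of_tendsto ht h

/-- A point of the closed cell is approached along the segment towards a point of the open cell. -/
lemma closure_cell (hne : (cell K A).Nonempty) :
    closure (cell K A) = closedCell K A := by
  refine Set.Subset.antisymm ?_ fun z hz => ?_
  · refine closure_minimal (fun z hz p hp => (hz p hp).le) ?_
    have : closedCell K A = ⋂ p ∈ K, {z | 0 ≤ side A p * excess p z} := by
      ext z; simp [closedCell]
    rw [this]
    refine isClosed_biInter fun p _ => isClosed_le continuous_const ?_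
    exact (continuous_excess p).const_smul (side A p)
  · obtain ⟨u, hu⟩ := hne
    refine mem_closure_of_eventually z (u - z) ?_
    filter_upwards [Ioo_mem_nhdsGT (zero_lt_one' ℝ)] with t ht p hp
    rw [excess_add_smul, ← excess_sub]
    have h1 := mul_nonneg (sub_nonneg.2 ht.2.le) (hz p hp)
    have h2 := mul_pos ht.1 (hu p hp)
    linarith

/-- The midpoint of two points of the edge is on no other line, since two lines meet only once. A
short vertical move across the line of `p` then enters the cell of `A ∆ {p}`. -/
lemma toggle_separable_of_nontrivial (hK : GeneralPosition K) (hA : A ∈ separable PointAbove K)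
    (hp : p ∈ K) (hn : (closure (cell K A) ∩ dualLine p).Nontrivial) :
    A ∆ {p} ∈ separable PointAbove K := by
  rw [closure_cell (hK.cell_nonempty hA)] at hn
  obtain ⟨u, ⟨hu, hup⟩, v, ⟨hv, hvp⟩, huv⟩ := hn
  rw [mem_dualLine_iff] at hup hvp
  refine hK.separable_of_cell (Halves.toggle_subset hA.1 hp) ?_
  have hmid : ∀ q, excess q (u + (2⁻¹ : ℝ) • (v - u)) = (excess q u + excess q v) / 2 := by
    intro q
    rw [excess_add_smul, ← excess_sub]; ring
  obtain ⟨t, ht⟩ := (eventually_forall_pos hK.finite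
    (fun q => side (A ∆ {p}) q * excess q (u + (2⁻¹ : ℝ) • (v - u)))
    (fun q => side (A ∆ {p}) q * side (A ∆ {p}) p) (by
      intro q hq
      by_cases hqp : q = p
      · subst hqp
        refine Or.inr ⟨by rw [hmid, hup, hvp]; ring, ?_⟩
        rw [side_mul_self]; exact one_pos
      · refine Or.inl ?_
        have hqx := hK.fst_ne hq hp hqp
        rw [side_toggle_of_ne hqp, hmid]
        have h1 := hu q hq
        have h2 := hv q hq
        by_contra! hcon
        have h3 : side A q * excess q u = 0 := by linarith
        have h4 : side A q * excess q v = 0 := by linarith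
        have hs : side A q ≠ 0 := fun h0 => by
          have := side_mul_self A q
          rw [h0] at this
          norm_num at this
        have h5 := eq_vertex hqx ((mul_eq_zero.1 h3).resolve_left hs) hup
        have h6 := eq_vertex hqx ((mul_eq_zero.1 h4).resolve_left hs) hvp
        exact huv (h5.trans h6.symm))).exists
  refine ⟨u + (2⁻¹ : ℝ) • (v - u) + t • (0, side (A ∆ {p}) p), fun q hq => ?_⟩
  have := ht q hq
  rw [excess_add_smul]
  simp only [mul_zero, sub_zero]
  linarith

/-- A segment between the two cells crosses the line of `p` and no other line. Near the crossing
point, that line stays in the closed cell. -/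
lemma nontrivial_of_toggle_separable (hK : GeneralPosition K) (hA : A ∈ separable PointAbove K)
    (hp : p ∈ K) (hs : A ∆ {p} ∈ separable PointAbove K) :
    (closure (cell K A) ∩ dualLine p).Nontrivial := by
  have hne := hK.cell_nonempty hA
  rw [closure_cell hne]
  obtain ⟨u, hu⟩ := hne
  obtain ⟨v, hv⟩ := hK.cell_nonempty hs
  have h1 := hu p hp
  have h2 := hv p hp
  rw [side_toggle_self] at h2
  set a := side A p * excess p u
  set b := side A p * excess p v with hb
  have hb' : b < 0 := by linarith
  have hab : a - b ≠ 0 := by linarith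
  -- The parameter at which the affine function `excess p` vanishes on the segment from `u` to `v`.
  set s := a / (a - b) with hs
  have hs0 : 0 < s := div_pos h1 (by linarith)
  have hs1 : s < 1 := by rw [hs, div_lt_one (by linarith)]; linarith
  set c := u + s • (v - u) with hc
  have hcq : ∀ q, excess q c = (1 - s) * excess q u + s * excess q v := by
    intro q
    rw [hc, excess_add_smul, ← excess_sub]; ring
  have hcp : excess p c = 0 := by
    have h3 : side A p * excess p c = (1 - s) * a + s * b := by rw [hcq]; ring
    have h4 : (1 - s) * a + s * b = 0 := by
      have : s * (a - b) = a := div_mul_cancel₀ _ hab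
      linarith
    rw [h4] at h3
    refine (mul_eq_zero.1 h3).resolve_left fun h0 => ?_
    have := side_mul_self A p
    rw [h0] at this
    norm_num at this
  have hcpos : ∀ q ∈ K \ {p}, 0 < side A q * excess q c := by
    rintro q ⟨hq, hqp⟩
    have h3 := hu q hq
    have h4 := hv q hq
    rw [side_toggle_of_ne hqp] at h4
    rw [hcq]
    have h5 := mul_pos (sub_pos.2 hs1) h3
    have h6 := mul_pos hs0 h4
    linarith
  obtain ⟨t, ht, ht0⟩ := ((eventually_forall_pos (hK.finite.subset (Set.sdiff_subset (t := {p})))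
    (fun q => side A q * excess q c) (fun q => side A q * (p.1 - q.1 * 1))
    (fun q hq => Or.inl (hcpos q hq))).and self_mem_nhdsWithin).exists
  have hdp : excess p (c + t • (1, p.1)) = 0 := by
    rw [excess_add_smul, hcp]; simp
  refine ⟨c, ⟨fun q hq => ?_, mem_dualLine_iff.2 hcp⟩, c + t • (1, p.1),
    ⟨fun q hq => ?_, mem_dualLine_iff.2 hdp⟩, fun h => ?_⟩
  · by_cases hqp : q = p
    · rw [hqp, hcp, mul_zero]
    · exact (hcpos q ⟨hq, hqp⟩).le
  · by_cases hqp : q = p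
    · rw [hqp, hdp, mul_zero]
    · have := ht q ⟨hq, hqp⟩
      rw [excess_add_smul]
      simp only at this ⊢
      linarith
  · have := congrArg Prod.fst h
    simp only [Prod.fst_add, Prod.smul_fst, smul_eq_mul, mul_one] at this
    have ht0' : (0 : ℝ) < t := ht0
    linarith

/-- The number of edges of a cell. -/
lemma numEdges_cell (hK : GeneralPosition K) (hA : A ∈ separable PointAbove K) :
    numEdges K (cell K A) = degree PointAbove K A := by
  have heq : edges K (cell K A) = (fun p => closure (cell K A) ∩ dualLine p) ''
      {p ∈ K | A ∆ {p} ∈ separable PointAbove K} := by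
    ext e
    constructor
    · rintro ⟨p, hp, rfl, hn⟩
      exact ⟨p, ⟨hp, hK.toggle_separable_of_nontrivial hA hp hn⟩, rfl⟩
    · rintro ⟨p, ⟨hp, hs⟩, rfl⟩
      exact ⟨p, hp, rfl, hK.nontrivial_of_toggle_separable hA hp hs⟩
  rw [numEdges, heq, Set.InjOn.encard_image, degree]
  rintro p ⟨hp, hps⟩ q ⟨hq, -⟩ h
  by_contra hpq
  have hpq' := hK.fst_ne hp hq hpq
  obtain ⟨u, hu, v, hv, huv⟩ := hK.nontrivial_of_toggle_separable hA hp hps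
  have hu' : u ∈ closure (cell K A) ∩ dualLine q := h.subset hu
  have hv' : v ∈ closure (cell K A) ∩ dualLine q := h.subset hv
  exact huv ((eq_vertex hpq' (mem_dualLine_iff.1 hu.2) (mem_dualLine_iff.1 hu'.2)).trans
    (eq_vertex hpq' (mem_dualLine_iff.1 hv.2) (mem_dualLine_iff.1 hv'.2)).symm)

lemma noUpperBoundary_iff (hK : GeneralPosition K) (hA : A ∈ separable PointAbove K) :
    NoUpperBoundary (cell K A) ↔ A = K := by
  obtain ⟨z, hz⟩ := hK.cell_nonempty hA
  constructor
  · intro h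
    refine hA.1.antisymm fun p hp => ?_
    by_contra hpA
    have h1 := excess_neg_of_mem_cell hz hp hpA
    have h2 := excess_neg_of_mem_cell (h z hz (-excess p z) (by linarith)) hp hpA
    simp only [excess] at h1 h2
    linarith
  · rintro rfl u hu t ht
    refine mem_cell_of (fun p hp _ => ?_) fun p hp h => absurd hp h
    have := excess_pos_of_mem_cell hu hp hp
    simp only [excess] at *
    linarith

lemma noLowerBoundary_iff (hK : GeneralPosition K) (hA : A ∈ separable PointAbove K) :
    NoLowerBoundary (cell K A) ↔ A = ∅ := by
  obtain ⟨z, hz⟩ := hK.cell_nonempty hA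
  constructor
  · intro h
    rw [Set.eq_empty_iff_forall_notMem]
    intro p hpA
    have hp := hA.1 hpA
    have h1 := excess_pos_of_mem_cell hz hp hpA
    have h2 := excess_pos_of_mem_cell (h z hz (excess p z) h1.le) hp hpA
    simp only [excess] at h1 h2
    linarith
  · rintro rfl u hu t ht
    refine mem_cell_of (fun p _ h => absurd h (Set.notMem_empty p)) fun p hp h => ?_
    have := excess_neg_of_mem_cell hu hp h
    simp only [excess] at *
    linarith

/-- Far away the slopes decide the vertical order of the lines, so all lines of `A` are below the
others. The factor `c` is 1 or -1 and selects the side. -/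
lemma exists_far_point (hK : GeneralPosition K) (hA : A ⊆ K) {c : ℝ}
    (h : ∀ p ∈ A, ∀ q ∈ K \ A, p.1 * c < q.1 * c) (x : ℝ) :
    ∃ r, x ≤ r ∧ ∃ y, (c * r, y) ∈ cell K A := by
  have hAf := hK.finite.subset hA
  have hBf : (K \ A).Finite := hK.finite.subset Set.sdiff_subset
  have hev : ∀ᶠ r in atTop, ∀ p ∈ A, ∀ q ∈ K \ A,
      p.1 * (c * r) - p.2 < q.1 * (c * r) - q.2 := by
    rw [eventually_all_finite hAf]
    intro p hp
    rw [eventually_all_finite hBf]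
    intro q hq
    have hpos := sub_pos.2 (h p hp q hq)
    filter_upwards [eventually_gt_atTop ((q.2 - p.2) / (q.1 * c - p.1 * c))] with r hr
    rw [div_lt_iff₀ hpos] at hr
    linarith
  obtain ⟨r, hr, hxr⟩ := (hev.and (eventually_ge_atTop x)).exists
  classical
  obtain ⟨y, hy1, hy2⟩ := Order.exists_between_finsets
    (hAf.toFinset.image fun p => p.1 * (c * r) - p.2)
    (hBf.toFinset.image fun p => p.1 * (c * r) - p.2) (by
      simp only [Finset.mem_image, Set.Finite.mem_toFinset]
      rintro _ ⟨p, hp, rfl⟩ _ ⟨q, hq, rfl⟩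
      exact hr p hp q hq)
  refine ⟨r, hxr, y, mem_cell_of (fun p _ hpA => ?_) fun p hp hpA => ?_⟩
  · have := hy1 _ (Finset.mem_image_of_mem _ (hAf.mem_toFinset.2 hpA))
    simp only [excess]; linarith
  · have := hy2 _ (Finset.mem_image_of_mem _ (hBf.mem_toFinset.2 ⟨hp, hpA⟩))
    simp only [excess]; linarith

lemma Lower.exists_far_point (hK : GeneralPosition K) (hA : Lower Prod.fst K A) (x : ℝ) :
    ∃ z ∈ cell K A, x ≤ z.1 := by
  obtain ⟨r, hr, y, hy⟩ := hK.exists_far_point hA.1 (c := 1) (fun p hp q hq => by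
    rw [mul_one, mul_one]
    rcases lt_trichotomy p.1 q.1 with h | h | h
    · exact h
    · exact absurd (hK.injOn (hA.1 hp) hq.1 h ▸ hp) hq.2
    · exact absurd (hA.2 p hp q hq.1 h) hq.2) x
  exact ⟨_, hy, by simpa using hr⟩

lemma Upper.exists_far_point (hK : GeneralPosition K) (hA : Upper Prod.fst K A) (x : ℝ) :
    ∃ z ∈ cell K A, z.1 ≤ x := by
  obtain ⟨r, hr, y, hy⟩ := hK.exists_far_point hA.1 (c := -1) (fun p hp q hq => by
    rcases lt_trichotomy p.1 q.1 with h | h | h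
    · exact absurd (hA.2 p hp q hq.1 h) hq.2
    · exact absurd (hK.injOn (hA.1 hp) hq.1 h ▸ hp) hq.2
    · linarith) (-x)
  exact ⟨_, hy, by simp only [neg_mul, one_mul]; linarith⟩

lemma separable_of_lower (hK : GeneralPosition K) (hA : Lower Prod.fst K A) :
    A ∈ separable PointAbove K := by
  obtain ⟨z, hz, -⟩ := Lower.exists_far_point hK hA 0
  exact hK.separable_of_cell hA.1 ⟨z, hz⟩

lemma separable_of_upper (hK : GeneralPosition K) (hA : Upper Prod.fst K A) :
    A ∈ separable PointAbove K := by
  obtain ⟨z, hz, -⟩ := Upper.exists_far_point hK hA 0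
  exact hK.separable_of_cell hA.1 ⟨z, hz⟩

lemma bddAbove_iff (hK : GeneralPosition K) (hA : A ∈ separable PointAbove K) :
    BddAbove (Prod.fst '' cell K A) ↔ ¬ Lower Prod.fst K A := by
  constructor
  · rintro ⟨x, hx⟩ hl
    obtain ⟨z, hz, hxz⟩ := Lower.exists_far_point hK hl (x + 1)
    have := hx ⟨z, hz, rfl⟩
    linarith
  · intro hl
    have : ∃ p ∈ A, ∃ q ∈ K, q.1 < p.1 ∧ q ∉ A := by
      by_contra! hcon
      exact hl ⟨hA.1, hcon⟩
    obtain ⟨p, hp, q, hq, hqp, hqA⟩ := this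
    -- The cell is above the line of `p` and below the flatter line of `q` (slopes compared with
    -- sign), hence to the left of their crossing point.
    refine ⟨(p.2 - q.2) / (p.1 - q.1), ?_⟩
    rintro _ ⟨z, hz, rfl⟩
    have h1 := excess_pos_of_mem_cell hz (hA.1 hp) hp
    have h2 := excess_neg_of_mem_cell hz hq hqA
    rw [le_div_iff₀ (by linarith)]
    simp only [excess] at h1 h2
    linarith

lemma bddBelow_iff (hK : GeneralPosition K) (hA : A ∈ separable PointAbove K) :
    BddBelow (Prod.fst '' cell K A) ↔ ¬ Upper Prod.fst K A := by
  constructor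
  · rintro ⟨x, hx⟩ hl
    obtain ⟨z, hz, hxz⟩ := Upper.exists_far_point hK hl (x - 1)
    have := hx ⟨z, hz, rfl⟩
    linarith
  · intro hl
    have : ∃ p ∈ A, ∃ q ∈ K, p.1 < q.1 ∧ q ∉ A := by
      by_contra! hcon
      exact hl ⟨hA.1, hcon⟩
    obtain ⟨p, hp, q, hq, hpq, hqA⟩ := this
    refine ⟨(q.2 - p.2) / (q.1 - p.1), ?_⟩
    rintro _ ⟨z, hz, rfl⟩
    have h1 := excess_pos_of_mem_cell hz (hA.1 hp) hp
    have h2 := excess_neg_of_mem_cell hz hq hqA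
    rw [div_le_iff₀ (by linarith)]
    simp only [excess] at h1 h2
    linarith

lemma isBounded_iff (hK : GeneralPosition K) (hA : A ∈ separable PointAbove K) :
    Bornology.IsBounded (cell K A) ↔ ¬ Lower Prod.fst K A ∧ ¬ Upper Prod.fst K A := by
  constructor
  · intro h
    rw [← hK.bddAbove_iff hA, ← hK.bddBelow_iff hA]
    have h1 : Bornology.IsBounded (Prod.fst '' cell K A) := by
      have := (LipschitzWith.prod_fst (α := ℝ) (β := ℝ)).isBounded_image h
      exact this
    exact ⟨h1.bddAbove, h1.bddBelow⟩
  · rintro ⟨hl, hu⟩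
    have hp : ∃ p, p ∈ A := by
      by_contra! hcon
      exact hl ⟨hA.1, fun p hp => absurd hp (hcon p)⟩
    have hq : ∃ q ∈ K, q ∉ A := by
      by_contra! hcon
      exact hl ⟨hA.1, fun p _ q hq _ => hcon q hq⟩
    obtain ⟨p, hp⟩ := hp
    obtain ⟨q, hq, hqA⟩ := hq
    rw [← hK.bddAbove_iff hA] at hl
    rw [← hK.bddBelow_iff hA] at hu
    obtain ⟨b, hb⟩ := hl
    obtain ⟨a, ha⟩ := hu
    -- Once the abscissas are bounded, one line below the cell and one above it bound the ordinates.
    have hbox : Bornology.IsBounded (Set.Icc a b ×ˢ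
        Set.Icc (-(|p.1| * (|a| + |b|)) - p.2) (|q.1| * (|a| + |b|) - q.2)) :=
      (Metric.isBounded_Icc _ _).prod (Metric.isBounded_Icc _ _)
    refine hbox.subset fun z hz => ?_
    have h1 := excess_pos_of_mem_cell hz (hA.1 hp) hp
    have h2 := excess_neg_of_mem_cell hz hq hqA
    have hza : a ≤ z.1 := ha ⟨z, hz, rfl⟩
    have hzb : z.1 ≤ b := hb ⟨z, hz, rfl⟩
    have habs : |z.1| ≤ |a| + |b| := by
      rw [abs_le]
      constructor
      · linarith [neg_abs_le a, abs_nonneg b]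
      · linarith [le_abs_self b, abs_nonneg a]
    have hmul : ∀ x : ℝ, |x * z.1| ≤ |x| * (|a| + |b|) := fun x => by
      rw [abs_mul]; exact mul_le_mul_of_nonneg_left habs (abs_nonneg x)
    simp only [excess] at h1 h2
    refine ⟨⟨hza, hzb⟩, ?_, ?_⟩
    · linarith [neg_le_of_abs_le (hmul p.1)]
    · linarith [le_of_abs_le (hmul q.1)]

end GeneralPosition
end Koch
end

/-! ### Geometry of Koch chains -/

noncomputable section
namespace Koch
open Filter Topology

lemma leftCopy_eq (ε : ℝ) (p : ℝ × ℝ) : leftCopy ε p =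
    (-1 / 2 - p.1 / 2 - ε * p.2 / 2, -1 / 2 + p.1 / 2 - ε * p.2 / 2) := by
  ext <;> simp only [leftCopy, flatCopy, bottomVertex, leftVertex] <;> ring

lemma rightCopy_eq (ε : ℝ) (p : ℝ × ℝ) : rightCopy ε p =
    (1 / 2 - p.1 / 2 + ε * p.2 / 2, -1 / 2 - p.1 / 2 - ε * p.2 / 2) := by
  ext <;> simp only [rightCopy, flatCopy, bottomVertex, rightVertex] <;> ring

lemma leftCopy_leftVertex (ε : ℝ) : leftCopy ε leftVertex = bottomVertex := by
  rw [leftCopy_eq]; ext <;> norm_num [leftVertex, bottomVertex]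

lemma leftCopy_rightVertex (ε : ℝ) : leftCopy ε rightVertex = leftVertex := by
  rw [leftCopy_eq]; ext <;> norm_num [leftVertex, rightVertex]

lemma rightCopy_leftVertex (ε : ℝ) : rightCopy ε leftVertex = rightVertex := by
  rw [rightCopy_eq]; ext <;> norm_num [leftVertex, rightVertex]

lemma rightCopy_rightVertex (ε : ℝ) : rightCopy ε rightVertex = bottomVertex := by
  rw [rightCopy_eq]; ext <;> norm_num [bottomVertex, rightVertex]

lemma leftCopy_injective {ε : ℝ} (hε : 0 < ε) : Function.Injective (leftCopy ε) := by
  intro p q h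
  rw [leftCopy_eq, leftCopy_eq, Prod.mk.injEq] at h
  have h1 : p.1 = q.1 := by linarith [h.1, h.2]
  have h2 : ε * p.2 = ε * q.2 := by linarith [h.1, h.2]
  exact Prod.ext h1 (mul_left_cancel₀ hε.ne' h2)

lemma rightCopy_injective {ε : ℝ} (hε : 0 < ε) : Function.Injective (rightCopy ε) := by
  intro p q h
  rw [rightCopy_eq, rightCopy_eq, Prod.mk.injEq] at h
  have h1 : p.1 = q.1 := by linarith [h.1, h.2]
  have h2 : ε * p.2 = ε * q.2 := by linarith [h.1, h.2]
  exact Prod.ext h1 (mul_left_cancel₀ hε.ne' h2)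

/-- Flattening multiplies areas by `ε` and the similarity, of ratio 1/√2, by 1/2. -/
lemma orient_leftCopy (ε : ℝ) (i j k : ℝ × ℝ) :
    orient (leftCopy ε i) (leftCopy ε j) (leftCopy ε k) = ε / 2 * orient i j k := by
  simp only [leftCopy_eq, orient]; ring

lemma orient_rightCopy (ε : ℝ) (i j k : ℝ × ℝ) :
    orient (rightCopy ε i) (rightCopy ε j) (rightCopy ε k) = ε / 2 * orient i j k := by
  simp only [rightCopy_eq, orient]; ring

section Copy

variable {P : Set (ℝ × ℝ)} {φ : ℝ × ℝ → ℝ × ℝ} {c : ℝ}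

lemma GeneralPosition.image (hP : GeneralPosition P) (inj : Function.Injective φ)
    (order : ∀ p ∈ P, ∀ q ∈ P, p.1 < q.1 → (φ q).1 < (φ p).1) (hc : 0 < c)
    (horient : ∀ i j k, orient (φ i) (φ j) (φ k) = c * orient i j k) :
    GeneralPosition (φ '' P) where
  finite := hP.finite.image φ
  nontrivial := hP.nontrivial.image inj
  injOn := by
    rintro _ ⟨p, hp, rfl⟩ _ ⟨q, hq, rfl⟩ h
    rcases lt_trichotomy p.1 q.1 with h1 | h1 | h1
    · exact absurd h (order p hp q hq h1).ne'
    · rw [hP.injOn hp hq h1]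
    · exact absurd h (order q hq p hp h1).ne
  orient_ne := by
    rintro _ ⟨i, hi, rfl⟩ _ ⟨j, hj, rfl⟩ _ ⟨k, hk, rfl⟩ hij hki hkj
    rw [horient]
    exact mul_ne_zero hc.ne' (hP.orient_ne i hi j hj k hk (inj.ne_iff.1 hij) (inj.ne_iff.1 hki)
      (inj.ne_iff.1 hkj))

/-- The sign of `orient` is kept while the sign of the difference of abscissas changes, so above and
below are exchanged. -/
lemma GeneralPosition.isFlip (hP : GeneralPosition P) (inj : Function.Injective φ)
    (order : ∀ p ∈ P, ∀ q ∈ P, p.1 < q.1 → (φ q).1 < (φ p).1) (hc : 0 < c)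
    (horient : ∀ i j k, orient (φ i) (φ j) (φ k) = c * orient i j k) :
    IsFlip Prod.fst PointAbove P φ where
  inj := inj
  key_lt p hp q hq := by
    refine ⟨fun h => ?_, order p hp q hq⟩
    rcases lt_trichotomy p.1 q.1 with h1 | h1 | h1
    · exact h1
    · rw [hP.injOn hp hq h1] at h; exact absurd h (lt_irrefl _)
    · exact absurd h (lt_asymm (order q hq p hp h1))
  above_iff i hi j hj k hk hij hki hkj := by
    have h0 := hP.orient_ne i hi j hj k hk hij hki hkj
    rw [PointAbove, PointAbove, horient, mul_assoc, mul_pos_iff_of_pos_left hc]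
    rcases lt_or_gt_of_ne (hP.fst_ne hi hj hij) with h1 | h1
    · have h2 := order i hi j hj h1
      rw [mul_pos_iff_of_pos_right (sub_pos.2 h1)]
      constructor
      · intro h3; by_contra h4
        exact absurd h3 (not_lt.2 (mul_nonpos_of_nonneg_of_nonpos (le_of_not_gt (fun h => h.not_gt h4))
          (sub_neg.2 h2).le))
      · intro h3
        exact mul_pos_of_neg_of_neg (lt_of_le_of_ne (not_lt.1 h3) h0) (sub_neg.2 h2)
    · have h2 := order j hj i hi h1
      rw [mul_pos_iff_of_pos_right (sub_pos.2 h2)]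
      constructor
      · exact fun h3 h4 => absurd h4
          (not_lt.2 (mul_nonpos_of_nonneg_of_nonpos h3.le (sub_neg.2 h1).le))
      · intro h3
        by_contra h4
        exact h3 (mul_pos_of_neg_of_neg (lt_of_le_of_ne (not_lt.1 h4) h0) (sub_neg.2 h1))

end Copy

lemma orient_neg_of_notMem_upperShadow {a b c : ℝ × ℝ} (hab : a.1 < b.1) (hbc : b.1 < c.1)
    (h : b ∉ upperShadow a c) : orient a c b < 0 := by
  by_contra! h0
  have hac : 0 < c.1 - a.1 := by linarith
  -- The parameter of the point of the segment that has the abscissa of `b`.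
  set t := (b.1 - a.1) / (c.1 - a.1) with ht
  have ht' : t * (c.1 - a.1) = b.1 - a.1 := div_mul_cancel₀ _ hac.ne'
  have ht0 : 0 ≤ t := div_nonneg (by linarith) hac.le
  have ht1 : t ≤ 1 := by rw [ht, div_le_one hac]; linarith
  refine h ⟨a + t • (c - a), ?_, ?_, ?_⟩
  · rw [segment_eq_image']
    exact ⟨t, ⟨ht0, ht1⟩, rfl⟩
  · simp only [Prod.fst_add, Prod.smul_fst, Prod.fst_sub, smul_eq_mul]; linarith
  · simp only [Prod.snd_add, Prod.smul_snd, Prod.snd_sub, smul_eq_mul]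
    have h1 : (c.1 - a.1) * (t * (c.2 - a.2)) ≤ (c.1 - a.1) * (b.2 - a.2) := by
      have : (c.1 - a.1) * (t * (c.2 - a.2)) = (c.2 - a.2) * (b.1 - a.1) := by
        rw [← ht']; ring
      rw [this]
      simp only [orient] at h0
      linarith
    have := le_of_mul_le_mul_left h1 hac
    linarith

lemma notMem_upperShadow_of_orient {a b c : ℝ × ℝ} (hac : a.1 < c.1) (h : orient a c b < 0) :
    b ∉ upperShadow a c := by
  rintro ⟨w, hw, h1, h2⟩
  rw [segment_eq_image'] at hw
  obtain ⟨t, -, rfl⟩ := hw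
  simp only [Prod.fst_add, Prod.smul_fst, Prod.fst_sub, smul_eq_mul, Prod.snd_add, Prod.smul_snd,
    Prod.snd_sub] at h1 h2
  have h3 := mul_le_mul_of_nonneg_left h2 (sub_pos.2 hac).le
  have h4 : (c.2 - a.2) * (a.1 + t * (c.1 - a.1)) = (c.2 - a.2) * b.1 := by rw [h1]
  simp only [orient] at h
  linarith

lemma notMem_upperShadow_of_fst {a b c : ℝ × ℝ} (hac : a.1 < c.1) (h : b.1 < a.1 ∨ c.1 < b.1) :
    b ∉ upperShadow a c := by
  rintro ⟨w, hw, h1, -⟩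
  rw [segment_eq_image'] at hw
  obtain ⟨t, ⟨ht0, ht1⟩, rfl⟩ := hw
  simp only [Prod.fst_add, Prod.smul_fst, Prod.fst_sub, smul_eq_mul] at h1
  have h2 := mul_nonneg ht0 (sub_pos.2 hac).le
  have h3 := mul_le_of_le_one_left (sub_pos.2 hac).le ht1
  rcases h with h | h <;> linarith

/-- The geometric properties of a Koch chain that are kept in each step. -/
structure ChainGeometry (K : Set (ℝ × ℝ)) : Prop where
  generalPosition : GeneralPosition K
  left_mem : leftVertex ∈ K
  bottom_mem : bottomVertex ∈ K
  right_mem : rightVertex ∈ K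
  left_lt : ∀ p ∈ K, p ≠ leftVertex → -1 < p.1
  lt_right : ∀ p ∈ K, p ≠ rightVertex → p.1 < 1
  snd_neg : ∀ p ∈ K, p ≠ leftVertex → p ≠ rightVertex → p.2 < 0

lemma leftVertex_ne_bottomVertex : leftVertex ≠ bottomVertex := by
  simp [leftVertex, bottomVertex]

lemma leftVertex_ne_rightVertex : leftVertex ≠ rightVertex := by
  simp only [leftVertex, rightVertex, Ne, Prod.mk.injEq]; norm_num

lemma bottomVertex_ne_rightVertex : bottomVertex ≠ rightVertex := by
  simp [bottomVertex, rightVertex]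

lemma snd_neg_of_mem_interior {z : ℝ × ℝ} (hz : z ∈ interior (convexHull ℝ triangle)) :
    z.2 < 0 := by
  have h1 : convexHull ℝ triangle ⊆ Prod.snd ⁻¹' Set.Iic (0 : ℝ) := by
    refine convexHull_min ?_ ((convex_Iic 0).linear_preimage (LinearMap.snd ℝ ℝ ℝ))
    rintro p (rfl | rfl | rfl) <;> simp [leftVertex, bottomVertex, rightVertex]
  have h2 := interior_mono h1 hz
  rw [← isOpenMap_snd.preimage_interior_eq_interior_preimage continuous_snd, interior_Iic] at h2
  exact h2

lemma mem_interior_triangle {z : ℝ × ℝ} (h1 : z.2 < 0) (h2 : 0 < 1 + z.2 + z.1)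
    (h3 : 0 < 1 + z.2 - z.1) : z ∈ interior (convexHull ℝ triangle) := by
  have hopen : IsOpen {z : ℝ × ℝ | z.2 < 0 ∧ 0 < 1 + z.2 + z.1 ∧ 0 < 1 + z.2 - z.1} := by
    have h (g : ℝ × ℝ → ℝ) (hg : Continuous g) : IsOpen {z | 0 < g z} :=
      isOpen_lt continuous_const hg
    exact (isOpen_lt continuous_snd continuous_const).inter
      ((h (fun z => 1 + z.2 + z.1) (by fun_prop)).inter (h (fun z => 1 + z.2 - z.1) (by fun_prop)))
  refine interior_maximal ?_ hopen ⟨h1, h2, h3⟩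
  rintro z ⟨h1, h2, h3⟩
  -- The weights are the barycentric coordinates of `z`.
  have := (convex_convexHull ℝ triangle).sum_mem (t := Finset.univ)
    (w := ![(1 + z.2 - z.1) / 2, -z.2, (1 + z.2 + z.1) / 2])
    (z := ![leftVertex, bottomVertex, rightVertex])
    (by intro i _; fin_cases i <;> simp <;> linarith)
    (by simp only [Fin.sum_univ_three]; simp; ring)
    (by
      intro i _
      refine subset_convexHull ℝ _ ?_
      fin_cases i <;> simp [triangle])
  simp only [Fin.sum_univ_three] at this
  convert this using 1
  ext
  · simp [leftVertex, bottomVertex, rightVertex]; ring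
  · simp [leftVertex, bottomVertex, rightVertex]

lemma generalPosition_of_sorted {K : Set (ℝ × ℝ)} (hfin : K.Finite) (hn : K.Nontrivial)
    (inj : Set.InjOn Prod.fst K)
    (h : ∀ a ∈ K, ∀ b ∈ K, ∀ c ∈ K, a.1 < b.1 → b.1 < c.1 → orient a c b ≠ 0) :
    GeneralPosition K where
  finite := hfin
  nontrivial := hn
  injOn := inj
  orient_ne i hi j hj k hk hij hki hkj h0 := by
    have hne : ∀ {p q : ℝ × ℝ}, p ∈ K → q ∈ K → p ≠ q → p.1 < q.1 ∨ q.1 < p.1 :=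
      fun hp hq hpq => lt_or_gt_of_ne fun h' => hpq (inj hp hq h')
    -- Six of the eight sign patterns are the possible orders of the three points; the other two are
    -- cyclic.
    rcases hne hi hj hij with h1 | h1 <;> rcases hne hk hi hki with h2 | h2 <;>
      rcases hne hk hj hkj with h3 | h3
    · exact h k hk i hi j hj h2 h1 (by simp only [orient] at *; linarith)
    · linarith
    · exact h i hi k hk j hj h2 h3 (by simp only [orient] at *; linarith)
    · exact h i hi j hj k hk h1 h3 (by simp only [orient] at *; linarith)
    · exact h k hk j hj i hi h3 h1 (by simp only [orient] at *; linarith)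
    · exact h j hj k hk i hi h3 h2 (by simp only [orient] at *; linarith)
    · linarith
    · exact h j hj i hi k hk h1 h2 (by simp only [orient] at *; linarith)

lemma chainGeometry_triangle : ChainGeometry triangle where
  generalPosition := by
    refine generalPosition_of_sorted (by simp [triangle])
      ⟨leftVertex, by simp [triangle], bottomVertex, by simp [triangle],
        leftVertex_ne_bottomVertex⟩ ?_ ?_
    · rintro p (rfl | rfl | rfl) q (rfl | rfl | rfl) <;>
        norm_num [leftVertex, bottomVertex, rightVertex]
    · rintro a (rfl | rfl | rfl) b (rfl | rfl | rfl) c (rfl | rfl | rfl) <;>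
        norm_num [leftVertex, bottomVertex, rightVertex, orient]
  left_mem := by simp [triangle]
  bottom_mem := by simp [triangle]
  right_mem := by simp [triangle]
  left_lt := by
    rintro p (rfl | rfl | rfl) <;> norm_num [leftVertex, bottomVertex, rightVertex]
  lt_right := by
    rintro p (rfl | rfl | rfl) <;> norm_num [leftVertex, bottomVertex, rightVertex]
  snd_neg := by
    rintro p (rfl | rfl | rfl) <;> norm_num [leftVertex, bottomVertex, rightVertex]

lemma chainCounts_triangle : ChainCounts 0 Prod.fst PointAbove triangle := by
  refine chainCounts_triple ?_ ?_ pointAbove_comm ?_ ?_ ?_ <;>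
    norm_num [leftVertex, bottomVertex, rightVertex, PointAbove, orient]

section Step

variable {P Q : Set (ℝ × ℝ)} {ε δ : ℝ}

/-- The shadow condition supplies `mixed`; general position of each single copy makes its initial
and final parts separable. -/
lemma halves_of_flat (hP : ChainGeometry P) (hQ : ChainGeometry Q) (hε : 0 < ε) (hδ : 0 < δ)
    (hflat : SufficientlyFlat P Q ε δ) :
    Halves Prod.fst PointAbove (leftCopy ε '' P) (rightCopy δ '' Q) bottomVertex := by
  have hL := hP.generalPosition.image (leftCopy_injective hε) hflat.left_order (half_pos hε)
    (orient_leftCopy ε)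
  have hR := hQ.generalPosition.image (rightCopy_injective hδ) hflat.right_order (half_pos hδ)
    (orient_rightCopy δ)
  refine
    { finL := hL.finite
      finR := hR.finite
      mL := ⟨_, hP.left_mem, leftCopy_leftVertex ε⟩
      mR := ⟨_, hQ.right_mem, rightCopy_rightVertex δ⟩
      ltL := ?_
      gtR := ?_
      injL := hL.injOn
      injR := hR.injOn
      exL := ?_
      exR := ?_
      comm := pointAbove_comm
      mixed := ?_
      lowerL := fun A hA => hL.separable_of_lower hA
      upperL := fun A hA => hL.separable_of_upper hA
      lowerR := fun A hA => hR.separable_of_lower hA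
      upperR := fun A hA => hR.separable_of_upper hA }
  · rintro _ ⟨p, hp, rfl⟩ hne
    rw [← leftCopy_leftVertex ε] at hne ⊢
    exact hflat.left_order _ hP.left_mem p hp (hP.left_lt p hp fun h => hne (h ▸ rfl))
  · rintro _ ⟨p, hp, rfl⟩ hne
    rw [← rightCopy_rightVertex δ] at hne ⊢
    exact hflat.right_order p hp _ hQ.right_mem (hQ.lt_right p hp fun h => hne (h ▸ rfl))
  · intro p
    rw [← leftCopy_leftVertex ε]
    have inj := leftCopy_injective hε
    by_cases hp : leftCopy ε bottomVertex = p
    · exact ⟨_, ⟨_, hP.right_mem, rfl⟩, inj.ne leftVertex_ne_rightVertex.symm,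
        hp ▸ inj.ne bottomVertex_ne_rightVertex.symm⟩
    · exact ⟨_, ⟨_, hP.bottom_mem, rfl⟩, inj.ne leftVertex_ne_bottomVertex.symm, hp⟩
  · intro p
    rw [← rightCopy_rightVertex δ]
    have inj := rightCopy_injective hδ
    by_cases hp : rightCopy δ bottomVertex = p
    · exact ⟨_, ⟨_, hQ.left_mem, rfl⟩, inj.ne leftVertex_ne_rightVertex,
        hp ▸ inj.ne leftVertex_ne_bottomVertex⟩
    · exact ⟨_, ⟨_, hQ.bottom_mem, rfl⟩, inj.ne bottomVertex_ne_rightVertex, hp⟩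
  · intro a ha c hc ham hcm b hb hab hbc
    have h := orient_neg_of_notMem_upperShadow hab hbc (hflat.shadow a ha c hc ham hcm b hb
      (by rintro rfl; exact lt_irrefl _ hab) (by rintro rfl; exact lt_irrefl _ hbc))
    have h1 : orient a b c = -orient a c b := by simp only [orient]; ring
    have h2 : orient b c a = -orient a c b := by simp only [orient]; ring
    refine ⟨?_, ?_, ?_⟩
    · rw [PointAbove, not_lt]
      exact mul_nonpos_of_nonpos_of_nonneg h.le (by linarith)
    · rw [PointAbove, h1]
      exact mul_pos (by linarith) (by linarith)
    · rw [PointAbove, h2]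
      exact mul_pos (by linarith) (by linarith)

/-- The axis through the bottom vertex separates the copies. A triple whose outer points lie
strictly on both sides is not collinear by the shadow condition; any other triple lies in one copy.
-/
lemma chainGeometry_step (hP : ChainGeometry P) (hQ : ChainGeometry Q) (hε : 0 < ε) (hδ : 0 < δ)
    (hflat : SufficientlyFlat P Q ε δ) :
    ChainGeometry (leftCopy ε '' P ∪ rightCopy δ '' Q) := by
  have h := halves_of_flat hP hQ hε hδ hflat
  have hL := hP.generalPosition.image (leftCopy_injective hε) hflat.left_order (half_pos hε)
    (orient_leftCopy ε)
  have hR := hQ.generalPosition.image (rightCopy_injective hδ) hflat.right_order (half_pos hδ)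
    (orient_rightCopy δ)
  have hm : bottomVertex.1 = 0 := rfl
  have hne : ∀ {a b : ℝ × ℝ}, a.1 < b.1 → a ≠ b := by
    rintro a b hab rfl; exact lt_irrefl _ hab
  have hleft : ∀ p ∈ leftCopy ε '' P ∪ rightCopy δ '' Q, p.1 < 0 → p ∈ leftCopy ε '' P :=
    fun p hp h0 => hp.resolve_right fun h' => absurd (h.le_of_right h') (not_le.2 h0)
  have hright : ∀ p ∈ leftCopy ε '' P ∪ rightCopy δ '' Q, 0 < p.1 → p ∈ rightCopy δ '' Q :=
    fun p hp h0 => hp.resolve_left fun h' => absurd (h.le_of_left h') (not_le.2 h0)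
  have hmid : ∀ p ∈ leftCopy ε '' P ∪ rightCopy δ '' Q, p.1 = 0 → p = bottomVertex := by
    rintro p (hp | hp) h0
    · exact h.injL hp h.mL h0
    · exact h.injR hp h.mR h0
  have hleft' : ∀ p ∈ leftCopy ε '' P ∪ rightCopy δ '' Q, p.1 ≤ 0 → p ∈ leftCopy ε '' P := by
    intro p hp h0
    rcases h0.lt_or_eq with h1 | h1
    · exact hleft p hp h1
    · exact hmid p hp h1 ▸ h.mL
  have hright' : ∀ p ∈ leftCopy ε '' P ∪ rightCopy δ '' Q, 0 ≤ p.1 → p ∈ rightCopy δ '' Q := by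
    intro p hp h0
    rcases h0.lt_or_eq with h1 | h1
    · exact hright p hp h1
    · exact hmid p hp h1.symm ▸ h.mR
  have hmemL : leftVertex ∈ leftCopy ε '' P := ⟨_, hP.right_mem, leftCopy_rightVertex ε⟩
  have hmemR : rightVertex ∈ rightCopy δ '' Q := ⟨_, hQ.left_mem, rightCopy_leftVertex δ⟩
  refine ⟨?_, Or.inl hmemL, Or.inl h.mL, Or.inr hmemR, ?_, ?_, ?_⟩
  · refine generalPosition_of_sorted (h.finL.union h.finR) (hL.nontrivial.mono
      Set.subset_union_left) ?_ ?_
    · intro p hp q hq hpq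
      rcases le_total p.1 0 with h0 | h0
      · exact h.injL (hleft' p hp h0) (hleft' q hq (hpq ▸ h0)) hpq
      · exact h.injR (hright' p hp h0) (hright' q hq (hpq ▸ h0)) hpq
    · intro a ha b hb c hc hab hbc
      rcases lt_or_ge a.1 0 with ha0 | ha0
      · rcases lt_or_ge 0 c.1 with hc0 | hc0
        · refine (orient_neg_of_notMem_upperShadow hab hbc (hflat.shadow a (hleft a ha ha0) c
            (hright c hc hc0) ?_ ?_ b hb (hne hab).symm (hne hbc))).ne
          · exact hne (by rw [hm]; exact ha0)
          · exact (hne (by rw [hm]; exact hc0)).symm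
        · exact hL.orient_ne a (hleft a ha ha0) c (hleft' c hc hc0) b
            (hleft' b hb (hbc.le.trans hc0)) (hne (hab.trans hbc)) (hne hab).symm (hne hbc)
      · exact hR.orient_ne a (hright' a ha ha0) c
          (hright' c hc (ha0.trans (hab.trans hbc).le)) b (hright' b hb (ha0.trans hab.le))
          (hne (hab.trans hbc)) (hne hab).symm (hne hbc)
  · rintro _ (⟨p, hp, rfl⟩ | hp) hpl
    · rw [← leftCopy_rightVertex ε] at hpl
      have h1 := hflat.left_order p hp _ hP.right_mem (hP.lt_right p hp fun h => hpl (h ▸ rfl))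
      rw [leftCopy_rightVertex] at h1
      exact h1
    · have := h.le_of_right hp
      rw [hm] at this
      linarith
  · rintro _ (hp | ⟨p, hp, rfl⟩) hpr
    · have := h.le_of_left hp
      rw [hm] at this
      linarith
    · rw [← rightCopy_leftVertex δ] at hpr
      have h1 := hflat.right_order _ hQ.left_mem p hp (hQ.left_lt p hp fun h => hpr (h ▸ rfl))
      rw [rightCopy_leftVertex] at h1
      exact h1
  · intro p hp hpl hpr
    by_cases hpb : p = bottomVertex
    · rw [hpb]; norm_num [bottomVertex]
    · exact snd_neg_of_mem_interior (hflat.inside p hp (by simp [triangle, hpl, hpr, hpb]))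

end Step

theorem IsKochChain.geometry_counts {s : ℕ} {K : Set (ℝ × ℝ)} (h : IsKochChain s K) :
    ChainGeometry K ∧ ∃ r, s = r + 1 ∧ ChainCounts r Prod.fst PointAbove K := by
  induction h with
  | base => exact ⟨chainGeometry_triangle, 0, rfl, chainCounts_triangle⟩
  | step s P Q ε δ _ _ hε hδ hflat ihP ihQ =>
    obtain ⟨hP, r, rfl, hPc⟩ := ihP
    obtain ⟨hQ, r', hr', hQc⟩ := ihQ
    obtain rfl : r = r' := by omega
    refine ⟨chainGeometry_step hP hQ hε hδ hflat, r + 1, rfl, ?_⟩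
    refine (halves_of_flat hP hQ hε hδ hflat).chainCounts ?_ ?_
    · exact (hP.generalPosition.isFlip (leftCopy_injective hε) hflat.left_order (half_pos hε)
        (orient_leftCopy ε)).flippedCounts hPc
    · exact (hQ.generalPosition.isFlip (rightCopy_injective hδ) hflat.right_order (half_pos hδ)
        (orient_rightCopy δ)).flippedCounts hQc

/-! ### Existence of sufficiently flat copies -/

section Existence

lemma eventually_pos_of_continuous {f : ℝ → ℝ} (hf : Continuous f) (h0 : 0 < f 0) :
    ∀ᶠ t in 𝓝[>] (0 : ℝ), 0 < f t :=
  ((hf.tendsto 0).mono_left nhdsWithin_le_nhds).eventually (eventually_gt_nhds h0)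

lemma continuous_leftCopy (p : ℝ × ℝ) : Continuous fun ε => leftCopy ε p := by
  simp only [leftCopy_eq]; fun_prop

lemma continuous_rightCopy (p : ℝ × ℝ) : Continuous fun ε => rightCopy ε p := by
  simp only [rightCopy_eq]; fun_prop

lemma continuous_orient {a b c : ℝ → ℝ × ℝ} (ha : Continuous a) (hb : Continuous b)
    (hc : Continuous c) : Continuous fun t => orient (a t) (b t) (c t) := by
  unfold orient; fun_prop

variable {P : Set (ℝ × ℝ)}

lemma eventually_order (hP : P.Finite) : ∀ᶠ ε in 𝓝[>] (0 : ℝ), ∀ p ∈ P, ∀ q ∈ P, p.1 < q.1 →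
    (leftCopy ε q).1 < (leftCopy ε p).1 ∧ (rightCopy ε q).1 < (rightCopy ε p).1 := by
  rw [eventually_all_finite hP]
  intro p _
  rw [eventually_all_finite hP]
  intro q _
  rw [eventually_imp_distrib_left]
  intro hpq
  have h1 := eventually_pos_of_continuous
    ((continuous_leftCopy p).fst.sub (continuous_leftCopy q).fst)
    (by simp only [Pi.sub_apply, leftCopy_eq]; linarith)
  have h2 := eventually_pos_of_continuous
    ((continuous_rightCopy p).fst.sub (continuous_rightCopy q).fst)
    (by simp only [Pi.sub_apply, rightCopy_eq]; linarith)
  filter_upwards [h1, h2] with t h1 h2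
  exact ⟨sub_pos.1 h1, sub_pos.1 h2⟩

lemma eventually_below (hP : ChainGeometry P) : ∀ᶠ ε in 𝓝[>] (0 : ℝ), ∀ p ∈ P,
    p ≠ leftVertex → p ≠ rightVertex → (leftCopy ε p).2 < 0 ∧ (rightCopy ε p).2 < 0 := by
  rw [eventually_all_finite hP.generalPosition.finite]
  intro p hp
  rw [eventually_imp_distrib_left]
  intro hpl
  rw [eventually_imp_distrib_left]
  intro hpr
  have hl := hP.left_lt p hp hpl
  have hr := hP.lt_right p hp hpr
  have h1 := eventually_pos_of_continuous (continuous_leftCopy p).snd.neg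
    (by simp only [Pi.neg_apply, leftCopy_eq]; linarith)
  have h2 := eventually_pos_of_continuous (continuous_rightCopy p).snd.neg
    (by simp only [Pi.neg_apply, rightCopy_eq]; linarith)
  filter_upwards [h1, h2] with t h1 h2
  exact ⟨neg_pos.1 h1, neg_pos.1 h2⟩

/-- At `ε = 0` the copies lie on the two edges of the triangle, and the signed areas are negative
multiples of `(1 - q.1) * (p.1 - r.1)` and `(p.1 + 1) * (r.1 - q.1)`. As the copies reverse the
order, the hypotheses on `r` describe points between the two ends. -/
lemma eventually_shadow (hP : ChainGeometry P) : ∀ᶠ ε in 𝓝[>] (0 : ℝ), ∀ p ∈ P, ∀ q ∈ P, ∀ r ∈ P,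
    p ≠ leftVertex → q ≠ rightVertex → (leftCopy ε p).1 < (rightCopy ε q).1 ∧
      (r.1 < p.1 → orient (leftCopy ε p) (rightCopy ε q) (leftCopy ε r) < 0) ∧
      (q.1 < r.1 → orient (leftCopy ε p) (rightCopy ε q) (rightCopy ε r) < 0) := by
  have hfin := hP.generalPosition.finite
  rw [eventually_all_finite hfin]
  intro p hp
  rw [eventually_all_finite hfin]
  intro q hq
  rw [eventually_all_finite hfin]
  intro r hr
  rw [eventually_imp_distrib_left]
  intro hpl
  rw [eventually_imp_distrib_left]
  intro hqr
  have hp1 := hP.left_lt p hp hpl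
  have hq1 := hP.lt_right q hq hqr
  refine Eventually.and ?_ (Eventually.and ?_ ?_)
  · have h1 := eventually_pos_of_continuous
      ((continuous_rightCopy q).fst.sub (continuous_leftCopy p).fst)
      (by simp only [Pi.sub_apply, rightCopy_eq, leftCopy_eq]; linarith)
    filter_upwards [h1] with t h1
    exact sub_pos.1 h1
  · rw [eventually_imp_distrib_left]
    intro hrp
    have h1 := eventually_pos_of_continuous
      (continuous_orient (continuous_leftCopy p) (continuous_rightCopy q)
        (continuous_leftCopy r)).neg (by
        have := mul_pos (sub_pos.2 hq1) (sub_pos.2 hrp)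
        simp only [Pi.neg_apply, orient, rightCopy_eq, leftCopy_eq]
        linarith)
    filter_upwards [h1] with t h1
    exact neg_pos.1 h1
  · rw [eventually_imp_distrib_left]
    intro hrp
    have h1 := eventually_pos_of_continuous
      (continuous_orient (continuous_leftCopy p) (continuous_rightCopy q)
        (continuous_rightCopy r)).neg (by
        have := mul_pos (sub_pos.2 hp1) (sub_pos.2 hrp)
        simp only [Pi.neg_apply, orient, rightCopy_eq, leftCopy_eq]
        linarith)
    filter_upwards [h1] with t h1
    exact neg_pos.1 h1

lemma exists_sufficientlyFlat (hP : ChainGeometry P) : ∃ ε, 0 < ε ∧ SufficientlyFlat P P ε ε := by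
  have hinj := hP.generalPosition.injOn
  obtain ⟨ε, ⟨⟨horder, hbelow⟩, hshadow⟩, hε⟩ := (((eventually_order hP.generalPosition.finite).and
    (eventually_below hP)).and (eventually_shadow hP) |>.and self_mem_nhdsWithin).exists
  have hε : 0 < ε := hε
  refine ⟨ε, hε, fun p hp q hq h => (horder p hp q hq h).1, fun p hp q hq h =>
    (horder p hp q hq h).2, ?_, ?_⟩
  · rintro _ (⟨p, hp, rfl⟩ | ⟨p, hp, rfl⟩) ht
    · have hpl : p ≠ leftVertex := by
        rintro rfl; exact ht (by rw [leftCopy_leftVertex]; simp [triangle])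
      have hpr : p ≠ rightVertex := by
        rintro rfl; exact ht (by rw [leftCopy_rightVertex]; simp [triangle])
      have h1 := hP.left_lt p hp hpl
      -- The distance to the edge is proportional to `-ε * p.2`. It vanishes in the limit, so this
      -- inequality comes from the chain lying below its axis and not from continuity.
      have h3 := mul_pos_of_neg_of_neg (hP.snd_neg p hp hpl hpr) (neg_neg_of_pos hε)
      refine mem_interior_triangle (hbelow p hp hpl hpr).1 ?_ ?_ <;> rw [leftCopy_eq] <;>
        simp only <;> linarith
    · have hpl : p ≠ leftVertex := by
        rintro rfl; exact ht (by rw [rightCopy_leftVertex]; simp [triangle])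
      have hpr : p ≠ rightVertex := by
        rintro rfl; exact ht (by rw [rightCopy_rightVertex]; simp [triangle])
      have h1 := hP.lt_right p hp hpr
      have h3 := mul_pos_of_neg_of_neg (hP.snd_neg p hp hpl hpr) (neg_neg_of_pos hε)
      refine mem_interior_triangle (hbelow p hp hpl hpr).2 ?_ ?_ <;> rw [rightCopy_eq] <;>
        simp only <;> linarith
  · rintro _ ⟨p, hp, rfl⟩ _ ⟨q, hq, rfl⟩ ha hc _ (⟨r, hr, rfl⟩ | ⟨r, hr, rfl⟩) hba hbc
    all_goals
      have hpl : p ≠ leftVertex := by rintro rfl; exact ha (leftCopy_leftVertex ε)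
      have hqr : q ≠ rightVertex := by rintro rfl; exact hc (rightCopy_rightVertex ε)
      obtain ⟨h1, h2, h3⟩ := hshadow p hp q hq r hr hpl hqr
    · rcases lt_trichotomy r.1 p.1 with h | h | h
      · exact notMem_upperShadow_of_orient h1 (h2 h)
      · exact absurd (hinj hr hp h ▸ rfl) hba
      · exact notMem_upperShadow_of_fst h1 (Or.inl (horder p hp r hr h).1)
    · rcases lt_trichotomy r.1 q.1 with h | h | h
      · exact notMem_upperShadow_of_fst h1 (Or.inr (horder r hr q hq h).2)
      · exact absurd (hinj hr hq h ▸ rfl) hbc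
      · exact notMem_upperShadow_of_orient h1 (h3 h)

theorem exists_isKochChain (r : ℕ) : ∃ K, IsKochChain (r + 1) K := by
  induction r with
  | zero => exact ⟨_, IsKochChain.base⟩
  | succ r ih =>
    obtain ⟨P, hP⟩ := ih
    obtain ⟨ε, hε, hflat⟩ := exists_sufficientlyFlat hP.geometry_counts.1
    exact ⟨_, IsKochChain.step _ P P ε ε hP hP hε hε hflat⟩

end Existence

/-! ### Finite and infinite faces in terms of separable sets -/

section Faces

variable {K A B : Set (ℝ × ℝ)}

lemma lower_self (K : Set (ℝ × ℝ)) : Lower Prod.fst K K := ⟨le_rfl, fun _ _ _ hq _ => hq⟩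

lemma lower_empty (K : Set (ℝ × ℝ)) : Lower Prod.fst K ∅ := by simp [Lower]

/-- This is why no face with both boundaries is unbounded towards both sides. -/
lemma GeneralPosition.eq_of_lower_of_upper (hK : GeneralPosition K) (hl : Lower Prod.fst K A)
    (hu : Upper Prod.fst K A) (h0 : A.Nonempty) : A = K := by
  obtain ⟨p, hp⟩ := h0
  refine hl.1.antisymm fun q hq => ?_
  rcases lt_trichotomy q.1 p.1 with h | h | h
  · exact hl.2 p hp q hq h
  · exact hK.injOn hq (hl.1 hp) h ▸ hp
  · exact hu.2 p hp q hq h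

lemma GeneralPosition.sideFaces_eq (hK : GeneralPosition K) : sideFaces K =
    cell K '' {A | (Lower Prod.fst K A ∨ Upper Prod.fst K A) ∧ A.Nonempty ∧ A ≠ K} := by
  ext F
  constructor
  · rintro ⟨hF, hb, h1, h2⟩
    rw [hK.faces_eq] at hF
    obtain ⟨A, hA, rfl⟩ := hF
    rw [hK.isBounded_iff hA] at hb
    rw [hK.noUpperBoundary_iff hA] at h1
    rw [hK.noLowerBoundary_iff hA] at h2
    exact ⟨A, ⟨by tauto, Set.nonempty_iff_ne_empty.2 h2, h1⟩, rfl⟩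
  · rintro ⟨A, ⟨hlu, h0, h1⟩, rfl⟩
    have hA : A ∈ separable PointAbove K :=
      hlu.elim hK.separable_of_lower hK.separable_of_upper
    refine ⟨hK.faces_eq ▸ ⟨A, hA, rfl⟩, ?_, ?_, ?_⟩
    · rw [hK.isBounded_iff hA]; tauto
    · rwa [hK.noUpperBoundary_iff hA]
    · rw [hK.noLowerBoundary_iff hA]; exact h0.ne_empty

lemma GeneralPosition.leftFaces_eq (hK : GeneralPosition K) : leftFaces K =
    cell K '' {A | Upper Prod.fst K A ∧ A.Nonempty ∧ A ≠ K} := by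
  rw [leftFaces, hK.sideFaces_eq]
  ext F
  constructor
  · rintro ⟨⟨A, ⟨hlu, h⟩, rfl⟩, hb⟩
    rw [hK.bddBelow_iff (hlu.elim hK.separable_of_lower hK.separable_of_upper), not_not] at hb
    exact ⟨A, ⟨hb, h⟩, rfl⟩
  · rintro ⟨A, ⟨hu, h⟩, rfl⟩
    refine ⟨⟨A, ⟨Or.inr hu, h⟩, rfl⟩, ?_⟩
    rw [hK.bddBelow_iff (hK.separable_of_upper hu), not_not]
    exact hu

lemma GeneralPosition.rightFaces_eq (hK : GeneralPosition K) : rightFaces K =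
    cell K '' {A | Lower Prod.fst K A ∧ A.Nonempty ∧ A ≠ K} := by
  rw [rightFaces, hK.sideFaces_eq]
  ext F
  constructor
  · rintro ⟨⟨A, ⟨hlu, h⟩, rfl⟩, hb⟩
    rw [hK.bddAbove_iff (hlu.elim hK.separable_of_lower hK.separable_of_upper), not_not] at hb
    exact ⟨A, ⟨hb, h⟩, rfl⟩
  · rintro ⟨A, ⟨hl, h⟩, rfl⟩
    refine ⟨⟨A, ⟨Or.inl hl, h⟩, rfl⟩, ?_⟩
    rw [hK.bddAbove_iff (hK.separable_of_lower hl), not_not]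
    exact hl

lemma GeneralPosition.finiteFaces_eq (hK : GeneralPosition K) : finiteFaces K =
    cell K '' {A ∈ separable PointAbove K | ¬ Lower Prod.fst K A ∧ ¬ Upper Prod.fst K A} := by
  rw [finiteFaces, hK.faces_eq]
  ext F
  constructor
  · rintro ⟨⟨A, hA, rfl⟩, hb⟩
    exact ⟨A, ⟨hA, (hK.isBounded_iff hA).1 hb⟩, rfl⟩
  · rintro ⟨A, ⟨hA, h⟩, rfl⟩
    exact ⟨⟨A, hA, rfl⟩, (hK.isBounded_iff hA).2 h⟩

/-- Different separable sets have different cells, so counting faces amounts to counting sets. -/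
lemma GeneralPosition.encard_numEdges (hK : GeneralPosition K) {S : Set (Set (ℝ × ℝ))}
    (hS : S ⊆ separable PointAbove K) (n : ℕ∞) :
    {F ∈ cell K '' S | numEdges K F = n}.encard =
      {A ∈ S | degree PointAbove K A = n}.encard := by
  rw [← (hK.cell_injOn.mono fun A (hA : A ∈ {A ∈ S | degree PointAbove K A = n}) =>
    hS hA.1).encard_image]
  congr 1
  ext F
  constructor
  · rintro ⟨⟨A, hA, rfl⟩, h⟩
    rw [hK.numEdges_cell (hS hA)] at h
    exact ⟨A, ⟨hA, h⟩, rfl⟩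
  · rintro ⟨A, ⟨hA, h⟩, rfl⟩
    refine ⟨⟨A, hA, rfl⟩, ?_⟩
    rwa [hK.numEdges_cell (hS hA)]

end Faces
end Koch
end

theorem mainTheorem2 (s : ℕ) (hs : 1 ≤ s) :
    (∃ K, Koch.IsKochChain s K) ∧
    ∀ K : Set (ℝ × ℝ), Koch.IsKochChain s K →
      -- the infinite face without upper boundary
      (∃! F, F ∈ Koch.faces K ∧ ¬ Bornology.IsBounded F ∧ Koch.NoUpperBoundary F) ∧
      (∀ F ∈ Koch.faces K, Koch.NoUpperBoundary F → Koch.numEdges K F = 3) ∧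
      -- the infinite face without lower boundary
      (∃! F, F ∈ Koch.faces K ∧ ¬ Bornology.IsBounded F ∧ Koch.NoLowerBoundary F) ∧
      (∀ F ∈ Koch.faces K, Koch.NoLowerBoundary F → Koch.numEdges K F = 2) ∧
      -- the remaining infinite faces: each is unbounded towards exactly one side
      Koch.leftFaces K ∪ Koch.rightFaces K = Koch.sideFaces K ∧
      Disjoint (Koch.leftFaces K) (Koch.rightFaces K) ∧
      {F ∈ Koch.leftFaces K | Koch.numEdges K F = 4}.encard = ((s - 1 : ℕ) : ℕ∞) ∧
      (∀ F ∈ Koch.leftFaces K, Koch.numEdges K F ≠ 4 →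
        Koch.numEdges K F = 2 ∨ Koch.numEdges K F = 3) ∧
      {F ∈ Koch.rightFaces K | Koch.numEdges K F = 4}.encard = ((s - 1 : ℕ) : ℕ∞) ∧
      (∀ F ∈ Koch.rightFaces K, Koch.numEdges K F ≠ 4 →
        Koch.numEdges K F = 2 ∨ Koch.numEdges K F = 3) ∧
      -- the finite faces; the first line says that `3 * 2 ^ (s - 1) - 2 * s - 1` are pentagons
      {F ∈ Koch.finiteFaces K | Koch.numEdges K F = 5}.encard + ((2 * s + 1 : ℕ) : ℕ∞)
        = ((3 * 2 ^ (s - 1) : ℕ) : ℕ∞) ∧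
      (∀ F ∈ Koch.finiteFaces K, Koch.numEdges K F ≠ 5 →
        Koch.numEdges K F = 3 ∨ Koch.numEdges K F = 4) := by
  obtain ⟨r, rfl⟩ : ∃ r, s = r + 1 := ⟨s - 1, by omega⟩
  refine ⟨Koch.exists_isKochChain r, fun K hchain => ?_⟩
  obtain ⟨hgeo, r', hr', hc⟩ := hchain.geometry_counts
  obtain rfl : r = r' := by omega
  have hK := hgeo.generalPosition
  have hselfL := Koch.lower_self K
  have hemptyL := Koch.lower_empty K
  have hself := hK.separable_of_lower hselfL
  have hempty := hK.separable_of_lower hemptyL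
  have hup : ∀ F ∈ Koch.faces K, Koch.NoUpperBoundary F → F = Koch.cell K K := by
    rw [hK.faces_eq]
    rintro _ ⟨A, hA, rfl⟩ h
    rw [(hK.noUpperBoundary_iff hA).1 h]
  have hlo : ∀ F ∈ Koch.faces K, Koch.NoLowerBoundary F → F = Koch.cell K ∅ := by
    rw [hK.faces_eq]
    rintro _ ⟨A, hA, rfl⟩ h
    rw [(hK.noLowerBoundary_iff hA).1 h]
  refine ⟨⟨Koch.cell K K, ⟨hK.faces_eq ▸ ⟨K, hself, rfl⟩, ?_, ?_⟩, fun F hF => hup F hF.1 hF.2.2⟩,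
    ?_, ⟨Koch.cell K ∅, ⟨hK.faces_eq ▸ ⟨∅, hempty, rfl⟩, ?_, ?_⟩,
      fun F hF => hlo F hF.1 hF.2.2⟩, ?_, ?_, ?_, ?_, ?_, ?_, ?_, ?_, ?_⟩
  · rw [hK.isBounded_iff hself]; tauto
  · rw [hK.noUpperBoundary_iff hself]
  · intro F hF h
    rw [hup F hF h, hK.numEdges_cell hself, hc.degree_self]
  · rw [hK.isBounded_iff hempty]; tauto
  · rw [hK.noLowerBoundary_iff hempty]
  · intro F hF h
    rw [hlo F hF h, hK.numEdges_cell hempty, hc.degree_empty]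
  · rw [hK.leftFaces_eq, hK.rightFaces_eq, hK.sideFaces_eq, ← Set.image_union]
    congr 1
    ext A
    simp only [Set.mem_union, Set.mem_ofPred_eq]
    tauto
  · rw [hK.leftFaces_eq, hK.rightFaces_eq, Set.disjoint_left]
    rintro _ ⟨A, ⟨hu, h0, hne⟩, rfl⟩ ⟨B, ⟨hl, -⟩, h⟩
    have hAB := hK.cell_injOn (hK.separable_of_lower hl) (hK.separable_of_upper hu) h
    exact hne (hK.eq_of_lower_of_upper (hAB ▸ hl) hu h0)
  · rw [hK.leftFaces_eq, hK.encard_numEdges fun A hA => hK.separable_of_upper hA.1,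
      Nat.add_sub_cancel, ← hc.upper_count]
    congr 1
    ext A
    simp only [Set.mem_ofPred_eq]
    tauto
  · rw [hK.leftFaces_eq]
    rintro _ ⟨A, ⟨hu, h0, hne⟩, rfl⟩ h4
    rw [hK.numEdges_cell (hK.separable_of_upper hu)] at h4 ⊢
    have := hc.upper_degree A hu h0 hne
    tauto
  · rw [hK.rightFaces_eq, hK.encard_numEdges fun A hA => hK.separable_of_lower hA.1,
      Nat.add_sub_cancel, ← hc.lower_count]
    congr 1
    ext A
    simp only [Set.mem_ofPred_eq]
    tauto
  · rw [hK.rightFaces_eq]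
    rintro _ ⟨A, ⟨hu, h0, hne⟩, rfl⟩ h4
    rw [hK.numEdges_cell (hK.separable_of_lower hu)] at h4 ⊢
    have := hc.lower_degree A hu h0 hne
    tauto
  · rw [hK.finiteFaces_eq, hK.encard_numEdges fun A hA => hA.1, Nat.add_sub_cancel,
      ← hc.inner_count]
    -- The offsets `2 * (r + 1) + 1` and `2 * r + 3` agree by computation; only the two sets remain
    -- to be compared.
    congr 2
    ext A
    simp only [Set.mem_ofPred_eq]
    tauto
  · rw [hK.finiteFaces_eq]
    rintro _ ⟨A, ⟨hA, hl, hu⟩, rfl⟩ h5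
    rw [hK.numEdges_cell hA] at h5 ⊢
    have := hc.inner_degree A hA hl hu
    tauto
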